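/- Let $f=\frac1n\sum_{i=1}^n f_i$ $(n\ge 1)$ and consider $$\min_{x\in\mathbb R^d} f(x)+h(x)\quad\text{s.t. } g_k(x)\le 0,\ 1\le k\le m, \tag{P}$$ where $f_i,g_k:\mathbb R^d\to\mathbb R$ are convex, $f_i$ is $L_f$-smooth, $g_k$ is $L_g$-smooth ($L_f,L_g\ge 0$), and $h$ is a proper closed convex function with values in $\mathbb R\cup\{+\infty\}$ and effective domain $\mathcal K$. Assume that (P) has a solution $x_\star$; that there are $\nu>0$, $\tilde B$ and $\tilde x\in\mathcal K$ with $g_k(\tilde x)\le-\nu$ for all $k$ and $f(\tilde x)+h(\tilde x)-f(x_\star)-h(x_\star)\le\tilde B$; and that $\gamma\ge\tilde B/\nu$. Write $[a]_+=\max\{a,0\}$, $F(x)=f(x)+h(x)+\gamma\max_k[g_k(x)]_+$ and $L_\gamma=L_f+\gamma L_g>0$. The initial point $x_0\in\mathcal K$ (possibly infeasible) satisfies $\|x_0-x_\star\|\le B_x$ and $f(x_0)+h(x_0)+\gamma\sum_k[g_k(x_0)]_+-f(x_\star)-h(x_\star)\le B_\gamma$. Put $D_0=2B_\gamma+\frac{3L_\gamma}{2}B_x^2$.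 The method VARAS, with parameters $\mu\ge0$, $T_s,\alpha_s,\beta_s,\omega_s,\theta_t$, starts from $\tilde x_0=z_0=x_0$. In epoch $s=1,\dots,S$ it computes $\nabla f(\tilde x_{s-1})$, sets $x_0=\tilde x_{s-1}$, and for $t=1,\dots,T_s$ samples $i_t$ uniformly from $\{1,\dots,n\}$ (all samples independent) and sets $$y_t=\frac{(1+\mu\beta_s)(1-\alpha_s-\omega_s)x_{t-1}+\alpha_s z_{t-1}+(1+\mu\beta_s)\omega_s\tilde x_{s-1}}{1+\mu\beta_s(1-\alpha_s)},\qquad z_{t-1}^+=\frac{z_{t-1}+\mu\beta_s y_t}{1+\mu\beta_s},$$ $$v_t=\nabla f_{i_t}(y_t)-\nabla f_{i_t}(\tilde x_{s-1})+\nabla f(\tilde x_{s-1}),$$ $$z_t=\arg\min_u\ \alpha_s\beta_s\Big(\langle v_t,u\rangle+\tfrac\mu2\|y_t-u\|^2+h(u)\Big)+\tfrac{\alpha_s}{2}\|z_{t-1}-u\|^2+\gamma\beta_s\max_k\big[g_k(y_t)+\alpha_s\langle\nabla g_k(y_t),u-z_{t-1}^+\rangle\big]_+,$$ $$x_t=(1-\alpha_s-\omega_s)x_{t-1}+\alpha_s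 z_t+\omega_s\tilde x_{s-1}.$$ At the end of the epoch, $\tilde x_s=\sum_t\theta_t x_t/\sum_t\theta_t$ and $z_0$ is reset to $z_{T_s}$. The output is $\tilde x_S$. The SFO is called $n$ times per epoch for the full gradient (whose components are stored) and once per iteration, and the QMO (which returns $z_t$) once per iteration, so that after $S$ epochs $N_{\rm SFO}=\sum_{s\le S}(n+T_s)$ and $N_{\rm QMO}=\sum_{s\le S}T_s$. Let $s_0=\lfloor\log_2 n\rfloor+1$, $\beta_s=\frac1{3\alpha_sL_\gamma}$, $\omega_s=\frac12$, $T_s=2^{s-1}$ for $s\le s_0$ and $T_s=T_{s_0}$ for $s>s_0$. Consider the weights $$\text{(a)}\ \ \theta_t=\tfrac{\beta_s}{\alpha_s}(\alpha_s+\omega_s)\ (1\le t<T_s),\quad \theta_{T_s}=\tfrac{\beta_s}{\alpha_s};$$ $$\text{(b)}\ \ \theta_t=\Gamma_{t-1}-(1-\alpha_s-\omega_s)\Gamma_t\ (1\le t<T_s),\quad \theta_{T_s}=\Gamma_{T_s-1},\qquad \Gamma_t=(1+\mu\beta_s)^t.$$ There is a universal constant $C$, hidden below in $\mathcal O(\cdot)$,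 such that the following holds for every $0<\varepsilon\le D_0$. **1. Convex case.** Run VARAS with $\mu=0$, $\alpha_s=\frac12$ for $s\le s_0$, $\alpha_s=\frac{2}{s-s_0+4}$ for $s>s_0$, and weights (a). There is a number of epochs $S$, depending only on $(n,D_0,\varepsilon)$, such that $\mathbb E F(\tilde x_S)-F(x_\star)\le\varepsilon$, with $$N_{\rm SFO}=\begin{cases}\mathcal O\big(n\log\frac{D_0}{\varepsilon}\big)& n\ge\frac{D_0}{\varepsilon}\\ \mathcal O\big(n\log n+\sqrt{nD_0/\varepsilon}\big)& n<\frac{D_0}{\varepsilon}\end{cases}\qquad N_{\rm QMO}=\begin{cases}\mathcal O\big(\frac{D_0}{\varepsilon}\big)& n\ge\frac{D_0}{\varepsilon}\\ \mathcal O\big(\sqrt{nD_0/\varepsilon}\big)& n<\frac{D_0}{\varepsilon}.\end{cases}$$ **2. Strongly convex case.** Let moreover $f$ be $\mu$-strongly convex with $\mu>0$ and $\kappa=L_\gamma/\mu$. Run VARAS with $\alpha_s=\frac12$ for $s\le s_0$, $\alpha_s=\max\{\frac2{s-s_0+4},\min\{\sqrt{\frac n{3\kappa}},\frac12\}\}$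 for $s>s_0$, and weights (a) if $s\le s_0$, or if $s_0<s\le s_0+\sqrt{12\kappa/n}-4$ and $n<\frac{3\kappa}4$, and weights (b) otherwise. There is a number of epochs $S$, depending only on $(n,\kappa,D_0,\varepsilon)$, such that $\mathbb E F(\tilde x_S)-F(x_\star)\le\varepsilon$ and $\mathbb E\|\tilde x_S-x_\star\|^2\le 2\varepsilon/\mu$, with $$N_{\rm SFO}=\begin{cases}\mathcal O\big(n\log\frac{D_0}{\varepsilon}\big)& n\ge\frac{D_0}\varepsilon\text{ or }n\ge\frac{3\kappa}4\\ \mathcal O\big(n\log n+\sqrt{nD_0/\varepsilon}\big)& n<\frac{D_0}\varepsilon\le\frac{3\kappa}4\\ \mathcal O\big(n\log n+\sqrt{n\kappa}\,(1+\log\frac{4D_0}{3\kappa\varepsilon})\big)& n<\frac{3\kappa}4\le\frac{D_0}\varepsilon\end{cases}$$ $$N_{\rm QMO}=\begin{cases}\mathcal O\big(\frac{D_0}\varepsilon\big)& n\ge\frac{D_0}\varepsilon\\ \mathcal O\big(n\log\frac{D_0}\varepsilon\big)& \frac{3\kappa}4\le n\le\frac{D_0}\varepsilon\\ \mathcal O\big(\sqrt{nD_0/\varepsilon}\big)&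 n<\frac{D_0}\varepsilon\le\frac{3\kappa}4\\ \mathcal O\big(n\log n+\sqrt{n\kappa}\,(1+\log\frac{4D_0}{3\kappa\varepsilon})\big)& n<\frac{3\kappa}4\le\frac{D_0}\varepsilon.\end{cases}$$ In both cases the output lies in $\mathcal K$ and also satisfies $\mathbb E[f(\tilde x_S)+h(\tilde x_S)]-f(x_\star)-h(x_\star)\le\varepsilon$ and $(\gamma-\tilde B/\nu)\,\mathbb E\max_k[g_k(\tilde x_S)]_+\le\varepsilon$; if $\gamma\ge\tilde B/\nu+m$ it is $\varepsilon$-optimal for (P), i.e. in addition $\sum_k\mathbb E[g_k(\tilde x_S)]_+\le\varepsilon$. -/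

import Mathlib

open MeasureTheory ProbabilityTheory

noncomputable section

namespace Varas

/-- The space `ℝ^d` with its Euclidean norm. -/
abbrev E (d : ℕ) : Type := EuclideanSpace ℝ (Fin d)

/-- `max {0, v₁, …, v_m}`; it is `0` when `m = 0`. -/
def maxPos {m : ℕ} (v : Fin m → ℝ) : ℝ := (Finset.univ : Finset (Fin m)).fold max 0 v

/-- `φ` is `L`-smooth: differentiable with an `L`-Lipschitz gradient. -/
def IsSmooth {d : ℕ} (L : ℝ) (φ : E d → ℝ) : Prop :=
  Differentiable ℝ φ ∧ ∀ x y, ‖gradient φ x - gradient φ y‖ ≤ L * ‖x - y‖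

/-- A minimizer of `φ` over `K` (an arbitrary point if there is none). -/
def argminOn {d : ℕ} (K : Set (E d)) (φ : E d → ℝ) : E d :=
  Classical.epsilon fun u => u ∈ K ∧ ∀ v ∈ K, φ u ≤ φ v

/-- Data of a finite-sum constrained problem
`min (1/n) ∑ fᵢ(x) + h(x)` subject to `g_k(x) ≤ 0`, together with a reference solution,
an initial point and the problem constants.
The regularizer is the extended-valued function equal to `h` on `K` and to `+∞` off `K`. -/
structure Instance (n d m : ℕ) where
  /-- the components of the smooth part of the objective -/
  f : Fin n → E d → ℝ
  /-- the constraint functions -/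
  g : Fin m → E d → ℝ
  /-- the regularizer (only its values on `K` matter) -/
  h : E d → ℝ
  /-- the effective domain of the regularizer -/
  K : Set (E d)
  /-- a solution of the constrained problem -/
  xs : E d
  /-- the initial point, possibly infeasible -/
  x0 : E d
  /-- smoothness constant of the `fᵢ` -/
  Lf : ℝ
  /-- smoothness constant of the `g_k` -/
  Lg : ℝ
  /-- the Slater margin -/
  nu : ℝ
  /-- bound on the optimality gap at the Slater point -/
  Bt : ℝ
  /-- the penalty parameter -/
  γ : ℝ
  /-- bound on the initial distance -/
  Bx : ℝ
  /-- bound on the initial penalized gap -/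
  Bγ : ℝ

namespace Instance

variable {n d m : ℕ} (A : Instance n d m)

/-- `f = (1/n) ∑ fᵢ`. -/
def favg (x : E d) : ℝ := (1 / (n : ℝ)) * ∑ i, A.f i x

/-- The objective `f + h`, on the effective domain. -/
def obj (x : E d) : ℝ := A.favg x + A.h x

/-- The constraint violation `max_k [g_k(x)]₊`. -/
def viol (x : E d) : ℝ := maxPos fun k => A.g k x

/-- The exact penalty function `F = f + h + γ max_k [g_k]₊`, on the effective domain. -/
def F (x : E d) : ℝ := A.obj x + A.γ * A.viol x

def Feasible (x : E d) : Prop := x ∈ A.K ∧ ∀ k, A.g k x ≤ 0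

/-- `x` solves the constrained problem. -/
def IsSolution (x : E d) : Prop := A.Feasible x ∧ ∀ u, A.Feasible u → A.obj x ≤ A.obj u

/-- `L_γ = L_f + γ L_g`. -/
def Lγ : ℝ := A.Lf + A.γ * A.Lg

/-- `D₀ = 2 B_γ + (3 L_γ / 2) B_x²`. -/
def D0 : ℝ := 2 * A.Bγ + 3 * A.Lγ / 2 * A.Bx ^ 2

/-- The standing assumptions. -/
structure Assumptions : Prop where
  f_convex : ∀ i, ConvexOn ℝ Set.univ (A.f i)
  f_smooth : ∀ i, IsSmooth A.Lf (A.f i)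
  g_convex : ∀ k, ConvexOn ℝ Set.univ (A.g k)
  g_smooth : ∀ k, IsSmooth A.Lg (A.g k)
  /-- the regularizer is convex (this includes convexity of `K`) -/
  h_convex : ConvexOn ℝ A.K A.h
  /-- the regularizer is closed: it has a closed epigraph -/
  h_closed : IsClosed {p : E d × ℝ | p.1 ∈ A.K ∧ A.h p.1 ≤ p.2}
  Lf_nonneg : 0 ≤ A.Lf
  Lg_nonneg : 0 ≤ A.Lg
  Lγ_pos : 0 < A.Lγ
  solution : A.IsSolution A.xs
  nu_pos : 0 < A.nu
  slater : ∃ x ∈ A.K, (∀ k, A.g k x ≤ -A.nu) ∧ A.obj x - A.obj A.xs ≤ A.Bt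
  penalty : A.Bt / A.nu ≤ A.γ
  x0_mem : A.x0 ∈ A.K
  init_dist : ‖A.x0 - A.xs‖ ≤ A.Bx
  init_gap : A.obj A.x0 + A.γ * ∑ k, max (A.g k A.x0) 0 - A.obj A.xs ≤ A.Bγ

end Instance

/-! ### The algorithm -/

/-- The inputs of the algorithm: epoch lengths `T_s`, parameters `α_s, β_s, ω_s`
and averaging weights `θ_t` of epoch `s` (written `θ s t`). -/
structure Schedule where
  T : ℕ → ℕ
  α : ℕ → ℝ
  β : ℕ → ℝ
  ω : ℕ → ℝ
  θ : ℕ → ℕ → ℝ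

/-- State inside an epoch: `x_t`, `z_t`, the partial sum `∑_{j ≤ t} θ_j x_j`, and the numbers of
first-order and quadratic-minimization oracle calls made so far. -/
structure Inner (d : ℕ) where
  x : E d
  z : E d
  acc : E d
  sfo : ℕ
  qmo : ℕ

/-- State between epochs: `x̃_s`, the last `z`, and the oracle counters. -/
structure Outer (d : ℕ) where
  xt : E d
  z : E d
  sfo : ℕ
  qmo : ℕ

section Algorithm

variable {n d m : ℕ} (A : Instance n d m) (μ : ℝ) (P : Schedule)

/-- Iteration `t` of epoch `s` with sampled index `i`. Here `xt = x̃_{s-1}` and `G j = ∇f_j(x̃_{s-1})`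
are the gradients stored at the start of the epoch. The iteration makes one first-order oracle call
(for `∇f_i`, `g_k`, `∇g_k` at `y`) and one call to the quadratic minimization oracle. -/
def innerStep (s t : ℕ) (xt : E d) (G : Fin n → E d) (i : Fin n) (st : Inner d) : Inner d :=
  let α := P.α s
  let β := P.β s
  let ω := P.ω s
  let y : E d :=
    (1 / (1 + μ * β * (1 - α))) •
      (((1 + μ * β) * (1 - α - ω)) • st.x + α • st.z + ((1 + μ * β) * ω) • xt)
  let zp : E d := (1 / (1 + μ * β)) • (st.z + (μ * β) • y)
  let v : E d := gradient (A.f i) y - G i + (1 / (n : ℝ)) • ∑ j, G j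
  let z' : E d := argminOn A.K fun u =>
    α * β * (inner ℝ v u + μ / 2 * ‖y - u‖ ^ 2 + A.h u) + α / 2 * ‖st.z - u‖ ^ 2
      + A.γ * β * maxPos fun k => A.g k y + α * inner ℝ (gradient (A.g k) y) (u - zp)
  let x' : E d := (1 - α - ω) • st.x + α • z' + ω • xt
  { x := x'
    z := z'
    acc := st.acc + P.θ s t • x'
    sfo := st.sfo + 1
    qmo := st.qmo + 1 }

/-- The state after `t` iterations of epoch `s`, when index `I t` is sampled at iteration `t`. -/
def innerRun (s : ℕ) (xt : E d) (G : Fin n → E d) (I : ℕ → Fin n) (init : Inner d) : ℕ → Inner d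
  | 0 => init
  | t + 1 => innerStep A μ P s (t + 1) xt G (I (t + 1)) (innerRun s xt G I init t)

/-- Epoch `s`. Forming the full gradient at `x̃_{s-1}` takes `n` first-order oracle calls. -/
def epoch (s : ℕ) (I : ℕ → Fin n) (o : Outer d) : Outer d :=
  let G : Fin n → E d := fun j => gradient (A.f j) o.xt
  let st := innerRun A μ P s o.xt G I
    { x := o.xt, z := o.z, acc := 0, sfo := o.sfo + n, qmo := o.qmo } (P.T s)
  { xt := (1 / ∑ t ∈ Finset.Icc 1 (P.T s), P.θ s t) • st.acc
    z := st.z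
    sfo := st.sfo
    qmo := st.qmo }

/-- The state after `S` epochs, when index `I s t` is sampled at iteration `t` of epoch `s`.
The output of the algorithm is the component `xt`. -/
def run (I : ℕ → ℕ → Fin n) : ℕ → Outer d
  | 0 => { xt := A.x0, z := A.x0, sfo := 0, qmo := 0 }
  | s + 1 => epoch A μ P (s + 1) (I (s + 1)) (run I s)

end Algorithm

/-! ### The parameter choices -/

/-- `s₀ = ⌊log₂ n⌋ + 1`. -/
def s0 (n : ℕ) : ℕ := Nat.log 2 n + 1

/-- `T_s = 2^(s-1)` for `s ≤ s₀` and `T_s = T_{s₀}` for `s > s₀`. -/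
def epochLength (n s : ℕ) : ℕ := if s ≤ s0 n then 2 ^ (s - 1) else 2 ^ (s0 n - 1)

/-- The weights `θ_t = (β/α)(α + ω)` for `t ≤ T - 1` and `θ_T = β/α`. -/
def thetaPlain (α β ω : ℝ) (T t : ℕ) : ℝ :=
  if t < T then β / α * (α + ω) else β / α

/-- The weights `θ_t = Γ_{t-1} - (1 - α - ω) Γ_t` for `t ≤ T - 1` and `θ_T = Γ_{T-1}`,
where `Γ_t = (1 + μ β)^t`. -/
def thetaGeom (μ α β ω : ℝ) (T t : ℕ) : ℝ :=
  if t < T then (1 + μ * β) ^ (t - 1) - (1 - α - ω) * (1 + μ * β) ^ t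
  else (1 + μ * β) ^ (t - 1)

def alphaConvex (n s : ℕ) : ℝ :=
  if s ≤ s0 n then 1 / 2 else 2 / ((s : ℝ) - s0 n + 4)

def alphaStrong (n : ℕ) (κ : ℝ) (s : ℕ) : ℝ :=
  if s ≤ s0 n then 1 / 2
  else max (2 / ((s : ℝ) - s0 n + 4)) (min (√(n / (3 * κ))) (1 / 2))

/-- Parameters for convex problems, with `L` in place of `L_γ`. -/
def scheduleConvex (n : ℕ) (L : ℝ) : Schedule where
  T := epochLength n
  α := alphaConvex n
  β s := 1 / (3 * alphaConvex n s * L)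
  ω _ := 1 / 2
  θ s t := thetaPlain (alphaConvex n s) (1 / (3 * alphaConvex n s * L)) (1 / 2) (epochLength n s) t

open Classical in
/-- Parameters for `μ`-strongly convex problems, with `L` in place of `L_γ`. -/
def scheduleStrong (n : ℕ) (L μ : ℝ) : Schedule where
  T := epochLength n
  α := alphaStrong n (L / μ)
  β s := 1 / (3 * alphaStrong n (L / μ) s * L)
  ω _ := 1 / 2
  θ s t :=
    let α := alphaStrong n (L / μ) s
    let β := 1 / (3 * α * L)
    if s ≤ s0 n ∨
        ((s : ℝ) ≤ s0 n + √(12 * (L / μ) / n) - 4 ∧ (n : ℝ) < 3 * (L / μ) / 4) then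
      thetaPlain α β (1 / 2) (epochLength n s) t
    else
      thetaGeom μ α β (1 / 2) (epochLength n s) t

/-! ### Sampling and accuracy -/

/-- The indices `I s t` are independent and uniform on `{1, …, n}`. -/
structure UniformSampling {n : ℕ} {Ω : Type*} [MeasurableSpace Ω] (Q : Measure Ω)
    (I : ℕ → ℕ → Ω → Fin n) : Prop where
  meas : ∀ s t, Measurable (I s t)
  indep : iIndepFun (fun p : ℕ × ℕ => I p.1 p.2) Q
  unif : ∀ s t i, Q.real {ω | I s t ω = i} = 1 / (n : ℝ)

section Accuracy

variable {n d m : ℕ} (A : Instance n d m) {Ω : Type*} [MeasurableSpace Ω] (Q : Measure Ω)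
  (X : Ω → E d) (ε : ℝ)

/-- `X` is an `ε`-optimal (random) solution of the constrained problem: the expected optimality gap
and the expected total constraint violation are at most `ε`. -/
structure IsEpsOptimal : Prop where
  mem : ∀ ω, X ω ∈ A.K
  int_obj : Integrable (fun ω => A.obj (X ω)) Q
  int_g : ∀ k, Integrable (fun ω => max (A.g k (X ω)) 0) Q
  gap : (∫ ω, A.obj (X ω) ∂Q) - A.obj A.xs ≤ ε
  violation : ∑ k, ∫ ω, max (A.g k (X ω)) 0 ∂Q ≤ ε

/-- Accuracy `ε` in terms of the exact penalty function, with what it entails for the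
objective gap and the constraint violation. -/
structure Attains : Prop where
  mem : ∀ ω, X ω ∈ A.K
  int_obj : Integrable (fun ω => A.obj (X ω)) Q
  int_viol : Integrable (fun ω => A.viol (X ω)) Q
  penalized_gap : (∫ ω, A.F (X ω) ∂Q) - A.F A.xs ≤ ε
  gap : (∫ ω, A.obj (X ω) ∂Q) - A.obj A.xs ≤ ε
  violation : (A.γ - A.Bt / A.nu) * ∫ ω, A.viol (X ω) ∂Q ≤ ε
  eps_optimal : A.Bt / A.nu + m ≤ A.γ → IsEpsOptimal A Q X ε

end Accuracy

end Varas

end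

/-!
The proof follows the potential argument for accelerated variance reduction, with the constraints
entering only through the exact penalty function `F = f + h + γ max_k [g_k]₊`.

*Exactness of the penalty.* Combining a point of `K` with the Slater point until the constraints
hold shows that `f + h` can drop below the optimal value by at most `(B̃/ν) max_k [g_k]₊`
(`obj_sub_ge`). Hence `x⋆` minimizes `F` over `K`, and a bound on the expected gap
`E F(x̃_S) - F(x⋆)` implies every other accuracy claim (`attains`, `expected_sq_dist_le`).

*One iteration.* The point `y_t` is chosen so that `x_t - y_t = α (z_t - z_{t-1}⁺)`. Therefore the
linearized constraints in the proximal subproblem are the linearizations at `y_t` evaluated at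
`x_t`; they are lower bounds for the constraints, and exact up to `L_g/2 ‖x_t - y_t‖²`. The
three-point inequality of the proximal step, with `β = 1/(3 α L_γ)`, leaves a multiple of
`‖z_t - z_{t-1}⁺‖²` that pays for the curvature of `F` and for one half of the gradient noise
(`step_le`). The variance of the noise is at most a Bregman divergence of `f` between `x̃` and `y_t`,
which is what is needed to turn the linearization of `f` at `y_t`, taken at `x̃`, into `f(x̃)`.
With `Δ = F - F(x⋆)` and `c = 3 α² L_γ / 2` this gives, in expectation (`expected_step_le`),
`Δ(x_t) + c (1 + μβ) ‖z_t - x⋆‖² ≤ (1/2 - α) Δ(x_{t-1}) + Δ(x̃)/2 + c ‖z_{t-1} - x⋆‖²`.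
The trajectory up to any iteration is a function of finitely many independent indices, so taking
expectations only needs `UniformSampling.integral_avg`.

*Epochs.* Summing with weights `1` or `(1 + μβ)^(t-1)` gives one inequality per epoch
(`epoch_plain`, `epoch_geom`). In the first `s₀` epochs the gap halves (`warmup_phase`); with
`α = 2/(k + 5)` it decays like `D₀/(k² n)` (`sublinear_phase`); once `α` is constant, it decays
geometrically, by `4/5` per epoch if `n ≥ 3κ/4` (`expGap_linear_half`) and by
`1 + √(n/(3κ))/2` otherwise (`expGap_linear`).

*Number of epochs.* If `n ≥ D₀/ε` or `D₀/ε < 2` the warm-up alone suffices, possibly with no epoch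
at all since `F(x₀) - F(x⋆) ≤ D₀/2`. Otherwise one stops in the first phase whose rate reaches `ε`.
Since `√(12κ/n)` need not be an integer, `α` can become constant before the sublinear phase has
reached `ε` even if `D₀/ε < 3κ/4`. In that case `D₀/ε` is still bounded below by a multiple of `κ`,
and the cost of the linear phase is absorbed in `√(n D₀/ε)`.
-/

namespace Varas

/-! ### The function `max {0, v₁, …, v_m}` -/

section MaxPos

variable {m : ℕ}

lemma maxPos_nonneg (v : Fin m → ℝ) : 0 ≤ maxPos v :=
  Finset.le_fold_max _ |>.2 (Or.inl le_rfl)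

lemma le_maxPos (v : Fin m → ℝ) (k : Fin m) : v k ≤ maxPos v :=
  Finset.le_fold_max _ |>.2 (Or.inr ⟨k, Finset.mem_univ k, le_rfl⟩)

lemma maxPos_le {v : Fin m → ℝ} {c : ℝ} (hc : 0 ≤ c) (h : ∀ k, v k ≤ c) : maxPos v ≤ c :=
  Finset.fold_max_le _ |>.2 ⟨hc, fun k _ => h k⟩

lemma maxPos_mono {v w : Fin m → ℝ} (h : ∀ k, v k ≤ w k) : maxPos v ≤ maxPos w :=
  maxPos_le (maxPos_nonneg w) fun k => (h k).trans (le_maxPos w k)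

lemma maxPos_le_add {v w : Fin m → ℝ} {c : ℝ} (hc : 0 ≤ c) (h : ∀ k, v k ≤ w k + c) :
    maxPos v ≤ maxPos w + c :=
  maxPos_le (add_nonneg (maxPos_nonneg w) hc) fun k =>
    (h k).trans (by gcongr; exact le_maxPos w k)

lemma maxPos_comb {u v w : Fin m → ℝ} {a b : ℝ} (ha : 0 ≤ a) (hb : 0 ≤ b)
    (h : ∀ k, u k ≤ a * v k + b * w k) : maxPos u ≤ a * maxPos v + b * maxPos w :=
  maxPos_le (by have := maxPos_nonneg v; have := maxPos_nonneg w; positivity) fun k =>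
    (h k).trans (by gcongr <;> exact le_maxPos _ k)

lemma continuous_maxPos {X : Type*} [TopologicalSpace X] {v : X → Fin m → ℝ}
    (hv : ∀ k, Continuous fun x => v x k) : Continuous fun x => maxPos (v x) := by
  classical
  have : ∀ s : Finset (Fin m), Continuous fun x => s.fold max 0 (v x) := by
    intro s
    induction s using Finset.induction_on with
    | empty => simpa using continuous_const
    | insert a s ha ih =>
      simp only [Finset.fold_insert ha]
      exact (hv a).max ih
  exact this _

end MaxPos

/-! ### Smooth and strongly convex functions -/

section Smooth

variable {d : ℕ}

/-- Along the segment from `y` to `x`, a differentiable function has derivative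
`⟨∇φ, x - y⟩`. -/
lemma hasDerivAt_line {φ : E d → ℝ} (hφ : Differentiable ℝ φ) (y w : E d) (t : ℝ) :
    HasDerivAt (fun t : ℝ => φ (y + t • w)) (inner ℝ (gradient φ (y + t • w)) w) t := by
  have h1 : HasDerivAt (fun t : ℝ => y + t • w) w t := by
    simpa using ((hasDerivAt_id t).smul_const w).const_add y
  have h2 := (hφ (y + t • w)).hasFDerivAt.comp_hasDerivAt t h1
  rwa [← inner_gradient_left] at h2

/-- Letting `t → 0` in `(1 - t) c ≤ a`. -/
lemma le_of_forall_mul_one_sub_le {a c : ℝ} (h : ∀ t : ℝ, 0 < t → t < 1 → (1 - t) * c ≤ a) :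
    c ≤ a := by
  by_contra hlt
  push Not at hlt
  rcases le_or_gt c 0 with hc | hc
  · have := h (1 / 2) (by norm_num) (by norm_num)
    linarith
  · have h1 := h ((c - max a 0) / (2 * c)) (by
      have : max a 0 < c := max_lt hlt hc
      have : 0 < c - max a 0 := by linarith
      positivity) (by
        rw [div_lt_one (by positivity)]
        have := le_max_right a 0
        linarith)
    have h2 : (1 - (c - max a 0) / (2 * c)) * c = c - (c - max a 0) / 2 := by
      field_simp
    rw [h2] at h1
    have : max a 0 < c := max_lt hlt hc
    have := le_max_left a 0
    linarith

/-- First-order characterization of strong convexity. -/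
lemma StrongConvexOn.first_order {μ : ℝ} {φ : E d → ℝ} (hc : StrongConvexOn Set.univ μ φ)
    {y G : E d} (hG : HasGradientAt φ G y) (x : E d) :
    φ y + inner ℝ G (x - y) + μ / 2 * ‖x - y‖ ^ 2 ≤ φ x := by
  have hline : HasDerivAt (fun t : ℝ => φ (y + t • (x - y))) (inner ℝ G (x - y)) 0 := by
    have h1 : HasDerivAt (fun t : ℝ => y + t • (x - y)) (x - y) 0 := by
      simpa using ((hasDerivAt_id (0 : ℝ)).smul_const (x - y)).const_add y
    have hG' : HasGradientAt φ G (y + (0 : ℝ) • (x - y)) := by simpa using hG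
    simpa [Function.comp_def] using hG'.hasFDerivAt.comp_hasDerivAt (0 : ℝ) h1
  have hslope := hline.tendsto_slope_zero_right
  have hrhs : Filter.Tendsto (fun t : ℝ => φ x - φ y - (1 - t) * (μ / 2 * ‖x - y‖ ^ 2))
      (nhdsWithin 0 (Set.Ioi 0)) (nhds (φ x - φ y - (1 - 0) * (μ / 2 * ‖x - y‖ ^ 2))) := by
    apply tendsto_nhdsWithin_of_tendsto_nhds
    exact Continuous.tendsto (by fun_prop) 0
  have hle := le_of_tendsto_of_tendsto hslope hrhs (by
    have hmem : Set.Ioo (0 : ℝ) 1 ∈ nhdsWithin (0 : ℝ) (Set.Ioi 0) :=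
      Ioo_mem_nhdsGT one_pos
    filter_upwards [hmem] with t ht
    have h := hc.2 (Set.mem_univ y) (Set.mem_univ x) (sub_nonneg.2 ht.2.le) ht.1.le (by ring)
    have e : (1 - t) • y + t • x = y + t • (x - y) := by module
    rw [e, norm_sub_rev y x] at h
    simp only [smul_eq_mul, zero_add, zero_smul, add_zero] at h ⊢
    rw [inv_mul_le_iff₀ ht.1]
    nlinarith [h])
  linarith

lemma ConvexOn.first_order {φ : E d → ℝ} (hc : ConvexOn ℝ Set.univ φ)
    {y G : E d} (hG : HasGradientAt φ G y) (x : E d) :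
    φ y + inner ℝ G (x - y) ≤ φ x := by
  have := StrongConvexOn.first_order (strongConvexOn_zero.2 hc) hG x
  simpa using this

/-- The descent lemma. -/
lemma IsSmooth.descent {L : ℝ} {φ : E d → ℝ} (h : IsSmooth L φ) (x y : E d) :
    φ x ≤ φ y + inner ℝ (gradient φ y) (x - y) + L / 2 * ‖x - y‖ ^ 2 := by
  set w := x - y with hw
  have hder : ∀ t : ℝ, HasDerivAt (fun t : ℝ => φ (y + t • w) - (t * inner ℝ (gradient φ y) w +
      L / 2 * ‖w‖ ^ 2 * t ^ 2))
      (inner ℝ (gradient φ (y + t • w)) w - (inner ℝ (gradient φ y) w +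
        L / 2 * ‖w‖ ^ 2 * (2 * t))) t := by
    intro t
    refine (hasDerivAt_line h.1 y w t).sub ?_
    convert! ((hasDerivAt_id t).mul_const (inner ℝ (gradient φ y) w)).add
      (((hasDerivAt_id t).pow 2).const_mul (L / 2 * ‖w‖ ^ 2)) using 1
    simp
  have hanti : AntitoneOn (fun t : ℝ => φ (y + t • w) - (t * inner ℝ (gradient φ y) w +
      L / 2 * ‖w‖ ^ 2 * t ^ 2)) (Set.Icc 0 1) := by
    apply antitoneOn_of_deriv_nonpos (convex_Icc 0 1)
    · exact fun t _ => (hder t).continuousAt.continuousWithinAt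
    · exact fun t _ => (hder t).differentiableAt.differentiableWithinAt
    · intro t ht
      rw [interior_Icc] at ht
      rw [(hder t).deriv]
      have h1 : inner ℝ (gradient φ (y + t • w) - gradient φ y) w ≤ L * ‖t • w‖ * ‖w‖ := by
        refine (real_inner_le_norm _ _).trans ?_
        gcongr
        simpa using h.2 (y + t • w) y
      rw [inner_sub_left, norm_smul, Real.norm_eq_abs, abs_of_pos ht.1] at h1
      nlinarith
  have := hanti (Set.left_mem_Icc.2 zero_le_one) (Set.right_mem_Icc.2 zero_le_one) zero_le_one
  simp only [one_smul, zero_smul, add_zero, one_pow, mul_one, one_mul, zero_mul] at this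
  have e : y + w = x := by simp [hw]
  rw [e, zero_pow two_ne_zero] at this
  linarith

/-- Differences of gradients of a smooth convex function are controlled by its Bregman
divergence. -/
lemma IsSmooth.sq_gradient_sub_le {L : ℝ} (hL : 0 ≤ L) {φ : E d → ℝ} (h : IsSmooth L φ)
    (hc : ConvexOn ℝ Set.univ φ) (x y : E d) :
    ‖gradient φ x - gradient φ y‖ ^ 2 ≤
      2 * L * (φ x - φ y - inner ℝ (gradient φ y) (x - y)) := by
  rcases hL.eq_or_lt with rfl | hL
  · have := h.2 x y
    have h0 : ‖gradient φ x - gradient φ y‖ = 0 :=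
      le_antisymm (by simpa using this) (norm_nonneg _)
    simp [h0]
  set w := gradient φ x - gradient φ y with hw
  -- a gradient step of length `1 / L` for `φ - ⟨∇φ y, ·⟩`, whose minimizer is `y`
  have h1 := h.descent (x - (1 / L) • w) x
  have h2 := ConvexOn.first_order hc (h.1 y).hasGradientAt (x - (1 / L) • w)
  have e1 : x - (1 / L) • w - x = -((1 / L) • w) := by abel
  have e2 : x - (1 / L) • w - y = (x - y) - (1 / L) • w := by abel
  rw [e1, inner_neg_right, norm_neg, inner_smul_right, norm_smul, Real.norm_eq_abs,
    abs_of_pos (by positivity)] at h1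
  rw [e2, inner_sub_right, inner_smul_right] at h2
  have e3 : inner ℝ (gradient φ x) w - inner ℝ (gradient φ y) w = ‖w‖ ^ 2 := by
    rw [← inner_sub_left, ← hw, real_inner_self_eq_norm_sq]
  have h3 : 1 / L * ‖w‖ ^ 2 - L / 2 * (1 / L * ‖w‖) ^ 2 ≤
      φ x - φ y - inner ℝ (gradient φ y) (x - y) := by
    rw [← e3]; nlinarith
  have e4 : 1 / L * ‖w‖ ^ 2 - L / 2 * (1 / L * ‖w‖) ^ 2 = ‖w‖ ^ 2 / (2 * L) := by
    field_simp; ring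
  rw [e4, div_le_iff₀ (by positivity)] at h3
  linarith

end Smooth

/-! ### Proximal subproblems -/

section Prox

variable {d : ℕ}

lemma argminOn_spec {K : Set (E d)} {φ : E d → ℝ} (h : ∃ u ∈ K, ∀ v ∈ K, φ u ≤ φ v) :
    argminOn K φ ∈ K ∧ ∀ v ∈ K, φ (argminOn K φ) ≤ φ v := by
  obtain ⟨u, hu⟩ := h
  exact Classical.epsilon_spec (p := fun u => u ∈ K ∧ ∀ v ∈ K, φ u ≤ φ v) ⟨u, hu⟩

/-- A closed convex function decreases at most linearly. -/
lemma exists_linear_lower_bound {K : Set (E d)} {h : E d → ℝ} (hc : ConvexOn ℝ K h)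
    (hcl : IsClosed {p : E d × ℝ | p.1 ∈ K ∧ h p.1 ≤ p.2}) {w : E d} (hw : w ∈ K) :
    ∃ C : ℝ, 0 ≤ C ∧ ∀ u ∈ K, -C * (1 + ‖u - w‖) ≤ h u := by
  -- `h` is bounded below on the unit ball around `w`: otherwise, the epigraph being closed, a
  -- limit point `a` of points with `h → -∞` would satisfy `h a ≤ c` for every `c`
  obtain ⟨B, hB⟩ : ∃ B : ℝ, ∀ u ∈ K, ‖u - w‖ ≤ 1 → -B ≤ h u := by
    by_contra hcon
    push Not at hcon
    choose u huK hub huh using fun k : ℕ => hcon k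
    have hcpt : IsCompact (Metric.closedBall w 1) := isCompact_closedBall w 1
    obtain ⟨a, -, φ, hφ, hlim⟩ := hcpt.tendsto_subseq (x := u) fun k => by
      simpa [dist_eq_norm] using hub k
    have hmem : ∀ c : ℝ, a ∈ K ∧ h a ≤ c := by
      intro c
      have hclim : Filter.Tendsto (fun k => (u (φ k), c)) Filter.atTop (nhds (a, c)) :=
        hlim.prodMk_nhds tendsto_const_nhds
      refine hcl.mem_of_tendsto hclim ?_
      filter_upwards [Filter.eventually_ge_atTop ⌈-c⌉₊] with k hk
      refine ⟨huK _, ?_⟩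
      have h1 : (k : ℝ) ≤ φ k := by exact_mod_cast hφ.id_le k
      have h2 : -c ≤ k := (Nat.le_ceil _).trans (by exact_mod_cast hk)
      have h3 : h (u (φ k)) ≤ c := by linarith [huh (φ k)]
      exact h3
    have := (hmem (h a - 1)).2
    linarith
  refine ⟨|B| + 2 * |h w|, by positivity, fun u hu => ?_⟩
  have hBa := le_abs_self B
  have hwa := neg_abs_le (h w)
  have hwb := le_abs_self (h w)
  rcases le_or_gt ‖u - w‖ 1 with h1 | h1
  · have := hB u hu h1
    nlinarith [norm_nonneg (u - w), abs_nonneg B, abs_nonneg (h w)]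
  · set r := ‖u - w‖ with hr
    have hr0 : 0 < r := by linarith
    have hr1 : 0 ≤ 1 - 1 / r := by rw [sub_nonneg, div_le_one hr0]; exact h1.le
    have hr2 : 0 ≤ 1 / r := by positivity
    have hcv := hc.2 hw hu hr1 hr2 (by ring)
    have hmem := hc.1 hw hu hr1 hr2 (by ring)
    have hball := hB _ hmem (by
      have e : (1 - 1 / r) • w + (1 / r) • u - w = (1 / r) • (u - w) := by module
      rw [e, norm_smul, Real.norm_eq_abs, abs_of_pos (by positivity), ← hr]
      field_simp; exact le_rfl)
    have h3 : -B ≤ (1 - 1 / r) * h w + 1 / r * h u := hball.trans hcv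
    have h4 : r * (-B) ≤ r * ((1 - 1 / r) * h w + 1 / r * h u) := by gcongr
    have h5 : r * ((1 - 1 / r) * h w + 1 / r * h u) = (r - 1) * h w + h u := by
      field_simp
    rw [h5] at h4
    nlinarith [abs_nonneg B, abs_nonneg (h w)]

/-- A closed convex function plus a continuous function with quadratic growth attains its
minimum. The minimizer is found on a compact part of the epigraph, since the effective domain
need not be closed. -/
lemma exists_minimizer {K : Set (E d)} {h : E d → ℝ} (hc : ConvexOn ℝ K h)
    (hcl : IsClosed {p : E d × ℝ | p.1 ∈ K ∧ h p.1 ≤ p.2}) {w : E d} (hw : w ∈ K)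
    {a p r : ℝ} (ha : 0 < a) (hp : 0 < p) {c : E d → ℝ} (hcont : Continuous c)
    (hgrow : ∀ u, p * ‖u - w‖ ^ 2 - r * (1 + ‖u - w‖) ≤ c u) :
    ∃ u ∈ K, ∀ v ∈ K, a * h u + c u ≤ a * h v + c v := by
  obtain ⟨C, hC0, hC⟩ := exists_linear_lower_bound hc hcl hw
  set M := a * h w + c w with hM
  set q := |r| + a * C with hq
  have hq0 : 0 ≤ q := by positivity
  set R := (q + |M|) / p + q / p + 1 with hR
  have hR1 : 1 ≤ R := by
    have : 0 ≤ (q + |M|) / p + q / p := by positivity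
    linarith
  have hrad : ∀ t : ℝ, 0 ≤ t → p * t ^ 2 - q * (1 + t) ≤ M → t ≤ R := by
    intro t ht hle
    by_contra hlt
    push Not at hlt
    have e : p * R = q + |M| + q + p := by rw [hR]; field_simp
    have h0 : p * R ≤ p * t := by gcongr
    have h1 : t * (p * R) ≤ p * t ^ 2 := by nlinarith
    rw [e] at h1
    have := le_abs_self M
    nlinarith [abs_nonneg M]
  let epi : Set (E d × ℝ) := {x | x.1 ∈ K ∧ h x.1 ≤ x.2}
  let A : Set (E d × ℝ) := epi ∩ {x | a * x.2 + c x.1 ≤ M}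
  have hAcl : IsClosed A := hcl.inter (isClosed_le (by fun_prop) continuous_const)
  have hfst : ∀ x ∈ A, ‖x.1 - w‖ ≤ R := by
    intro x hx
    apply hrad _ (norm_nonneg _)
    have h1 := hC x.1 hx.1.1
    have h2 : a * h x.1 ≤ a * x.2 := by have := hx.1.2; gcongr
    have h3 := hgrow x.1
    have h4 : a * x.2 + c x.1 ≤ M := hx.2
    have h5 : a * (-C * (1 + ‖x.1 - w‖)) ≤ a * h x.1 := by gcongr
    have h6 : r * (1 + ‖x.1 - w‖) ≤ |r| * (1 + ‖x.1 - w‖) := by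
      gcongr; exact le_abs_self r
    rw [hq]
    nlinarith
  obtain ⟨m, hm⟩ : ∃ m : ℝ, ∀ x ∈ A, -m ≤ x.2 ∧ x.2 ≤ m := by
    refine ⟨max (C * (1 + R)) ((M + |r| * (1 + R)) / a), fun x hx => ⟨?_, ?_⟩⟩
    · have h1 := hC x.1 hx.1.1
      have h2 := hfst x hx
      have h3 : C * (1 + ‖x.1 - w‖) ≤ C * (1 + R) := by gcongr
      have h4 : h x.1 ≤ x.2 := hx.1.2
      have := le_max_left (C * (1 + R)) ((M + |r| * (1 + R)) / a)
      linarith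
    · refine le_trans ?_ (le_max_right _ _)
      rw [le_div_iff₀ ha]
      have h2 := hfst x hx
      have h3 := hgrow x.1
      have h4 : a * x.2 + c x.1 ≤ M := hx.2
      have h6 : r * (1 + ‖x.1 - w‖) ≤ |r| * (1 + R) := by
        gcongr; exact le_abs_self r
      have h7 : 0 ≤ p * ‖x.1 - w‖ ^ 2 := by positivity
      linarith
  have hAb : A ⊆ Metric.closedBall w R ×ˢ Set.Icc (-m) m := fun x hx =>
    ⟨by simpa [dist_eq_norm] using hfst x hx, hm x hx⟩
  have hAcpt : IsCompact A :=
    ((isCompact_closedBall w R).prod isCompact_Icc).of_isClosed_subset hAcl hAb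
  have hne : A.Nonempty := ⟨(w, h w), ⟨hw, le_rfl⟩, hM.ge⟩
  obtain ⟨x, hxA, hmin⟩ := hAcpt.exists_isMinOn hne
    (f := fun x : E d × ℝ => a * x.2 + c x.1) (by fun_prop)
  have hx2 : a * h x.1 ≤ a * x.2 := by have := hxA.1.2; gcongr
  refine ⟨x.1, hxA.1.1, fun v hv => ?_⟩
  rcases le_or_gt (a * h v + c v) M with hvM | hvM
  · have : a * x.2 + c x.1 ≤ a * h v + c v :=
      hmin (show (v, h v) ∈ A from ⟨⟨hv, le_rfl⟩, hvM⟩)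
    linarith
  · have : a * x.2 + c x.1 ≤ M := hxA.2
    linarith

/-- A minimizer of a convex function plus quadratics of total curvature `a + b` satisfies a
quadratic growth inequality with the same curvature. -/
lemma three_point {K : Set (E d)} {φ : E d → ℝ} (hφ : ConvexOn ℝ K φ) {a b : ℝ} {p q z : E d}
    (hz : z ∈ K)
    (hmin : ∀ v ∈ K, φ z + a / 2 * ‖p - z‖ ^ 2 + b / 2 * ‖q - z‖ ^ 2 ≤
      φ v + a / 2 * ‖p - v‖ ^ 2 + b / 2 * ‖q - v‖ ^ 2) {u : E d} (hu : u ∈ K) :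
    φ z + a / 2 * ‖p - z‖ ^ 2 + b / 2 * ‖q - z‖ ^ 2 + (a + b) / 2 * ‖u - z‖ ^ 2 ≤
      φ u + a / 2 * ‖p - u‖ ^ 2 + b / 2 * ‖q - u‖ ^ 2 := by
  have key : ∀ r : E d, ∀ t : ℝ, ‖r - ((1 - t) • z + t • u)‖ ^ 2 =
      (1 - t) * ‖r - z‖ ^ 2 + t * ‖r - u‖ ^ 2 - t * (1 - t) * ‖u - z‖ ^ 2 := by
    intro r t
    have e1 : r - ((1 - t) • z + t • u) = (r - z) - t • (u - z) := by module
    have e2 : r - u = (r - z) - (u - z) := by abel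
    rw [e1, e2, norm_sub_sq_real (r - z) (t • (u - z)), norm_sub_sq_real (r - z) (u - z),
      inner_smul_right, norm_smul, mul_pow, Real.norm_eq_abs, sq_abs]
    ring
  suffices h : (a + b) / 2 * ‖u - z‖ ^ 2 ≤
      φ u + a / 2 * ‖p - u‖ ^ 2 + b / 2 * ‖q - u‖ ^ 2 -
        (φ z + a / 2 * ‖p - z‖ ^ 2 + b / 2 * ‖q - z‖ ^ 2) by linarith
  refine le_of_forall_mul_one_sub_le fun t ht0 ht1 => ?_
  have h1 := hmin _ (hφ.1 hz hu (sub_nonneg.2 ht1.le) ht0.le (by ring))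
  have h2 := hφ.2 hz hu (sub_nonneg.2 ht1.le) ht0.le (by ring)
  rw [key p t, key q t] at h1
  simp only [smul_eq_mul] at h2
  have h3 : t * ((1 - t) * ((a + b) / 2 * ‖u - z‖ ^ 2)) ≤
      t * (φ u + a / 2 * ‖p - u‖ ^ 2 + b / 2 * ‖q - u‖ ^ 2 -
        (φ z + a / 2 * ‖p - z‖ ^ 2 + b / 2 * ‖q - z‖ ^ 2)) := by
    nlinarith
  exact le_of_mul_le_mul_left h3 ht0

end Prox

/-! ### The exact penalty function -/

namespace Instance

variable {n d m : ℕ} {A : Instance n d m}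

lemma viol_nonneg (x : E d) : 0 ≤ A.viol x := maxPos_nonneg _

/-- The penalized gap `F(x) - F(x⋆)`. -/
noncomputable def gap (A : Instance n d m) (x : E d) : ℝ := A.F x - A.F A.xs

/-- The gradient of the finite sum `f`. -/
noncomputable def avgGrad (A : Instance n d m) (y : E d) : E d := (1 / (n : ℝ)) • ∑ i, gradient (A.f i) y

namespace Assumptions

variable (hA : A.Assumptions)

include hA

lemma viol_xs : A.viol A.xs = 0 :=
  le_antisymm (maxPos_le le_rfl hA.solution.1.2) (viol_nonneg _)

lemma F_xs : A.F A.xs = A.obj A.xs := by simp [F, hA.viol_xs]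

lemma Bt_nonneg : 0 ≤ A.Bt := by
  obtain ⟨x, hx, hg, hB⟩ := hA.slater
  have := hA.solution.2 x ⟨hx, fun k => (hg k).trans (by linarith [hA.nu_pos])⟩
  linarith

lemma γ_nonneg : 0 ≤ A.γ :=
  (div_nonneg hA.Bt_nonneg hA.nu_pos.le).trans hA.penalty

lemma Lf_le : A.Lf ≤ A.Lγ := by
  have := mul_nonneg hA.γ_nonneg hA.Lg_nonneg
  unfold Lγ; linarith

lemma favg_convex : ConvexOn ℝ Set.univ A.favg := by
  have h : ConvexOn ℝ Set.univ (fun x => ∑ i, A.f i x) := by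
    have : ∀ s : Finset (Fin n), ConvexOn ℝ Set.univ (fun x => ∑ i ∈ s, A.f i x) := by
      classical
      intro s
      induction s using Finset.induction_on with
      | empty => simpa using convexOn_const (0 : ℝ) convex_univ
      | insert a s ha ih =>
        simp only [Finset.sum_insert ha]
        exact (hA.f_convex a).add ih
    exact this _
  exact h.smul (c := 1 / (n : ℝ)) (by positivity)

lemma obj_convex : ConvexOn ℝ A.K A.obj :=
  (hA.favg_convex.subset (Set.subset_univ _) hA.h_convex.1).add hA.h_convex

lemma viol_convex : ConvexOn ℝ Set.univ A.viol := by
  refine ⟨convex_univ, fun x _ y _ a b ha hb hab => ?_⟩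
  exact maxPos_comb ha hb fun k => by
    simpa using (hA.g_convex k).2 (Set.mem_univ x) (Set.mem_univ y) ha hb hab

lemma F_convex : ConvexOn ℝ A.K A.F :=
  hA.obj_convex.add ((hA.viol_convex.smul hA.γ_nonneg).subset (Set.subset_univ _) hA.h_convex.1)

lemma gap_convex : ConvexOn ℝ A.K A.gap := by
  have : A.gap = fun x => A.F x + -A.F A.xs := by funext x; rw [gap, sub_eq_add_neg]
  rw [this]
  exact hA.F_convex.add_const (-A.F A.xs)

/-- Exactness of the penalty: the objective can fall below the optimal value by at most
`B̃/ν` times the violation, because the convex combination of an infeasible point with the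
Slater point that just becomes feasible has weight proportional to the violation. -/
lemma obj_sub_ge {x : E d} (hx : x ∈ A.K) :
    -(A.Bt / A.nu * A.viol x) ≤ A.obj x - A.obj A.xs := by
  obtain ⟨u, hu, hg, hB⟩ := hA.slater
  have hν := hA.nu_pos
  set v := A.viol x with hv
  have hv0 : 0 ≤ v := viol_nonneg x
  have hs : 0 < v + A.nu := by linarith
  have ha : 0 ≤ A.nu / (v + A.nu) := by positivity
  have hb : 0 ≤ v / (v + A.nu) := by positivity
  have hab : A.nu / (v + A.nu) + v / (v + A.nu) = 1 := by field_simp; ring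
  have hfeas : A.Feasible ((A.nu / (v + A.nu)) • x + (v / (v + A.nu)) • u) := by
    refine ⟨hA.h_convex.1 hx hu ha hb hab, fun k => ?_⟩
    have h1 := (hA.g_convex k).2 (Set.mem_univ x) (Set.mem_univ u) ha hb hab
    have h2 : A.g k x ≤ v := le_maxPos (fun k => A.g k x) k
    have h3 : (A.nu / (v + A.nu)) * A.g k x ≤ (A.nu / (v + A.nu)) * v := by gcongr
    have h4 : (v / (v + A.nu)) * A.g k u ≤ (v / (v + A.nu)) * (-A.nu) := by
      have := hg k; gcongr
    have h5 : (A.nu / (v + A.nu)) * v + (v / (v + A.nu)) * (-A.nu) = 0 := by ring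
    simp only [smul_eq_mul] at h1
    linarith
  have h1 := hA.solution.2 _ hfeas
  have h2 := hA.obj_convex.2 hx hu ha hb hab
  simp only [smul_eq_mul] at h2
  have h3 := h1.trans h2
  have h4 : (v + A.nu) * A.obj A.xs ≤
      (v + A.nu) * (A.nu / (v + A.nu) * A.obj x + v / (v + A.nu) * A.obj u) := by gcongr
  have h5 : (v + A.nu) * (A.nu / (v + A.nu) * A.obj x + v / (v + A.nu) * A.obj u) =
      A.nu * A.obj x + v * A.obj u := by field_simp
  rw [h5] at h4
  have h6 : v * (A.obj u - A.obj A.xs) ≤ v * A.Bt := by gcongr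
  have h7 : -(A.Bt / A.nu * v) = -(v * A.Bt) / A.nu := by ring
  rw [h7, div_le_iff₀ hν]
  linarith

lemma penalty_mul_viol_le_gap {x : E d} (hx : x ∈ A.K) :
    (A.γ - A.Bt / A.nu) * A.viol x ≤ A.gap x := by
  have := hA.obj_sub_ge hx
  rw [gap, hA.F_xs, F]
  linarith

lemma gap_nonneg {x : E d} (hx : x ∈ A.K) : 0 ≤ A.gap x :=
  (mul_nonneg (sub_nonneg.2 hA.penalty) (viol_nonneg x)).trans (hA.penalty_mul_viol_le_gap hx)

lemma obj_sub_le_gap (x : E d) : A.obj x - A.obj A.xs ≤ A.gap x := by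
  have := mul_nonneg hA.γ_nonneg (viol_nonneg (A := A) x)
  rw [gap, hA.F_xs, F]
  linarith

/-- If `f` is strongly convex then `F` grows quadratically around its minimizer. -/
lemma quadratic_growth {μ : ℝ} (hμ : StrongConvexOn Set.univ μ A.favg) {x : E d} (hx : x ∈ A.K) :
    μ / 2 * ‖x - A.xs‖ ^ 2 ≤ A.gap x := by
  refine le_of_forall_mul_one_sub_le fun t ht0 ht1 => ?_
  have hxs := hA.solution.1.1
  have h1 := hμ.2 (Set.mem_univ A.xs) (Set.mem_univ x) (sub_nonneg.2 ht1.le) ht0.le (by ring)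
  have h2 := hA.h_convex.2 hxs hx (sub_nonneg.2 ht1.le) ht0.le (by ring)
  have h3 := hA.viol_convex.2 (Set.mem_univ A.xs) (Set.mem_univ x)
    (sub_nonneg.2 ht1.le) ht0.le (by ring)
  have h4 := hA.gap_nonneg (hA.h_convex.1 hxs hx (sub_nonneg.2 ht1.le) ht0.le (by ring))
  have h5 := mul_le_mul_of_nonneg_left h3 hA.γ_nonneg
  rw [norm_sub_rev] at h1
  simp only [gap, F, obj, smul_eq_mul] at *
  have h6 : 0 ≤ t * (A.favg x + A.h x + A.γ * A.viol x -
      (A.favg A.xs + A.h A.xs + A.γ * A.viol A.xs) - (1 - t) * (μ / 2 * ‖x - A.xs‖ ^ 2)) := by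
    nlinarith
  linarith [nonneg_of_mul_nonneg_right h6 ht0]

lemma gap_x0_le : A.gap A.x0 ≤ A.Bγ := by
  have h := hA.init_gap
  have h1 : A.viol A.x0 ≤ ∑ k, max (A.g k A.x0) 0 :=
    maxPos_le (Finset.sum_nonneg fun k _ => le_max_right _ _) fun k =>
      (le_max_left _ 0).trans (Finset.single_le_sum (f := fun k => max (A.g k A.x0) 0)
        (fun j _ => le_max_right _ _) (Finset.mem_univ k))
  have h2 := mul_le_mul_of_nonneg_left h1 hA.γ_nonneg
  rw [gap, hA.F_xs, F]
  linarith

lemma two_mul_gap_x0_le : 2 * A.gap A.x0 + 3 * A.Lγ / 2 * ‖A.x0 - A.xs‖ ^ 2 ≤ A.D0 := by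
  have h1 := hA.gap_x0_le
  have h2 : ‖A.x0 - A.xs‖ ^ 2 ≤ A.Bx ^ 2 := by
    have := hA.init_dist; gcongr
  have h3 : 3 * A.Lγ / 2 * ‖A.x0 - A.xs‖ ^ 2 ≤ 3 * A.Lγ / 2 * A.Bx ^ 2 := by
    have := hA.Lγ_pos; gcongr
  unfold D0; linarith

/-! ### Gradients of the finite sum -/

lemma hasGradientAt_favg (y : E d) : HasGradientAt A.favg (A.avgGrad y) y := by
  rw [hasGradientAt_iff_hasFDerivAt]
  have h : HasFDerivAt (fun x => ∑ i, A.f i x)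
      (∑ i, InnerProductSpace.toDual ℝ (E d) (gradient (A.f i) y)) y :=
    HasFDerivAt.fun_sum fun i _ => ((hA.f_smooth i).1 y).hasGradientAt.hasFDerivAt
  have h2 := h.const_mul (1 / (n : ℝ))
  convert! h2 using 1
  simp [avgGrad]

lemma favg_descent (hn : 1 ≤ n) (x y : E d) :
    A.favg x ≤ A.favg y + inner ℝ (A.avgGrad y) (x - y) + A.Lf / 2 * ‖x - y‖ ^ 2 := by
  have hn' : (0 : ℝ) < n := by exact_mod_cast hn
  have h := Finset.sum_le_sum fun i (_ : i ∈ Finset.univ) => (hA.f_smooth i).descent x y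
  simp only [Finset.sum_add_distrib, Finset.sum_const, Finset.card_univ, Fintype.card_fin,
    nsmul_eq_mul] at h
  have h2 := mul_le_mul_of_nonneg_left h (by positivity : 0 ≤ 1 / (n : ℝ))
  have e : 1 / (n : ℝ) * (n * (A.Lf / 2 * ‖x - y‖ ^ 2)) = A.Lf / 2 * ‖x - y‖ ^ 2 := by
    field_simp
  rw [mul_add, mul_add, e] at h2
  simpa [favg, avgGrad, inner_smul_left, sum_inner] using h2

/-- The variance of the SVRG estimator is controlled by a Bregman divergence of `f`. -/
lemma variance_le (hn : 1 ≤ n) (y w : E d) :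
    1 / (n : ℝ) * ∑ i, ‖gradient (A.f i) y - gradient (A.f i) w + A.avgGrad w - A.avgGrad y‖ ^ 2 ≤
      2 * A.Lf * (A.favg w - A.favg y - inner ℝ (A.avgGrad y) (w - y)) := by
  have hn' : (0 : ℝ) < n := by exact_mod_cast hn
  -- the average squared deviation from the mean is at most the average square
  set a : Fin n → E d := fun i => gradient (A.f i) y - gradient (A.f i) w with ha
  set b : E d := A.avgGrad y - A.avgGrad w with hb
  have hmean : ∑ i, a i = (n : ℝ) • b := by
    simp only [ha, hb, avgGrad, Finset.sum_sub_distrib, ← smul_sub, smul_smul]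
    rw [mul_one_div_cancel hn'.ne', one_smul]
  have hdev : ∑ i, ‖a i - b‖ ^ 2 = ∑ i, ‖a i‖ ^ 2 - n * ‖b‖ ^ 2 := by
    simp only [norm_sub_sq_real, Finset.sum_add_distrib, Finset.sum_sub_distrib,
      ← Finset.mul_sum, ← sum_inner, hmean, inner_smul_left, real_inner_self_eq_norm_sq,
      Finset.sum_const, Finset.card_univ, Fintype.card_fin, nsmul_eq_mul]
    simp
    ring
  have e1 : ∀ i, gradient (A.f i) y - gradient (A.f i) w + A.avgGrad w - A.avgGrad y = a i - b := by
    intro i; simp only [ha, hb]; abel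
  have h1 : ∀ i, ‖a i‖ ^ 2 ≤
      2 * A.Lf * (A.f i w - A.f i y - inner ℝ (gradient (A.f i) y) (w - y)) := by
    intro i
    rw [ha, ← norm_neg, neg_sub]
    exact (hA.f_smooth i).sq_gradient_sub_le hA.Lf_nonneg (hA.f_convex i) w y
  have h2 : ∑ i, ‖a i - b‖ ^ 2 ≤
      ∑ i, 2 * A.Lf * (A.f i w - A.f i y - inner ℝ (gradient (A.f i) y) (w - y)) := by
    rw [hdev]
    have h3 := Finset.sum_le_sum fun i (_ : i ∈ Finset.univ) => h1 i
    have h4 : 0 ≤ (n : ℝ) * ‖b‖ ^ 2 := by positivity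
    linarith
  simp only [e1]
  refine (mul_le_mul_of_nonneg_left h2 (by positivity)).trans_eq ?_
  rw [← Finset.mul_sum]
  simp only [Finset.sum_sub_distrib, ← sum_inner, favg, avgGrad, inner_smul_left]
  simp
  ring

/-! ### Linearized constraints -/

omit hA in
/-- The linearization at `y` of the constraint violation. -/
noncomputable def _root_.Varas.Instance.linViol (A : Instance n d m) (y u : E d) : ℝ :=
  maxPos fun k => A.g k y + inner ℝ (gradient (A.g k) y) (u - y)

lemma linViol_le_viol (y u : E d) : A.linViol y u ≤ A.viol u :=
  maxPos_mono fun k => ConvexOn.first_order (hA.g_convex k) ((hA.g_smooth k).1 y).hasGradientAt u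

lemma viol_le_linViol (y u : E d) : A.viol u ≤ A.linViol y u + A.Lg / 2 * ‖u - y‖ ^ 2 :=
  maxPos_le_add (by have := hA.Lg_nonneg; positivity) fun k => (hA.g_smooth k).descent u y

omit hA in
lemma _root_.Varas.Instance.linViol_convex (y : E d) : ConvexOn ℝ Set.univ (A.linViol y) := by
  refine ⟨convex_univ, fun u _ w _ a b ha hb hab => ?_⟩
  refine maxPos_comb ha hb fun k => le_of_eq ?_
  have e : a • u + b • w - y = a • (u - y) + b • (w - y) := by
    have : y = (a + b) • y := by rw [hab, one_smul]
    nth_rewrite 1 [this]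
    module
  rw [e, inner_add_right, inner_smul_right, inner_smul_right]
  linear_combination - A.g k y * hab

end Assumptions

end Instance

lemma three_convex {d : ℕ} {K : Set (E d)} {φ : E d → ℝ} (hφ : ConvexOn ℝ K φ) {x y z : E d}
    (hx : x ∈ K) (hy : y ∈ K) (hz : z ∈ K) {a b c : ℝ} (ha : 0 ≤ a) (hb : 0 ≤ b) (hc : 0 < c)
    (h : a + b + c = 1) :
    a • x + b • y + c • z ∈ K ∧ φ (a • x + b • y + c • z) ≤ a * φ x + b * φ y + c * φ z := by
  have h1 : 0 < b + c := by linarith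
  have e : a • x + b • y + c • z = a • x + (b + c) • ((b / (b + c)) • y + (c / (b + c)) • z) := by
    rw [smul_add, smul_smul, smul_smul, mul_div_cancel₀ _ h1.ne', mul_div_cancel₀ _ h1.ne', add_assoc]
  have hb' : 0 ≤ b / (b + c) := by positivity
  have hc' : 0 ≤ c / (b + c) := by positivity
  have hs : b / (b + c) + c / (b + c) = 1 := by field_simp
  have hm := hφ.1 hy hz hb' hc' hs
  have h2 := hφ.2 hy hz hb' hc' hs
  have h3 := hφ.2 hx hm ha h1.le (by linarith)
  rw [e]
  refine ⟨hφ.1 hx hm ha h1.le (by linarith), h3.trans ?_⟩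
  have h4 := mul_le_mul_of_nonneg_left h2 h1.le
  have h5 : (b + c) * (b / (b + c) * φ y + c / (b + c) * φ z) = b * φ y + c * φ z := by
    field_simp
  simp only [smul_eq_mul] at *
  linarith

/-! ### One iteration -/

/-- If `(1 + b) • p = q + b • r` then `(1 + b) ‖p‖² ≤ ‖q‖² + b ‖r‖²`. -/
lemma mul_sq_norm_le_of_smul_eq {d : ℕ} {b : ℝ} (hb : 0 ≤ b) {p q r : E d}
    (h : (1 + b) • p = q + b • r) : (1 + b) * ‖p‖ ^ 2 ≤ ‖q‖ ^ 2 + b * ‖r‖ ^ 2 := by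
  have h2 : (1 + b) * ((1 + b) * ‖p‖ ^ 2) =
      (1 + b) * (‖q‖ ^ 2 + b * ‖r‖ ^ 2) - b * ‖q - r‖ ^ 2 := by
    have h3 : (1 + b) * ((1 + b) * ‖p‖ ^ 2) = ‖q + b • r‖ ^ 2 := by
      rw [← h, norm_smul, mul_pow, Real.norm_eq_abs, sq_abs]; ring
    rw [h3, norm_add_sq_real q (b • r), norm_sub_sq_real q r,
      inner_smul_right, norm_smul, mul_pow, Real.norm_eq_abs, sq_abs]
    ring
  have hpos : 0 < 1 + b := by linarith
  refine le_of_mul_le_mul_left ?_ hpos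
  have : 0 ≤ b * ‖q - r‖ ^ 2 := by positivity
  linarith

/-- Young's inequality with the constants of the variance reduction argument. -/
lemma neg_mul_inner_le {d : ℕ} {α L : ℝ} (hα : 0 ≤ α) (hL : 0 < L) (δ w : E d) :
    -(α * inner ℝ δ w) ≤ α ^ 2 * L * ‖w‖ ^ 2 + ‖δ‖ ^ 2 / (4 * L) := by
  have h1 := neg_le_of_abs_le (abs_real_inner_le_norm δ w)
  have h2 : 0 ≤ (2 * L * α * ‖w‖ - ‖δ‖) ^ 2 / (4 * L) := by positivity
  have h3 : (2 * L * α * ‖w‖ - ‖δ‖) ^ 2 / (4 * L) =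
      α ^ 2 * L * ‖w‖ ^ 2 - α * (‖δ‖ * ‖w‖) + ‖δ‖ ^ 2 / (4 * L) := by
    field_simp; ring
  have h4 := mul_le_mul_of_nonneg_left h1 hα
  linarith

namespace Instance.Assumptions

variable {n d m : ℕ} {A : Instance n d m} (hA : A.Assumptions)

include hA

/-- The proximal subproblem has a solution. -/
lemma prox_exists {α β μ : ℝ} (hα : 0 < α) (hβ : 0 < β) (hμ : 0 ≤ μ) (v y z zp : E d) :
    ∃ u ∈ A.K, ∀ w ∈ A.K,
      α * β * (inner ℝ v u + μ / 2 * ‖y - u‖ ^ 2 + A.h u) + α / 2 * ‖z - u‖ ^ 2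
        + A.γ * β * (maxPos fun k => A.g k y + α * inner ℝ (gradient (A.g k) y) (u - zp)) ≤
      α * β * (inner ℝ v w + μ / 2 * ‖y - w‖ ^ 2 + A.h w) + α / 2 * ‖z - w‖ ^ 2
        + A.γ * β * (maxPos fun k => A.g k y + α * inner ℝ (gradient (A.g k) y) (w - zp)) := by
  have hγ := hA.γ_nonneg
  have hx0 := hA.x0_mem
  set w := A.x0
  obtain ⟨u, hu, hmin⟩ := exists_minimizer hA.h_convex hA.h_closed hx0
    (a := α * β) (p := α / 4) (r := α * β * ‖v‖ * (1 + ‖w‖) + α / 2 * ‖z - w‖ ^ 2)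
    (c := fun u => α * β * (inner ℝ v u + μ / 2 * ‖y - u‖ ^ 2) + α / 2 * ‖z - u‖ ^ 2
        + A.γ * β * (maxPos fun k => A.g k y + α * inner ℝ (gradient (A.g k) y) (u - zp)))
    (by positivity) (by positivity)
    (by
      have := continuous_maxPos
        (v := fun u : E d => fun k => A.g k y + α * inner ℝ (gradient (A.g k) y) (u - zp))
        (fun k => by fun_prop)
      fun_prop)
    (by
      intro u
      have h1 : 0 ≤ A.γ * β *
          (maxPos fun k => A.g k y + α * inner ℝ (gradient (A.g k) y) (u - zp)) :=
        mul_nonneg (by positivity) (maxPos_nonneg _)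
      have h2 : -(‖v‖ * (‖u - w‖ + ‖w‖)) ≤ inner ℝ v u := by
        have h := neg_le_of_abs_le (abs_real_inner_le_norm v u)
        have h' : ‖u‖ ≤ ‖u - w‖ + ‖w‖ := by simpa using norm_add_le (u - w) w
        have h'' : ‖v‖ * ‖u‖ ≤ ‖v‖ * (‖u - w‖ + ‖w‖) := by gcongr
        linarith
      have h3 : ‖u - w‖ ^ 2 ≤ 2 * ‖z - u‖ ^ 2 + 2 * ‖z - w‖ ^ 2 := by
        have e : ‖u - w‖ ≤ ‖z - u‖ + ‖z - w‖ := by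
          rw [norm_sub_rev z u]; simpa using norm_add_le (u - z) (z - w)
        nlinarith [sq_nonneg (‖z - u‖ - ‖z - w‖), norm_nonneg (u - w)]
      have h4 : 0 ≤ μ / 2 * ‖y - u‖ ^ 2 := by positivity
      have h5 : α * β * -(‖v‖ * (‖u - w‖ + ‖w‖)) ≤
          α * β * (inner ℝ v u + μ / 2 * ‖y - u‖ ^ 2) := by gcongr; linarith
      have h6 : α / 4 * ‖u - w‖ ^ 2 ≤ α / 4 * (2 * ‖z - u‖ ^ 2 + 2 * ‖z - w‖ ^ 2) := by gcongr
      have h7 : 0 ≤ α / 2 * ‖z - w‖ ^ 2 * ‖u - w‖ := by positivity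
      have h8 : 0 ≤ α * β * ‖v‖ * ‖w‖ * ‖u - w‖ := by positivity
      have h9 : 0 ≤ α * β * ‖v‖ := by positivity
      nlinarith)
  refine ⟨u, hu, fun w hw => ?_⟩
  have := hmin w hw
  linarith

omit hA in
/-- The point `y` is obtained from the iterate `(1 - α - ω) x + α z' + ω x̃` by replacing `z'` by
`z⁺`. -/
lemma extrapolation {α b : ℝ} (hb : 0 ≤ b) (hα2 : α ≤ 1 / 2) {x xt z y zp : E d}
    (hy : y = (1 / (1 + b * (1 - α))) •
      (((1 + b) * (1 - α - 1 / 2)) • x + α • z + ((1 + b) * (1 / 2)) • xt))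
    (hzp : zp = (1 / (1 + b)) • (z + b • y)) :
    (1 + b) • zp = z + b • y ∧ y = (1 / 2 - α) • x + (1 / 2 : ℝ) • xt + α • zp := by
  have hzp' : (1 + b) • zp = z + b • y := by
    rw [hzp, smul_smul, mul_one_div_cancel (by positivity), one_smul]
  have hy0 : (1 + b * (1 - α)) • y =
      ((1 + b) * (1 - α - 1 / 2)) • x + α • z + ((1 + b) * (1 / 2)) • xt := by
    have : 0 < 1 + b * (1 - α) := by
      have : 0 ≤ b * (1 - α) := mul_nonneg hb (by linarith)
      linarith
    rw [hy, smul_smul, mul_one_div_cancel this.ne', one_smul]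
  refine ⟨hzp', ?_⟩
  have h1 : (1 + b) • y = (1 + b) • ((1 / 2 - α) • x + (1 / 2 : ℝ) • xt + α • zp) := by
    have h2 : (1 + b) • y = (1 + b * (1 - α)) • y + α • b • y := by module
    have h3 : b • y = (1 + b) • zp - z := by rw [hzp']; abel
    rw [h2, hy0, h3]
    module
  have hne : (1 + b) ≠ 0 := by positivity
  exact smul_right_injective _ hne h1

/-- One iteration before averaging over the sampled index: `v = ∇f(y) + δ` is an arbitrary
gradient estimate. The quadratic left over by the proximal step absorbs the curvature of the
penalty function and one half of the error `δ`. -/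
lemma step_le (hn : 1 ≤ n) {α β μ : ℝ} (hα : 0 < α) (hα2 : α ≤ 1 / 2) (hμ : 0 ≤ μ)
    (hsc : StrongConvexOn Set.univ μ A.favg) (hβ : β = 1 / (3 * α * A.Lγ))
    {x xt z y zp v z' x' : E d} (hx : x ∈ A.K) (hxt : xt ∈ A.K)
    (hy : y = (1 / (1 + μ * β * (1 - α))) •
      (((1 + μ * β) * (1 - α - 1 / 2)) • x + α • z + ((1 + μ * β) * (1 / 2)) • xt))
    (hzp : zp = (1 / (1 + μ * β)) • (z + (μ * β) • y))
    (hz' : z' ∈ A.K)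
    (hmin : ∀ w ∈ A.K,
      α * β * (inner ℝ v z' + μ / 2 * ‖y - z'‖ ^ 2 + A.h z') + α / 2 * ‖z - z'‖ ^ 2
        + A.γ * β * (maxPos fun k => A.g k y + α * inner ℝ (gradient (A.g k) y) (z' - zp)) ≤
      α * β * (inner ℝ v w + μ / 2 * ‖y - w‖ ^ 2 + A.h w) + α / 2 * ‖z - w‖ ^ 2
        + A.γ * β * (maxPos fun k => A.g k y + α * inner ℝ (gradient (A.g k) y) (w - zp)))
    (hx' : x' = (1 - α - 1 / 2) • x + α • z' + (1 / 2 : ℝ) • xt) :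
    A.F x' + 3 / 2 * α ^ 2 * A.Lγ * (1 + μ * β) * ‖z' - A.xs‖ ^ 2 ≤
      (1 / 2 - α) * A.F x + α * A.F A.xs +
        1 / 2 * (A.favg y + inner ℝ (A.avgGrad y) (xt - y) + A.h xt + A.γ * A.viol xt) +
        3 / 2 * α ^ 2 * A.Lγ * ‖z - A.xs‖ ^ 2 -
        α * inner ℝ (v - A.avgGrad y) (zp - A.xs) + ‖v - A.avgGrad y‖ ^ 2 / (4 * A.Lγ) := by
  have hγ := hA.γ_nonneg
  have hL := hA.Lγ_pos
  have hLg := hA.Lg_nonneg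
  have hβ0 : 0 < β := by rw [hβ]; positivity
  have hb : 0 ≤ μ * β := by positivity
  have hβL : β * (3 * α * A.Lγ) = 1 := by rw [hβ]; field_simp
  have hxs := hA.solution.1.1
  set u := A.xs with hu
  set G := A.avgGrad y with hG
  set δ := v - G with hδ
  set c := 3 / 2 * α ^ 2 * A.Lγ with hc
  have hc0 : 0 < c := by positivity
  have hcβ : β * c = α / 2 := by
    rw [hc]; linear_combination α / 2 * hβL
  obtain ⟨hzp', hyy⟩ := extrapolation hb hα2 hy hzp
  have hcomb : ∀ w : E d, y + α • (w - zp) = (1 / 2 - α) • x + (1 / 2 : ℝ) • xt + α • w := by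
    intro w
    have : y + α • (w - zp) = y - α • zp + α • w := by module
    rw [this]; nth_rewrite 1 [hyy]; module
  have hx'y : x' = y + α • (z' - zp) := by rw [hcomb, hx']; module
  have hdiff : x' - y = α • (z' - zp) := by rw [hx'y]; abel
  have hlin : ∀ w : E d,
      (maxPos fun k => A.g k y + α * inner ℝ (gradient (A.g k) y) (w - zp)) =
        A.linViol y (y + α • (w - zp)) := by
    intro w; simp [linViol, inner_smul_right, -inner_gradient_left]
  simp only [hlin] at hmin
  -- the three-point inequality of the proximal step, with `u = x⋆` as comparison point
  have hconv : ConvexOn ℝ A.K (fun w => α * β * (inner ℝ v w + A.h w) +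
      A.γ * β * A.linViol y (y + α • (w - zp))) := by
    refine ⟨hA.h_convex.1, fun p hp q hq a b ha hb hab => ?_⟩
    have h1 := hA.h_convex.2 hp hq ha hb hab
    have h2 := (linViol_convex (A := A) y).2 (Set.mem_univ (y + α • (p - zp)))
      (Set.mem_univ (y + α • (q - zp))) ha hb hab
    have e : y + α • (a • p + b • q - zp) = a • (y + α • (p - zp)) + b • (y + α • (q - zp)) := by
      have hb' : b = 1 - a := by linarith
      rw [hb']; module
    rw [← e] at h2
    have h1' := mul_le_mul_of_nonneg_left h1 (by positivity : 0 ≤ α * β)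
    have h2' := mul_le_mul_of_nonneg_left h2 (by positivity : 0 ≤ A.γ * β)
    simp only [smul_eq_mul, inner_add_right, inner_smul_right] at h1' h2' ⊢
    linarith
  have h3p := three_point hconv (a := α * β * μ) (b := α) (p := y) (q := z) hz'
    (fun w hw => by have := hmin w hw; linarith) hxs
  rw [← hx'y, hcomb] at h3p
  have hprox : α * inner ℝ v z' + α * μ / 2 * ‖y - z'‖ ^ 2 + α * A.h z' + c * ‖z - z'‖ ^ 2 +
      A.γ * A.linViol y x' + c * (1 + μ * β) * ‖z' - u‖ ^ 2 ≤
      α * inner ℝ v u + α * μ / 2 * ‖y - u‖ ^ 2 + α * A.h u + c * ‖z - u‖ ^ 2 +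
      A.γ * A.linViol y ((1 / 2 - α) • x + (1 / 2 : ℝ) • xt + α • u) := by
    refine le_of_mul_le_mul_left ?_ hβ0
    rw [norm_sub_rev u z'] at h3p
    have t1 : β * (c * ‖z - z'‖ ^ 2) = α / 2 * ‖z - z'‖ ^ 2 := by rw [← mul_assoc, hcβ]
    have t2 : β * (c * ‖z - u‖ ^ 2) = α / 2 * ‖z - u‖ ^ 2 := by rw [← mul_assoc, hcβ]
    have t3 : β * (c * (1 + μ * β) * ‖z' - u‖ ^ 2) =
        α / 2 * (1 + μ * β) * ‖z' - u‖ ^ 2 := by rw [← hcβ]; ring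
    linarith
  -- bounds for the three parts of `F x'`
  have hf := hA.favg_descent hn x' y
  have hg := mul_le_mul_of_nonneg_left (hA.viol_le_linViol y x') hγ
  have hh := (three_convex hA.h_convex hx hxt hz' (by linarith : 0 ≤ 1 / 2 - α)
    (by norm_num : (0 : ℝ) ≤ 1 / 2) hα (by ring)).2
  have hl := (three_convex (linViol_convex (A := A) y) (Set.mem_univ x) (Set.mem_univ xt)
    (Set.mem_univ u) (by linarith : 0 ≤ 1 / 2 - α) (by norm_num : (0 : ℝ) ≤ 1 / 2) hα (by ring)).2
  rw [← hcomb z', ← hx'y] at hh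
  have hfx := StrongConvexOn.first_order hsc (hA.hasGradientAt_favg y) u
  have hfx0 := ConvexOn.first_order hA.favg_convex (hA.hasGradientAt_favg y) x
  have hl1 := hA.linViol_le_viol y x
  have hl2 := hA.linViol_le_viol y xt
  have hl3 := hA.linViol_le_viol y u
  have hl' : A.γ * A.linViol y ((1 / 2 - α) • x + (1 / 2 : ℝ) • xt + α • u) ≤
      A.γ * ((1 / 2 - α) * A.viol x + 1 / 2 * A.viol xt + α * A.viol u) := by
    gcongr
    refine hl.trans ?_
    have : 0 ≤ 1 / 2 - α := by linarith
    gcongr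
  -- the inner products
  have i1 : inner ℝ G (x' - y) = (1 / 2 - α) * inner ℝ G (x - y) + 1 / 2 * inner ℝ G (xt - y) +
      α * inner ℝ G (z' - y) := by
    have : x' - y = (1 / 2 - α) • (x - y) + (1 / 2 : ℝ) • (xt - y) + α • (z' - y) := by
      rw [hx'y, hcomb]; module
    rw [this]; simp only [inner_add_right, inner_smul_right]
  have i2 : inner ℝ G (z' - y) = inner ℝ G (u - y) + inner ℝ v z' - inner ℝ v u -
      inner ℝ δ (z' - zp) - inner ℝ δ (zp - u) := by
    simp only [hδ, inner_sub_left, inner_sub_right]; ring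
  have i3 : -(α * inner ℝ δ (z' - zp)) ≤
      α ^ 2 * A.Lγ * ‖z' - zp‖ ^ 2 + ‖δ‖ ^ 2 / (4 * A.Lγ) :=
    neg_mul_inner_le hα.le hL δ (z' - zp)
  have i4 : c * (1 + μ * β) * ‖z' - zp‖ ^ 2 ≤
      α * μ / 2 * ‖y - z'‖ ^ 2 + c * ‖z - z'‖ ^ 2 := by
    have h1 : (1 + μ * β) • (zp - z') = (z - z') + (μ * β) • (y - z') := by
      rw [smul_sub, hzp']; module
    have h4 := mul_sq_norm_le_of_smul_eq hb h1
    rw [norm_sub_rev z' zp]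
    have h5 := mul_le_mul_of_nonneg_left h4 hc0.le
    have h6 : c * (μ * β * ‖y - z'‖ ^ 2) = α * μ / 2 * ‖y - z'‖ ^ 2 := by
      linear_combination (μ * ‖y - z'‖ ^ 2) * hcβ
    linarith
  have i5 : ‖x' - y‖ ^ 2 = α ^ 2 * ‖z' - zp‖ ^ 2 := by
    rw [hdiff, norm_smul, mul_pow, Real.norm_eq_abs, sq_abs]
  have i6 : α ^ 2 * A.Lγ * ‖z' - zp‖ ^ 2 + A.Lγ / 2 * (α ^ 2 * ‖z' - zp‖ ^ 2) ≤
      c * (1 + μ * β) * ‖z' - zp‖ ^ 2 := by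
    have : 0 ≤ c * (μ * β) * ‖z' - zp‖ ^ 2 := by positivity
    rw [hc] at *
    linarith
  rw [i1, i2, i5] at hf
  rw [i5] at hg
  have hfx' := mul_le_mul_of_nonneg_left hfx hα.le
  have hfx0' := mul_le_mul_of_nonneg_left hfx0 (by linarith : 0 ≤ 1 / 2 - α)
  have eL : A.Lγ = A.Lf + A.γ * A.Lg := rfl
  have i7 : A.Lγ / 2 * (α ^ 2 * ‖z' - zp‖ ^ 2) = A.Lf / 2 * (α ^ 2 * ‖z' - zp‖ ^ 2) +
      A.γ * (A.Lg / 2 * (α ^ 2 * ‖z' - zp‖ ^ 2)) := by rw [eL]; ring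
  rw [norm_sub_rev u y, ← hG] at hfx'
  rw [← hG] at hfx0'
  simp only [F, obj]
  linarith only [hf, hg, hh, hl', hprox, hfx', hfx0', i3, i4, i6, i7]

end Instance.Assumptions

namespace Instance.Assumptions

variable {n d m : ℕ} {A : Instance n d m} (hA : A.Assumptions)

include hA

/-- The prox step of the algorithm returns a point of the effective domain, and one iteration
stays there. -/
lemma innerStep_mem {μ : ℝ} (hμ : 0 ≤ μ) {P : Schedule} {s : ℕ} (hα : 0 < P.α s)
    (hα2 : P.α s ≤ 1 / 2) (hω : P.ω s = 1 / 2) (hβ : 0 < P.β s) (t : ℕ) {xt : E d}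
    (hxt : xt ∈ A.K) (G : Fin n → E d) (i : Fin n) {st : Inner d} (hx : st.x ∈ A.K) :
    (innerStep A μ P s t xt G i st).z ∈ A.K ∧ (innerStep A μ P s t xt G i st).x ∈ A.K := by
  have hz : (innerStep A μ P s t xt G i st).z ∈ A.K :=
    (argminOn_spec (hA.prox_exists hα hβ hμ _ _ _ _)).1
  refine ⟨hz, ?_⟩
  have h := (three_convex hA.h_convex hx hz hxt (by linarith : 0 ≤ 1 / 2 - P.α s) hα.le
    (by norm_num : (0 : ℝ) < 1 / 2) (by ring)).1
  have e : (innerStep A μ P s t xt G i st).x = (1 / 2 - P.α s) • st.x +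
      P.α s • (innerStep A μ P s t xt G i st).z + (1 / 2 : ℝ) • xt := by
    have e1 : 1 - P.α s - 1 / 2 = 1 / 2 - P.α s := by ring
    rw [← e1, ← hω]; rfl
  rwa [e]

/-- One iteration, averaged over the sampled index. -/
lemma avg_innerStep_le (hn : 1 ≤ n) {μ : ℝ} (hμ : 0 ≤ μ)
    (hsc : StrongConvexOn Set.univ μ A.favg) {P : Schedule} {s : ℕ} (hα : 0 < P.α s)
    (hα2 : P.α s ≤ 1 / 2) (hω : P.ω s = 1 / 2) (hβ : P.β s = 1 / (3 * P.α s * A.Lγ)) (t : ℕ)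
    {xt : E d} (hxt : xt ∈ A.K) {st : Inner d} (hx : st.x ∈ A.K) :
    1 / (n : ℝ) * ∑ i, (A.gap (innerStep A μ P s t xt (fun j => gradient (A.f j) xt) i st).x +
        3 / 2 * P.α s ^ 2 * A.Lγ * (1 + μ * P.β s) *
          ‖(innerStep A μ P s t xt (fun j => gradient (A.f j) xt) i st).z - A.xs‖ ^ 2) ≤
      (1 / 2 - P.α s) * A.gap st.x + 1 / 2 * A.gap xt +
        3 / 2 * P.α s ^ 2 * A.Lγ * ‖st.z - A.xs‖ ^ 2 := by
  have hn' : (0 : ℝ) < n := by exact_mod_cast hn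
  have hL := hA.Lγ_pos
  have hβ0 : 0 < P.β s := by rw [hβ]; positivity
  set α := P.α s with hαdef
  set β := P.β s with hβdef
  set G : Fin n → E d := fun j => gradient (A.f j) xt with hG
  set y : E d := (1 / (1 + μ * β * (1 - α))) •
      (((1 + μ * β) * (1 - α - 1 / 2)) • st.x + α • st.z + ((1 + μ * β) * (1 / 2)) • xt) with hy
  set zp : E d := (1 / (1 + μ * β)) • (st.z + (μ * β) • y) with hzp
  set δ : Fin n → E d := fun i =>
    gradient (A.f i) y - gradient (A.f i) xt + A.avgGrad xt - A.avgGrad y with hδ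
  set c := 3 / 2 * α ^ 2 * A.Lγ with hc
  set B := (1 / 2 - α) * A.F st.x + α * A.F A.xs +
        1 / 2 * (A.favg y + inner ℝ (A.avgGrad y) (xt - y) + A.h xt + A.γ * A.viol xt) +
        c * ‖st.z - A.xs‖ ^ 2 with hB
  have hstep : ∀ i, A.F (innerStep A μ P s t xt G i st).x +
      c * (1 + μ * β) * ‖(innerStep A μ P s t xt G i st).z - A.xs‖ ^ 2 ≤
      B - α * inner ℝ (δ i) (zp - A.xs) + ‖δ i‖ ^ 2 / (4 * A.Lγ) := by
    intro i
    have hspec := argminOn_spec (hA.prox_exists hα hβ0 hμ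
      (gradient (A.f i) y - gradient (A.f i) xt + A.avgGrad xt) y st.z zp)
    have hzeq : (innerStep A μ P s t xt G i st).z = argminOn A.K (fun u =>
        α * β * (inner ℝ (gradient (A.f i) y - gradient (A.f i) xt + A.avgGrad xt) u +
          μ / 2 * ‖y - u‖ ^ 2 + A.h u) + α / 2 * ‖st.z - u‖ ^ 2
        + A.γ * β * maxPos fun k => A.g k y + α * inner ℝ (gradient (A.g k) y) (u - zp)) := by
      simp only [innerStep, hω]
      rfl
    have hxeq : (innerStep A μ P s t xt G i st).x = (1 - α - 1 / 2) • st.x +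
        α • (innerStep A μ P s t xt G i st).z + (1 / 2 : ℝ) • xt := by
      rw [← hω]; rfl
    rw [← hzeq] at hspec
    exact hA.step_le hn hα hα2 hμ hsc hβ hx hxt hy hzp hspec.1 hspec.2 hxeq
  -- the error of the gradient estimator has mean zero
  have hmean : ∑ i, inner ℝ (δ i) (zp - A.xs) = 0 := by
    rw [← sum_inner]
    have : ∑ i, δ i = 0 := by
      simp only [hδ, Finset.sum_sub_distrib, Finset.sum_add_distrib, Finset.sum_const,
        Finset.card_univ, Fintype.card_fin, avgGrad, ← Nat.cast_smul_eq_nsmul ℝ, smul_smul]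
      rw [mul_one_div_cancel hn'.ne', one_smul, one_smul]
      abel
    rw [this, inner_zero_left]
  have hvar := hA.variance_le hn y xt
  have hsum := Finset.sum_le_sum fun i (_ : i ∈ Finset.univ) => hstep i
  simp only [Finset.sum_add_distrib, Finset.sum_sub_distrib, ← Finset.mul_sum, hmean,
    ← Finset.sum_div, Finset.sum_const, Finset.card_univ, Fintype.card_fin, nsmul_eq_mul] at hsum
  have hsum' := mul_le_mul_of_nonneg_left hsum (by positivity : 0 ≤ 1 / (n : ℝ))
  have hbreg := ConvexOn.first_order hA.favg_convex (hA.hasGradientAt_favg y) xt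
  set V := 1 / (n : ℝ) * ∑ i, ‖δ i‖ ^ 2 with hV
  have hVle : V / (4 * A.Lγ) ≤
      1 / 2 * (A.favg xt - A.favg y - inner ℝ (A.avgGrad y) (xt - y)) := by
    rw [div_le_iff₀ (by positivity)]
    refine hvar.trans ?_
    have h1 : A.Lf * (A.favg xt - A.favg y - inner ℝ (A.avgGrad y) (xt - y)) ≤
        A.Lγ * (A.favg xt - A.favg y - inner ℝ (A.avgGrad y) (xt - y)) :=
      mul_le_mul_of_nonneg_right hA.Lf_le (by linarith)
    linarith
  have e1 : 1 / (n : ℝ) * (n * B - α * 0 + (∑ i, ‖δ i‖ ^ 2) / (4 * A.Lγ)) =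
      B + V / (4 * A.Lγ) := by
    rw [hV]; field_simp; ring
  rw [e1] at hsum'
  have e2 : 1 / (n : ℝ) * ∑ i, (A.gap (innerStep A μ P s t xt G i st).x +
      c * (1 + μ * β) * ‖(innerStep A μ P s t xt G i st).z - A.xs‖ ^ 2) =
      1 / (n : ℝ) * (∑ i, A.F (innerStep A μ P s t xt G i st).x + c * (1 + μ * β) *
        ∑ i, ‖(innerStep A μ P s t xt G i st).z - A.xs‖ ^ 2) - A.F A.xs := by
    simp only [gap, Finset.sum_add_distrib, Finset.sum_sub_distrib, ← Finset.mul_sum,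
      Finset.sum_const, Finset.card_univ, Fintype.card_fin, nsmul_eq_mul]
    field_simp
    ring
  rw [e2]
  have e3 : A.F xt = A.favg xt + A.h xt + A.γ * A.viol xt := rfl
  simp only [gap]
  linarith only [hsum', hVle, hB, e3]

end Instance.Assumptions

/-! ### Expectations over the sampled indices -/

section Sampling

variable {n : ℕ} {Ω : Type*} [MeasurableSpace Ω] {Q : Measure Ω} [IsProbabilityMeasure Q]
  {I : ℕ → ℕ → Ω → Fin n}

/-- A function of finitely many sampled indices is integrable. -/
lemma UniformSampling.integrable (hI : UniformSampling Q I) {S : Finset (ℕ × ℕ)}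
    {Ψ : (ℕ × ℕ → Fin n) → ℝ} (hΨ : DependsOn Ψ (S : Set (ℕ × ℕ))) :
    Integrable (fun ω => Ψ fun p => I p.1 p.2 ω) Q := by
  obtain ⟨ψ, hψ⟩ := dependsOn_iff_exists_comp.1 hΨ
  have hm : Measurable fun ω => ψ fun p : S => I p.1.1 p.1.2 ω :=
    (measurable_of_finite ψ).comp (measurable_pi_lambda _ fun p => hI.meas _ _)
  have e : (fun ω => Ψ fun p => I p.1 p.2 ω) = fun ω => ψ fun p : S => I p.1.1 p.1.2 ω := by
    rw [hψ]; rfl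
  rw [e]
  refine Integrable.of_bound hm.aestronglyMeasurable (∑ x, ‖ψ x‖) (ae_of_all _ fun ω => ?_)
  exact Finset.single_le_sum (f := fun x => ‖ψ x‖) (fun _ _ => norm_nonneg _) (Finset.mem_univ _)

/-- Averaging over an index that is independent of the others. -/
lemma UniformSampling.integral_avg (hI : UniformSampling Q I) {S : Finset (ℕ × ℕ)}
    {p : ℕ × ℕ} (hp : p ∉ S) {Ψ : Fin n → (ℕ × ℕ → Fin n) → ℝ}
    (hΨ : ∀ i, DependsOn (Ψ i) (S : Set (ℕ × ℕ))) :
    ∫ ω, Ψ (I p.1 p.2 ω) (fun p => I p.1 p.2 ω) ∂Q =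
      ∫ ω, 1 / (n : ℝ) * ∑ i, Ψ i (fun p => I p.1 p.2 ω) ∂Q := by
  choose ψ hψ using fun i => dependsOn_iff_exists_comp.1 (hΨ i)
  have hmX : Measurable fun ω => fun q : S => I q.1.1 q.1.2 ω :=
    measurable_pi_lambda _ fun q => hI.meas _ _
  have hind := hI.indep.indepFun_finset S {p} (by simpa using hp) fun q => hI.meas _ _
  have hind2 : ∀ i, IndepFun (fun ω => ψ i fun q : S => I q.1.1 q.1.2 ω)
      (fun ω => if I p.1 p.2 ω = i then (1 : ℝ) else 0) Q := fun i =>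
    hind.comp (φ := ψ i) (ψ := fun x : ({p} : Finset (ℕ × ℕ)) → Fin n =>
        if x ⟨p, Finset.mem_singleton_self p⟩ = i then (1 : ℝ) else 0)
      (measurable_of_finite _) (measurable_of_finite _)
  have hone : ∀ i, ∫ ω, (if I p.1 p.2 ω = i then (1 : ℝ) else 0) ∂Q = 1 / (n : ℝ) := by
    intro i
    rw [← hI.unif p.1 p.2 i]
    have hms : MeasurableSet {ω | I p.1 p.2 ω = i} := hI.meas _ _ (measurableSet_singleton i)
    have := integral_indicator_one (μ := Q) hms
    rw [← this]
    congr 1 with ω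
    simp [Set.indicator_apply]
  have hint : ∀ i, Integrable (fun ω => Ψ i fun p => I p.1 p.2 ω) Q := fun i => hI.integrable (hΨ i)
  have hmi : ∀ i, Measurable fun ω => if I p.1 p.2 ω = i then (1 : ℝ) else 0 := fun i =>
    (measurable_of_finite fun j : Fin n => if j = i then (1 : ℝ) else 0).comp (hI.meas p.1 p.2)
  have e1 : ∀ ω, Ψ (I p.1 p.2 ω) (fun p => I p.1 p.2 ω) =
      ∑ i, Ψ i (fun p => I p.1 p.2 ω) * (if I p.1 p.2 ω = i then (1 : ℝ) else 0) := by
    intro ω; simp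
  simp only [e1]
  rw [integral_finsetSum, integral_const_mul, integral_finsetSum _ fun i _ => hint i,
    Finset.mul_sum]
  · refine Finset.sum_congr rfl fun i _ => ?_
    have e2 : (fun ω => Ψ i fun p => I p.1 p.2 ω) =
        fun ω => ψ i fun q : S => I q.1.1 q.1.2 ω := by
      rw [hψ i]; rfl
    have hm : Measurable fun ω => ψ i fun q : S => I q.1.1 q.1.2 ω :=
      (measurable_of_finite (ψ i)).comp hmX
    have h := (hind2 i).integral_fun_mul_eq_mul_integral hm.aestronglyMeasurable
      (hmi i).aestronglyMeasurable
    rw [hone i] at h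
    have e3 : ∀ ω, Ψ i (fun p => I p.1 p.2 ω) = ψ i fun q : S => I q.1.1 q.1.2 ω :=
      fun ω => congrFun e2 ω
    simp only [e3]
    rw [h, mul_comm]
  · intro i _
    refine (hint i).mul_bdd (c := 1) (hmi i).aestronglyMeasurable (ae_of_all _ fun ω => ?_)
    split_ifs <;> simp

end Sampling

/-! ### Trajectories -/

section Trajectory

variable {n d m : ℕ} (A : Instance n d m) (μ : ℝ) (P : Schedule)

/-- The indices sampled before iteration `t + 1` of epoch `s + 1`. -/
def seen (P : Schedule) (s t : ℕ) : Finset (ℕ × ℕ) :=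
  (Finset.Icc 1 s).biUnion (fun r => {r} ×ˢ Finset.Icc 1 (P.T r)) ∪ {s + 1} ×ˢ Finset.Icc 1 t

lemma mem_seen {s t : ℕ} {p : ℕ × ℕ} : p ∈ seen P s t ↔
    (1 ≤ p.1 ∧ p.1 ≤ s ∧ 1 ≤ p.2 ∧ p.2 ≤ P.T p.1) ∨ (p.1 = s + 1 ∧ 1 ≤ p.2 ∧ p.2 ≤ t) := by
  obtain ⟨a, b⟩ := p
  simp only [seen, Finset.mem_union, Finset.mem_biUnion, Finset.mem_product, Finset.mem_singleton,
    Finset.mem_Icc]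
  constructor
  · rintro (⟨r, hr, rfl, hb⟩ | h)
    · exact Or.inl ⟨hr.1, hr.2, hb⟩
    · exact Or.inr h
  · rintro (⟨h1, h2, h3⟩ | h)
    · exact Or.inl ⟨a, ⟨h1, h2⟩, rfl, h3⟩
    · exact Or.inr h

/-- The state after `s` epochs when the samples are `j`. -/
noncomputable def outerState (s : ℕ) (j : ℕ × ℕ → Fin n) : Outer d :=
  run A μ P (fun s t => j (s, t)) s

/-- The state after `t` iterations of epoch `s + 1` when the samples are `j`. -/
noncomputable def innerState (s t : ℕ) (j : ℕ × ℕ → Fin n) : Inner d :=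
  innerRun A μ P (s + 1) (outerState A μ P s j).xt
    (fun i => gradient (A.f i) (outerState A μ P s j).xt) (fun t => j (s + 1, t))
    { x := (outerState A μ P s j).xt, z := (outerState A μ P s j).z, acc := 0,
      sfo := (outerState A μ P s j).sfo + n, qmo := (outerState A μ P s j).qmo } t

lemma innerState_succ (s t : ℕ) (j : ℕ × ℕ → Fin n) :
    innerState A μ P s (t + 1) j = innerStep A μ P (s + 1) (t + 1) (outerState A μ P s j).xt
      (fun i => gradient (A.f i) (outerState A μ P s j).xt) (j (s + 1, t + 1))
      (innerState A μ P s t j) := rfl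

lemma outerState_succ (s : ℕ) (j : ℕ × ℕ → Fin n) :
    outerState A μ P (s + 1) j =
      { xt := (1 / ∑ t ∈ Finset.Icc 1 (P.T (s + 1)), P.θ (s + 1) t) •
          (innerState A μ P s (P.T (s + 1)) j).acc
        z := (innerState A μ P s (P.T (s + 1)) j).z
        sfo := (innerState A μ P s (P.T (s + 1)) j).sfo
        qmo := (innerState A μ P s (P.T (s + 1)) j).qmo } := rfl

lemma dependsOn_innerState {s : ℕ}
    (h : DependsOn (outerState A μ P s) (seen P s 0 : Set (ℕ × ℕ))) (t : ℕ) :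
    DependsOn (innerState A μ P s t) (seen P s t : Set (ℕ × ℕ)) := by
  have hsub : ∀ t, (seen P s 0 : Set (ℕ × ℕ)) ⊆ seen P s t := by
    intro t p hp
    simp only [Finset.mem_coe, mem_seen] at hp ⊢
    grind
  induction t with
  | zero =>
    intro j j' hj
    have := h hj
    simp only [innerState, innerRun, this]
  | succ t ih =>
    intro j j' hj
    have h1 : outerState A μ P s j = outerState A μ P s j' :=
      h fun p hp => hj p (hsub _ hp)
    have h2 : innerState A μ P s t j = innerState A μ P s t j' := ih fun p hp => hj p (by
      simp only [Finset.mem_coe, mem_seen] at hp ⊢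
      grind)
    have h3 : j (s + 1, t + 1) = j' (s + 1, t + 1) := hj _ (by
      simp [mem_seen])
    rw [innerState_succ, innerState_succ, h1, h2, h3]

lemma dependsOn_outerState (s : ℕ) :
    DependsOn (outerState A μ P s) (seen P s 0 : Set (ℕ × ℕ)) := by
  induction s with
  | zero => intro j j' _; rfl
  | succ s ih =>
    intro j j' hj
    have h2 : innerState A μ P s (P.T (s + 1)) j = innerState A μ P s (P.T (s + 1)) j' :=
      dependsOn_innerState A μ P ih _ fun p hp => hj p (by
        simp only [Finset.mem_coe, mem_seen] at hp ⊢
        grind)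
    rw [outerState_succ, outerState_succ, h2]

lemma innerState_counters (s t : ℕ) (j : ℕ × ℕ → Fin n) :
    (innerState A μ P s t j).sfo = (outerState A μ P s j).sfo + n + t ∧
      (innerState A μ P s t j).qmo = (outerState A μ P s j).qmo + t := by
  induction t with
  | zero => exact ⟨rfl, rfl⟩
  | succ t ih =>
    rw [innerState_succ]
    simp only [innerStep]
    omega

/-- The oracle counts after `s` epochs. -/
lemma outerState_counters (s : ℕ) (j : ℕ × ℕ → Fin n) :
    (outerState A μ P s j).sfo = ∑ r ∈ Finset.range s, (n + P.T (r + 1)) ∧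
      (outerState A μ P s j).qmo = ∑ r ∈ Finset.range s, P.T (r + 1) := by
  induction s with
  | zero => exact ⟨rfl, rfl⟩
  | succ s ih =>
    rw [outerState_succ, Finset.sum_range_succ, Finset.sum_range_succ]
    have := innerState_counters A μ P s (P.T (s + 1)) j
    simp only
    omega

lemma innerState_acc (s t : ℕ) (j : ℕ × ℕ → Fin n) :
    (innerState A μ P s t j).acc =
      ∑ r ∈ Finset.Icc 1 t, P.θ (s + 1) r • (innerState A μ P s r j).x := by
  induction t with
  | zero => rfl
  | succ t ih =>
    rw [Finset.sum_Icc_succ_top (by omega), ← ih]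
    rfl

end Trajectory

/-! ### Summing the one-step inequality over an epoch -/

/-- The parameters of epoch `s` satisfy what the convergence analysis needs. -/
structure Schedule.IsValid (P : Schedule) (L : ℝ) (s : ℕ) : Prop where
  α_pos : 0 < P.α s
  α_le : P.α s ≤ 1 / 2
  ω_eq : P.ω s = 1 / 2
  β_eq : P.β s = 1 / (3 * P.α s * L)
  T_pos : 1 ≤ P.T s
  θ_nonneg : ∀ t, 1 ≤ t → t ≤ P.T s → 0 ≤ P.θ s t
  θ_sum_pos : 0 < ∑ t ∈ Finset.Icc 1 (P.T s), P.θ s t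

lemma Schedule.IsValid.β_pos {P : Schedule} {L : ℝ} (hL : 0 < L) {s : ℕ} (h : P.IsValid L s) :
    0 < P.β s := by
  have := h.α_pos
  rw [h.β_eq]; positivity

namespace Instance.Assumptions

variable {n d m : ℕ} {A : Instance n d m} (hA : A.Assumptions) {μ : ℝ} {P : Schedule}

include hA

lemma innerState_x_mem (hμ : 0 ≤ μ) {s : ℕ} (hP : P.IsValid A.Lγ (s + 1)) {j : ℕ × ℕ → Fin n}
    (h : (outerState A μ P s j).xt ∈ A.K) (t : ℕ) : (innerState A μ P s t j).x ∈ A.K := by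
  induction t with
  | zero => exact h
  | succ t ih =>
    rw [innerState_succ]
    exact (hA.innerStep_mem hμ hP.α_pos hP.α_le hP.ω_eq (hP.β_pos hA.Lγ_pos) _ h _ _ ih).2

omit hA in
lemma outerState_xt_eq (s : ℕ) (j : ℕ × ℕ → Fin n) :
    (outerState A μ P (s + 1) j).xt = ∑ r ∈ Finset.Icc 1 (P.T (s + 1)),
      ((∑ t ∈ Finset.Icc 1 (P.T (s + 1)), P.θ (s + 1) t)⁻¹ * P.θ (s + 1) r) •
        (innerState A μ P s r j).x := by
  rw [outerState_succ, innerState_acc, Finset.smul_sum]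
  simp only [smul_smul, one_div]

omit hA in
lemma weights_sum {s : ℕ} (hP : P.IsValid A.Lγ s) :
    ∑ r ∈ Finset.Icc 1 (P.T s), (∑ t ∈ Finset.Icc 1 (P.T s), P.θ s t)⁻¹ * P.θ s r = 1 := by
  rw [← Finset.mul_sum, inv_mul_cancel₀ hP.θ_sum_pos.ne']

lemma outerState_xt_mem (hμ : 0 ≤ μ) (hP : ∀ s, 1 ≤ s → P.IsValid A.Lγ s) (s : ℕ)
    (j : ℕ × ℕ → Fin n) : (outerState A μ P s j).xt ∈ A.K := by
  induction s with
  | zero => exact hA.x0_mem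
  | succ s ih =>
    have hs := hP (s + 1) (by omega)
    rw [outerState_xt_eq]
    refine hA.h_convex.1.sum_mem (fun r hr => ?_) (weights_sum hs) fun r _ =>
      hA.innerState_x_mem hμ hs ih r
    rw [Finset.mem_Icc] at hr
    exact mul_nonneg (inv_nonneg.2 hs.θ_sum_pos.le) (hs.θ_nonneg r hr.1 hr.2)

/-- Jensen's inequality for the averaged output of an epoch. -/
lemma gap_outerState_succ_le (hμ : 0 ≤ μ) (hP : ∀ s, 1 ≤ s → P.IsValid A.Lγ s) (s : ℕ)
    (j : ℕ × ℕ → Fin n) :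
    (∑ t ∈ Finset.Icc 1 (P.T (s + 1)), P.θ (s + 1) t) * A.gap (outerState A μ P (s + 1) j).xt ≤
      ∑ t ∈ Finset.Icc 1 (P.T (s + 1)), P.θ (s + 1) t * A.gap (innerState A μ P s t j).x := by
  have hs := hP (s + 1) (by omega)
  have h := hA.gap_convex.map_sum_le (t := Finset.Icc 1 (P.T (s + 1)))
    (w := fun r => (∑ t ∈ Finset.Icc 1 (P.T (s + 1)), P.θ (s + 1) t)⁻¹ * P.θ (s + 1) r)
    (p := fun r => (innerState A μ P s r j).x)
    (fun r hr => by
      rw [Finset.mem_Icc] at hr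
      exact mul_nonneg (inv_nonneg.2 hs.θ_sum_pos.le) (hs.θ_nonneg r hr.1 hr.2))
    (weights_sum hs)
    (fun r _ => hA.innerState_x_mem hμ hs (hA.outerState_xt_mem hμ hP s j) r)
  rw [← outerState_xt_eq] at h
  refine (mul_le_mul_of_nonneg_left h hs.θ_sum_pos.le).trans_eq ?_
  rw [Finset.mul_sum]
  refine Finset.sum_congr rfl fun r _ => ?_
  rw [smul_eq_mul, mul_assoc, mul_inv_cancel_left₀ hs.θ_sum_pos.ne']

section Expectation

variable {Ω : Type*} [MeasurableSpace Ω] {Q : Measure Ω} [IsProbabilityMeasure Q]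
  {I : ℕ → ℕ → Ω → Fin n} (hI : UniformSampling Q I)

include hI

omit hA in
lemma integrable_innerState (φ : Inner d → ℝ) (s t : ℕ) :
    Integrable (fun ω => φ (innerState A μ P s t fun p => I p.1 p.2 ω)) Q :=
  hI.integrable (S := seen P s t) (Ψ := fun j => φ (innerState A μ P s t j)) fun j j' h => by
    simp only [dependsOn_innerState A μ P (dependsOn_outerState A μ P s) t h]

omit hA in
lemma integrable_outerState (φ : Outer d → ℝ) (s : ℕ) :
    Integrable (fun ω => φ (outerState A μ P s fun p => I p.1 p.2 ω)) Q :=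
  hI.integrable (S := seen P s 0) (Ψ := fun j => φ (outerState A μ P s j)) fun j j' h => by
    simp only [dependsOn_outerState A μ P s h]

/-- The one-step inequality in expectation. -/
lemma expected_step_le (hn : 1 ≤ n) (hμ : 0 ≤ μ) (hsc : StrongConvexOn Set.univ μ A.favg)
    (hP : ∀ s, 1 ≤ s → P.IsValid A.Lγ s) (s t : ℕ) :
    ∫ ω, A.gap (innerState A μ P s (t + 1) fun p => I p.1 p.2 ω).x ∂Q +
      3 / 2 * P.α (s + 1) ^ 2 * A.Lγ * (1 + μ * P.β (s + 1)) *
        ∫ ω, ‖(innerState A μ P s (t + 1) fun p => I p.1 p.2 ω).z - A.xs‖ ^ 2 ∂Q ≤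
    (1 / 2 - P.α (s + 1)) * ∫ ω, A.gap (innerState A μ P s t fun p => I p.1 p.2 ω).x ∂Q +
      1 / 2 * ∫ ω, A.gap (outerState A μ P s fun p => I p.1 p.2 ω).xt ∂Q +
      3 / 2 * P.α (s + 1) ^ 2 * A.Lγ *
        ∫ ω, ‖(innerState A μ P s t fun p => I p.1 p.2 ω).z - A.xs‖ ^ 2 ∂Q := by
  have hs := hP (s + 1) (by omega)
  set c := 3 / 2 * P.α (s + 1) ^ 2 * A.Lγ with hc
  set b := 1 + μ * P.β (s + 1) with hb
  have hx1 := integrable_innerState (A := A) (μ := μ) (P := P) hI (fun o => A.gap o.x)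
  have hz1 := integrable_innerState (A := A) (μ := μ) (P := P) hI (fun o => ‖o.z - A.xs‖ ^ 2)
  have hxt := integrable_outerState (A := A) (μ := μ) (P := P) hI (fun o => A.gap o.xt) s
  let Ψ : Fin n → (ℕ × ℕ → Fin n) → ℝ := fun i j =>
    let st := innerStep A μ P (s + 1) (t + 1) (outerState A μ P s j).xt
      (fun i => gradient (A.f i) (outerState A μ P s j).xt) i (innerState A μ P s t j)
    A.gap st.x + c * b * ‖st.z - A.xs‖ ^ 2
  have hΨ : ∀ i, DependsOn (Ψ i) (seen P s t : Set (ℕ × ℕ)) := by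
    intro i j j' h
    have h1 := dependsOn_innerState A μ P (dependsOn_outerState A μ P s) t h
    have h2 := dependsOn_outerState A μ P s (x := j) (y := j') fun p hp => h p (by
      simp only [Finset.mem_coe, mem_seen] at hp ⊢
      grind)
    simp only [Ψ, h1, h2]
  have hnot : ((s + 1, t + 1) : ℕ × ℕ) ∉ seen P s t := by
    rw [mem_seen]; simp
  have havg := hI.integral_avg hnot hΨ
  have hmono : ∫ ω, 1 / (n : ℝ) * ∑ i, Ψ i (fun p => I p.1 p.2 ω) ∂Q ≤
      ∫ ω, ((1 / 2 - P.α (s + 1)) * A.gap (innerState A μ P s t fun p => I p.1 p.2 ω).x +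
        1 / 2 * A.gap (outerState A μ P s fun p => I p.1 p.2 ω).xt +
        c * ‖(innerState A μ P s t fun p => I p.1 p.2 ω).z - A.xs‖ ^ 2) ∂Q := by
    refine integral_mono ?_ ?_ fun ω => ?_
    · exact (integrable_finsetSum _ fun i _ => hI.integrable (hΨ i)).const_mul _
    · exact (((hx1 s t).const_mul _).add (hxt.const_mul _)).add ((hz1 s t).const_mul _)
    · have hmem := hA.outerState_xt_mem hμ hP s fun p => I p.1 p.2 ω
      exact hA.avg_innerStep_le hn hμ hsc hs.α_pos hs.α_le hs.ω_eq hs.β_eq (t + 1) hmem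
        (hA.innerState_x_mem hμ hs hmem t)
  have e1 : ∫ ω, Ψ (I (s + 1) (t + 1) ω) (fun p => I p.1 p.2 ω) ∂Q =
      ∫ ω, A.gap (innerState A μ P s (t + 1) fun p => I p.1 p.2 ω).x ∂Q +
      c * b * ∫ ω, ‖(innerState A μ P s (t + 1) fun p => I p.1 p.2 ω).z - A.xs‖ ^ 2 ∂Q := by
    rw [← integral_const_mul, ← integral_add (hx1 s (t + 1)) ((hz1 s (t + 1)).const_mul _)]
    rfl
  have e2 := integral_add (((hx1 s t).const_mul (1 / 2 - P.α (s + 1))).add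
    (hxt.const_mul (1 / 2))) ((hz1 s t).const_mul c)
  have e3 := integral_add ((hx1 s t).const_mul (1 / 2 - P.α (s + 1))) (hxt.const_mul (1 / 2))
  simp only [Pi.add_apply, integral_const_mul] at e2 e3
  rw [← e1, havg]
  refine hmono.trans_eq ?_
  rw [e2, e3]

lemma expected_gap_succ_le (hμ : 0 ≤ μ) (hP : ∀ s, 1 ≤ s → P.IsValid A.Lγ s) (s : ℕ) :
    (∑ t ∈ Finset.Icc 1 (P.T (s + 1)), P.θ (s + 1) t) *
      ∫ ω, A.gap (outerState A μ P (s + 1) fun p => I p.1 p.2 ω).xt ∂Q ≤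
    ∑ t ∈ Finset.Icc 1 (P.T (s + 1)), P.θ (s + 1) t *
      ∫ ω, A.gap (innerState A μ P s t fun p => I p.1 p.2 ω).x ∂Q := by
  have hx1 := integrable_innerState (A := A) (μ := μ) (P := P) hI (fun o => A.gap o.x)
  have hxt := integrable_outerState (A := A) (μ := μ) (P := P) hI (fun o => A.gap o.xt) (s + 1)
  rw [← integral_const_mul]
  simp only [← integral_const_mul]
  rw [← integral_finsetSum _ fun t _ => (hx1 s t).const_mul _]
  exact integral_mono (hxt.const_mul _)
    (integrable_finsetSum _ fun t _ => (hx1 s t).const_mul _)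
    fun ω => hA.gap_outerState_succ_le hμ hP s _

end Expectation

end Instance.Assumptions

/-! ### Scalar recursions within an epoch -/

lemma sum_Icc_one_succ (φ : ℕ → ℝ) (T : ℕ) :
    ∑ t ∈ Finset.Icc 1 (T + 1), φ t = ∑ t ∈ Finset.range T, φ (t + 1) + φ (T + 1) := by
  have h : ∀ T, ∑ t ∈ Finset.Icc 1 T, φ t = ∑ t ∈ Finset.range T, φ (t + 1) := by
    intro T
    induction T with
    | zero => simp
    | succ T ih => rw [Finset.sum_Icc_succ_top (by omega), ih, Finset.sum_range_succ]
  rw [h, Finset.sum_range_succ]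

lemma sum_thetaPlain (α β : ℝ) (T : ℕ) (φ : ℕ → ℝ) :
    ∑ t ∈ Finset.Icc 1 (T + 1), thetaPlain α β (1 / 2) (T + 1) t * φ t =
      β / α * ((α + 1 / 2) * ∑ t ∈ Finset.range T, φ (t + 1) + φ (T + 1)) := by
  rw [sum_Icc_one_succ]
  have h : ∀ t ∈ Finset.range T, thetaPlain α β (1 / 2) (T + 1) (t + 1) * φ (t + 1) =
      β / α * ((α + 1 / 2) * φ (t + 1)) := by
    intro t ht
    rw [Finset.mem_range] at ht
    rw [thetaPlain, if_pos (by omega)]; ring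
  rw [Finset.sum_congr rfl h, ← Finset.mul_sum, ← Finset.mul_sum, thetaPlain, if_neg (by omega)]
  ring

lemma sum_thetaGeom (μ α β : ℝ) (T : ℕ) (φ : ℕ → ℝ) :
    ∑ t ∈ Finset.Icc 1 (T + 1), thetaGeom μ α β (1 / 2) (T + 1) t * φ t =
      ∑ t ∈ Finset.range (T + 1), (1 + μ * β) ^ t * φ (t + 1) -
        (1 / 2 - α) * ∑ t ∈ Finset.range T, (1 + μ * β) ^ (t + 1) * φ (t + 1) := by
  rw [sum_Icc_one_succ, Finset.sum_range_succ]
  have h : ∀ t ∈ Finset.range T, thetaGeom μ α β (1 / 2) (T + 1) (t + 1) * φ (t + 1) =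
      (1 + μ * β) ^ t * φ (t + 1) - (1 / 2 - α) * ((1 + μ * β) ^ (t + 1) * φ (t + 1)) := by
    intro t ht
    rw [Finset.mem_range] at ht
    rw [thetaGeom, if_pos (by omega), Nat.add_sub_cancel]; ring
  rw [Finset.sum_congr rfl h, Finset.sum_sub_distrib, ← Finset.mul_sum, thetaGeom,
    if_neg (by omega), Nat.add_sub_cancel]
  ring

/-- Telescoping of the one-step inequality, iteration `t + 1` being weighted by `b ^ t`. -/
lemma telescope {e D : ℕ → ℝ} {a c b x : ℝ} (hb : 0 ≤ b)
    (hrec : ∀ t, e (t + 1) + c * b * D (t + 1) ≤ a * e t + 1 / 2 * x + c * D t) (T : ℕ) :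
    ∑ t ∈ Finset.range T, b ^ t * e (t + 1) + c * b ^ T * D T ≤
      a * ∑ t ∈ Finset.range T, b ^ t * e t + 1 / 2 * x * ∑ t ∈ Finset.range T, b ^ t +
        c * D 0 := by
  induction T with
  | zero => simp
  | succ T ih =>
    have h := mul_le_mul_of_nonneg_left (hrec T) (pow_nonneg hb T)
    simp only [Finset.sum_range_succ]
    rw [pow_succ]
    linarith

/-- The outcome of an epoch with weights `thetaPlain`: the factor `b = 1 + μ β` is not exploited. -/
lemma epoch_plain {e D : ℕ → ℝ} {α c b x x' β : ℝ} {T : ℕ} (hT : 1 ≤ T) (hb : 1 ≤ b) (hc : 0 ≤ c)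
    (hα : 0 < α) (hβ : 0 < β) (hD : ∀ t, 0 ≤ D t) (he : e 0 = x)
    (hrec : ∀ t, e (t + 1) + c * b * D (t + 1) ≤ (1 / 2 - α) * e t + 1 / 2 * x + c * D t)
    (hx : (∑ t ∈ Finset.Icc 1 T, thetaPlain α β (1 / 2) T t) * x' ≤
      ∑ t ∈ Finset.Icc 1 T, thetaPlain α β (1 / 2) T t * e t) :
    (1 / 2 - α + T * (1 / 2 + α)) * x' + c * D T ≤ (1 / 2 - α + T / 2) * x + c * D 0 := by
  obtain ⟨T, rfl⟩ : ∃ k, T = k + 1 := ⟨T - 1, by omega⟩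
  have hrec' : ∀ t, e (t + 1) + c * 1 * D (t + 1) ≤ (1 / 2 - α) * e t + 1 / 2 * x + c * D t := by
    intro t
    have : c * 1 * D (t + 1) ≤ c * b * D (t + 1) := by
      have := hD (t + 1); gcongr
    linarith [hrec t]
  have h := telescope (a := 1 / 2 - α) zero_le_one hrec' (T + 1)
  have h1 := sum_thetaPlain α β T fun _ => 1
  simp only [mul_one, Finset.sum_const, Finset.card_range, nsmul_eq_mul] at h1
  rw [sum_thetaPlain, h1] at hx
  have hx' : ((α + 1 / 2) * T + 1) * x' ≤
      (α + 1 / 2) * ∑ t ∈ Finset.range T, e (t + 1) + e (T + 1) := by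
    have hp : 0 < β / α := by positivity
    refine le_of_mul_le_mul_left ?_ hp
    linarith
  simp only [one_pow, one_mul, mul_one, Finset.sum_const, Finset.card_range, nsmul_eq_mul] at h
  rw [Finset.sum_range_succ, Finset.sum_range_succ' (fun t => e t), he] at h
  push_cast at h ⊢
  linarith

/-- The outcome of an epoch with weights `thetaGeom`. -/
lemma epoch_geom {e D : ℕ → ℝ} {α c μ x x' β : ℝ} {T : ℕ} (hT : 1 ≤ T) (hb : 0 ≤ μ * β)
    (he : e 0 = x)
    (hrec : ∀ t, e (t + 1) + c * (1 + μ * β) * D (t + 1) ≤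
      (1 / 2 - α) * e t + 1 / 2 * x + c * D t)
    (hx : (∑ t ∈ Finset.Icc 1 T, thetaGeom μ α β (1 / 2) T t) * x' ≤
      ∑ t ∈ Finset.Icc 1 T, thetaGeom μ α β (1 / 2) T t * e t) :
    (1 / 2 - α + (1 / 2 + α) * ∑ t ∈ Finset.range T, (1 + μ * β) ^ t) * x' +
        c * (1 + μ * β) ^ T * D T ≤
      (1 / 2 - α + 1 / 2 * ∑ t ∈ Finset.range T, (1 + μ * β) ^ t) * x + c * D 0 := by
  obtain ⟨T, rfl⟩ : ∃ k, T = k + 1 := ⟨T - 1, by omega⟩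
  have h := telescope (a := 1 / 2 - α) (by linarith) hrec (T + 1)
  have h1 := sum_thetaGeom μ α β T fun _ => 1
  simp only [mul_one] at h1
  rw [sum_thetaGeom, h1] at hx
  have e1 := Finset.sum_range_succ' (fun t => (1 + μ * β) ^ t * e t) T
  have e2 := Finset.sum_range_succ' (fun t => (1 + μ * β) ^ t) T
  rw [he] at e1
  rw [e1] at h
  simp only [pow_zero, one_mul] at h e2
  have e3 : ∑ t ∈ Finset.range T, (1 + μ * β) ^ (t + 1) =
      ∑ t ∈ Finset.range (T + 1), (1 + μ * β) ^ t - 1 := by linarith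
  rw [e3] at hx
  linarith

/-! ### Epoch recursions in expectation -/

section Expected

variable {n d m : ℕ} (A : Instance n d m) (μ : ℝ) (P : Schedule) {Ω : Type*} [MeasurableSpace Ω]
  (Q : Measure Ω) (I : ℕ → ℕ → Ω → Fin n)

/-- The expected penalized gap of the output of epoch `s`. -/
noncomputable def expGap (s : ℕ) : ℝ :=
  ∫ ω, A.gap (outerState A μ P s fun p => I p.1 p.2 ω).xt ∂Q

/-- The expected squared distance to the solution of the prox center after epoch `s`. -/
noncomputable def expDist (s : ℕ) : ℝ :=
  ∫ ω, ‖(outerState A μ P s fun p => I p.1 p.2 ω).z - A.xs‖ ^ 2 ∂Q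

variable {A μ P Q I}

lemma expDist_nonneg (s : ℕ) : 0 ≤ expDist A μ P Q I s :=
  integral_nonneg fun _ => by positivity

namespace Instance.Assumptions

variable (hA : A.Assumptions) (hn : 1 ≤ n) (hI : UniformSampling Q I) (hμ : 0 ≤ μ)
  (hP : ∀ s, 1 ≤ s → P.IsValid A.Lγ s)

include hA hμ hP in
lemma expGap_nonneg (s : ℕ) : 0 ≤ expGap A μ P Q I s :=
  integral_nonneg fun _ => hA.gap_nonneg (hA.outerState_xt_mem hμ hP s _)

include hA in
lemma expGap_zero_add_le [IsProbabilityMeasure Q] :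
    2 * expGap A μ P Q I 0 + 3 * A.Lγ / 2 * expDist A μ P Q I 0 ≤ A.D0 := by
  have h1 : expGap A μ P Q I 0 = A.gap A.x0 := by
    simp [expGap, outerState, run]
  have h2 : expDist A μ P Q I 0 = ‖A.x0 - A.xs‖ ^ 2 := by
    simp [expDist, outerState, run]
  rw [h1, h2]
  exact hA.two_mul_gap_x0_le

include hA hn hI hμ hP

variable [IsProbabilityMeasure Q]

/-- The expected progress of an epoch with weights `thetaPlain`. -/
lemma expGap_plain (hsc : StrongConvexOn Set.univ μ A.favg) {s : ℕ}
    (hθ : ∀ t, P.θ (s + 1) t =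
      thetaPlain (P.α (s + 1)) (P.β (s + 1)) (1 / 2) (P.T (s + 1)) t) :
    (1 / 2 - P.α (s + 1) + P.T (s + 1) * (1 / 2 + P.α (s + 1))) * expGap A μ P Q I (s + 1) +
        3 / 2 * P.α (s + 1) ^ 2 * A.Lγ * expDist A μ P Q I (s + 1) ≤
      (1 / 2 - P.α (s + 1) + P.T (s + 1) / 2) * expGap A μ P Q I s +
        3 / 2 * P.α (s + 1) ^ 2 * A.Lγ * expDist A μ P Q I s := by
  have hs := hP (s + 1) (by omega)
  have hL := hA.Lγ_pos
  have hβ := hs.β_pos hL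
  have h := hA.expected_gap_succ_le hI hμ hP s
  simp only [hθ] at h
  exact epoch_plain hs.T_pos (le_add_of_nonneg_right (mul_nonneg hμ hβ.le)) (by positivity)
    hs.α_pos hβ
    (D := fun t => ∫ ω, ‖(innerState A μ P s t fun p => I p.1 p.2 ω).z - A.xs‖ ^ 2 ∂Q)
    (fun t => integral_nonneg fun _ => by positivity) rfl
    (fun t => hA.expected_step_le hI hn hμ hsc hP s t) h

/-- The expected progress of an epoch with weights `thetaGeom`. -/
lemma expGap_geom (hsc : StrongConvexOn Set.univ μ A.favg) {s : ℕ}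
    (hθ : ∀ t, P.θ (s + 1) t =
      thetaGeom μ (P.α (s + 1)) (P.β (s + 1)) (1 / 2) (P.T (s + 1)) t) :
    (1 / 2 - P.α (s + 1) + (1 / 2 + P.α (s + 1)) *
          ∑ t ∈ Finset.range (P.T (s + 1)), (1 + μ * P.β (s + 1)) ^ t) *
        expGap A μ P Q I (s + 1) +
        3 / 2 * P.α (s + 1) ^ 2 * A.Lγ * (1 + μ * P.β (s + 1)) ^ P.T (s + 1) *
          expDist A μ P Q I (s + 1) ≤
      (1 / 2 - P.α (s + 1) + 1 / 2 *
          ∑ t ∈ Finset.range (P.T (s + 1)), (1 + μ * P.β (s + 1)) ^ t) * expGap A μ P Q I s +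
        3 / 2 * P.α (s + 1) ^ 2 * A.Lγ * expDist A μ P Q I s := by
  have hs := hP (s + 1) (by omega)
  have hβ := hs.β_pos hA.Lγ_pos
  have h := hA.expected_gap_succ_le hI hμ hP s
  simp only [hθ] at h
  exact epoch_geom hs.T_pos (mul_nonneg hμ hβ.le)
    (D := fun t => ∫ ω, ‖(innerState A μ P s t fun p => I p.1 p.2 ω).z - A.xs‖ ^ 2 ∂Q) rfl
    (fun t => hA.expected_step_le hI hn hμ hsc hP s t) h

end Instance.Assumptions

end Expected

/-! ### Scalar recursions over the epochs -/

lemma warmup_rate {Δ d : ℕ → ℝ} {L D : ℝ} {s₀ : ℕ} (h0 : 2 * Δ 0 + 3 * L / 2 * d 0 ≤ D)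
    (hrec : ∀ s < s₀, 2 ^ s * Δ (s + 1) + 3 / 8 * L * d (s + 1) ≤
      2 ^ s / 2 * Δ s + 3 / 8 * L * d s) :
    ∀ s ≤ s₀, 2 ^ s * Δ s + 3 / 4 * L * d s ≤ D / 2 := by
  intro s hs
  induction s with
  | zero => norm_num; linarith
  | succ s ih =>
    have h1 := ih (by omega)
    have h2 := hrec s (by omega)
    rw [pow_succ]
    linarith

/-- With `α = 2 / (k + 5)` the quantity `(k + 5)² T Δ / 8 + 3 L d / 2`, up to a correction of lower
order in `T`, does not increase. -/
lemma sublinear_rate {Δ d : ℕ → ℝ} {T L D : ℝ} (hT : 1 ≤ T) (hΔ : ∀ k, 0 ≤ Δ k)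
    (h0 : 2 * T * Δ 0 + 3 / 4 * L * d 0 ≤ D / 2) {K : ℕ}
    (hrec : ∀ k < K, (1 / 2 - 2 / ((k : ℝ) + 5) + T * (1 / 2 + 2 / ((k : ℝ) + 5))) * Δ (k + 1) +
        3 / 2 * (2 / ((k : ℝ) + 5)) ^ 2 * L * d (k + 1) ≤
      (1 / 2 - 2 / ((k : ℝ) + 5) + T / 2) * Δ k + 3 / 2 * (2 / ((k : ℝ) + 5)) ^ 2 * L * d k) :
    ∀ k ≤ K, ((k : ℝ) + 5) ^ 2 * T / 8 * Δ k + 3 / 2 * L * d k ≤ D := by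
  have main : ∀ k ≤ K, (((k : ℝ) + 5) ^ 2 * T / 8 + ((k : ℝ) + 5) * (k + 1) / 8) * Δ k +
      3 / 2 * L * d k ≤ D := by
    intro k hk
    induction k with
    | zero =>
      have := mul_le_mul_of_nonneg_right hT (hΔ 0)
      norm_num
      linarith [hΔ 0]
    | succ k ih =>
      have h1 := ih (by omega)
      have h2 := hrec k (by omega)
      have hk0 : (0 : ℝ) ≤ k := Nat.cast_nonneg k
      have h3 := mul_le_mul_of_nonneg_left h2 (by positivity : 0 ≤ ((k : ℝ) + 5) ^ 2 / 4)
      have e1 : ((k : ℝ) + 5) ^ 2 / 4 * ((1 / 2 - 2 / ((k : ℝ) + 5) +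
          T * (1 / 2 + 2 / ((k : ℝ) + 5))) * Δ (k + 1) +
          3 / 2 * (2 / ((k : ℝ) + 5)) ^ 2 * L * d (k + 1)) =
          (((k : ℝ) + 5) ^ 2 * (1 + T) / 8 + ((k : ℝ) + 5) * (T - 1) / 2) * Δ (k + 1) +
            3 / 2 * L * d (k + 1) := by
        field_simp; ring
      have e2 : ((k : ℝ) + 5) ^ 2 / 4 * ((1 / 2 - 2 / ((k : ℝ) + 5) + T / 2) * Δ k +
          3 / 2 * (2 / ((k : ℝ) + 5)) ^ 2 * L * d k) =
          (((k : ℝ) + 5) ^ 2 * T / 8 + ((k : ℝ) + 5) * (k + 1) / 8) * Δ k +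
            3 / 2 * L * d k := by
        field_simp; ring
      rw [e1, e2] at h3
      have h4 : (((k + 1 : ℕ) : ℝ) + 5) ^ 2 * T / 8 +
          (((k + 1 : ℕ) : ℝ) + 5) * ((k + 1 : ℕ) + 1) / 8 ≤
          ((k : ℝ) + 5) ^ 2 * (1 + T) / 8 + ((k : ℝ) + 5) * (T - 1) / 2 := by
        push_cast
        nlinarith
      have h5 := mul_le_mul_of_nonneg_right h4 (hΔ (k + 1))
      linarith
  intro k hk
  have h1 := main k hk
  have h2 : 0 ≤ ((k : ℝ) + 5) * (k + 1) / 8 * Δ k := mul_nonneg (by positivity) (hΔ k)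
  linarith

lemma linear_rate {U : ℕ → ℝ} {q : ℝ} (hq : 0 ≤ q) (hrec : ∀ j, q * U (j + 1) ≤ U j) (j : ℕ) :
    q ^ j * U j ≤ U 0 := by
  induction j with
  | zero => simp
  | succ j ih =>
    have := mul_le_mul_of_nonneg_left (hrec j) (pow_nonneg hq j)
    rw [pow_succ]
    linarith

/-! ### Epoch lengths and oracle counts -/

lemma s0_pos (n : ℕ) : 1 ≤ s0 n := by unfold s0; omega

lemma epochLength_succ {n s : ℕ} (hs : s < s0 n) : epochLength n (s + 1) = 2 ^ s := by
  rw [epochLength, if_pos (by omega), Nat.add_sub_cancel]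

lemma epochLength_late {n k : ℕ} : epochLength n (s0 n + k + 1) = 2 ^ (s0 n - 1) := by
  rw [epochLength, if_neg (by omega)]

lemma epochLength_pos (n s : ℕ) : 1 ≤ epochLength n s := by
  unfold epochLength; split_ifs <;> exact Nat.one_le_two_pow

/-- The final epoch length. -/
noncomputable def lateLength (n : ℕ) : ℝ := 2 ^ (s0 n - 1)

lemma lateLength_ge_one (n : ℕ) : 1 ≤ lateLength n := one_le_pow₀ (by norm_num)

lemma lateLength_le {n : ℕ} (hn : 1 ≤ n) : lateLength n ≤ n := by
  have : 2 ^ (s0 n - 1) ≤ n := by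
    rw [s0, Nat.add_sub_cancel]; exact Nat.pow_log_le_self 2 (by omega)
  unfold lateLength; exact_mod_cast this

lemma two_mul_lateLength (n : ℕ) : 2 * lateLength n = 2 ^ s0 n := by
  have := s0_pos n
  rw [lateLength, ← pow_succ', Nat.sub_add_cancel this]

lemma le_two_mul_lateLength (n : ℕ) : (n : ℝ) ≤ 2 * lateLength n := by
  rw [two_mul_lateLength]
  have : n < 2 ^ s0 n := Nat.lt_pow_succ_log_self (by norm_num) n
  exact_mod_cast this.le

lemma sum_epochLength_early {n s : ℕ} (hs : s ≤ s0 n) :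
    (∑ r ∈ Finset.range s, epochLength n (r + 1)) + 1 = 2 ^ s := by
  induction s with
  | zero => simp
  | succ s ih =>
    rw [Finset.sum_range_succ, epochLength_succ (by omega), pow_succ]
    have := ih (by omega)
    omega

lemma sum_epochLength_late (n k : ℕ) :
    (∑ r ∈ Finset.range (s0 n + k), epochLength n (r + 1)) + 1 =
      2 ^ s0 n + k * 2 ^ (s0 n - 1) := by
  induction k with
  | zero => simpa using sum_epochLength_early le_rfl
  | succ k ih =>
    rw [← add_assoc, Finset.sum_range_succ, epochLength_late]
    linarith

lemma s0_le {n : ℕ} (hn : 1 ≤ n) : (s0 n : ℝ) ≤ 2 * Real.log n + 1 := by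
  have h1 : (2 : ℝ) ^ Nat.log 2 n ≤ n := by exact_mod_cast Nat.pow_log_le_self 2 (by omega)
  have h2 := Real.log_le_log (by positivity) h1
  rw [Real.log_pow] at h2
  have h3 := Real.log_two_gt_d9
  have h4 : (0 : ℝ) ≤ Nat.log 2 n := Nat.cast_nonneg _
  unfold s0
  push_cast
  nlinarith

section Counts

variable {n d m : ℕ} (A : Instance n d m) (μ : ℝ) {P : Schedule} (hT : P.T = epochLength n)
  (j : ℕ × ℕ → Fin n)

include hT

lemma counts_early {S : ℕ} (hS : S ≤ s0 n) :
    ((outerState A μ P S j).sfo : ℝ) = n * S + (2 ^ S - 1) ∧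
      ((outerState A μ P S j).qmo : ℝ) = 2 ^ S - 1 := by
  obtain ⟨h1, h2⟩ := outerState_counters A μ P S j
  have h3 : ((∑ r ∈ Finset.range S, epochLength n (r + 1) : ℕ) : ℝ) + 1 = 2 ^ S := by
    exact_mod_cast sum_epochLength_early hS
  rw [h1, h2, hT, Finset.sum_add_distrib]
  simp only [Finset.sum_const, Finset.card_range, smul_eq_mul, Nat.cast_add, Nat.cast_mul]
  constructor <;> linarith

lemma counts_late (hn : 1 ≤ n) (k : ℕ) :
    ((outerState A μ P (s0 n + k) j).sfo : ℝ) ≤ n * (2 * Real.log n + 3 + 2 * k) ∧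
      ((outerState A μ P (s0 n + k) j).qmo : ℝ) ≤ n * (k + 2) := by
  obtain ⟨h1, h2⟩ := outerState_counters A μ P (s0 n + k) j
  have h3 : ((∑ r ∈ Finset.range (s0 n + k), epochLength n (r + 1) : ℕ) : ℝ) + 1 =
      2 * lateLength n + k * lateLength n := by
    rw [two_mul_lateLength]; unfold lateLength; exact_mod_cast sum_epochLength_late n k
  have h4 := lateLength_le hn
  have h5 := s0_le hn
  have hn0 : (0 : ℝ) ≤ n := Nat.cast_nonneg n
  have hk0 : (0 : ℝ) ≤ k := Nat.cast_nonneg k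
  have h6 := mul_le_mul_of_nonneg_left h4 hk0
  have h7 := mul_le_mul_of_nonneg_left h5 hn0
  rw [h1, h2, hT, Finset.sum_add_distrib]
  simp only [Finset.sum_const, Finset.card_range, smul_eq_mul, Nat.cast_add, Nat.cast_mul]
  constructor <;> linarith

end Counts

/-! ### Rates of the individual phases -/

lemma Schedule.isValid_plain {P : Schedule} {L : ℝ} (hL : 0 < L) {s : ℕ} (hα : 0 < P.α s)
    (hα2 : P.α s ≤ 1 / 2) (hω : P.ω s = 1 / 2) (hβ : P.β s = 1 / (3 * P.α s * L))
    (hT : 1 ≤ P.T s)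
    (hθ : ∀ t, P.θ s t = thetaPlain (P.α s) (P.β s) (1 / 2) (P.T s) t) : P.IsValid L s := by
  have hβ0 : 0 < P.β s := by rw [hβ]; positivity
  have hpos : ∀ t, 0 < P.θ s t := by
    intro t
    rw [hθ, thetaPlain]
    split_ifs <;> positivity
  exact ⟨hα, hα2, hω, hβ, hT, fun t _ _ => (hpos t).le,
    Finset.sum_pos (fun t _ => hpos t) ⟨1, by simpa using hT⟩⟩

lemma Schedule.isValid_geom {P : Schedule} {L μ : ℝ} (hL : 0 < L) (hμ : 0 ≤ μ) {s : ℕ}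
    (hα : 0 < P.α s)
    (hα2 : P.α s ≤ 1 / 2) (hω : P.ω s = 1 / 2) (hβ : P.β s = 1 / (3 * P.α s * L))
    (hT : 1 ≤ P.T s)
    (hθ : ∀ t, P.θ s t = thetaGeom μ (P.α s) (P.β s) (1 / 2) (P.T s) t)
    (hsmall : (1 / 2 - P.α s) * (1 + μ * P.β s) < 1) : P.IsValid L s := by
  have hβ0 : 0 < P.β s := by rw [hβ]; positivity
  have hb : 0 < 1 + μ * P.β s := by positivity
  have hpos : ∀ t, 1 ≤ t → 0 < P.θ s t := by
    intro t ht
    obtain ⟨t, rfl⟩ : ∃ r, t = r + 1 := ⟨t - 1, by omega⟩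
    rw [hθ, thetaGeom, Nat.add_sub_cancel]
    have hp := pow_pos hb t
    split_ifs
    · rw [pow_succ]
      have := mul_lt_mul_of_pos_left hsmall hp
      linarith
    · exact hp
  exact ⟨hα, hα2, hω, hβ, hT, fun t ht _ => (hpos t ht).le,
    Finset.sum_pos (fun t ht => hpos t (Finset.mem_Icc.1 ht).1) ⟨1, by simpa using hT⟩⟩

namespace Instance.Assumptions

variable {n d m : ℕ} {A : Instance n d m} {μ : ℝ} {P : Schedule} {Ω : Type*} [MeasurableSpace Ω]
  {Q : Measure Ω} [IsProbabilityMeasure Q] {I : ℕ → ℕ → Ω → Fin n}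
  (hA : A.Assumptions) (hn : 1 ≤ n) (hI : UniformSampling Q I) (hμ : 0 ≤ μ)
  (hP : ∀ s, 1 ≤ s → P.IsValid A.Lγ s) (hsc : StrongConvexOn Set.univ μ A.favg)
  (hT : P.T = epochLength n)

include hA hn hI hμ hP hsc hT

/-- In the first `s₀` epochs, whose lengths double, the gap halves with every epoch. -/
lemma warmup_phase (hα : ∀ s < s0 n, P.α (s + 1) = 1 / 2)
    (hθ : ∀ s < s0 n, ∀ t, P.θ (s + 1) t =
      thetaPlain (P.α (s + 1)) (P.β (s + 1)) (1 / 2) (P.T (s + 1)) t) {s : ℕ} (hs : s ≤ s0 n) :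
    2 ^ s * expGap A μ P Q I s + 3 / 4 * A.Lγ * expDist A μ P Q I s ≤ A.D0 / 2 := by
  refine warmup_rate hA.expGap_zero_add_le (fun s hs => ?_) s hs
  have h := hA.expGap_plain hn hI hμ hP hsc (hθ s hs)
  rw [hα s hs, hT, epochLength_succ hs] at h
  push_cast at h
  norm_num at h
  linarith

/-- The gap decreases like `1 / (k² n)` in epochs with `α = 2 / (k + 5)`. -/
lemma sublinear_phase (hα : ∀ s < s0 n, P.α (s + 1) = 1 / 2)
    (hθ : ∀ s < s0 n, ∀ t, P.θ (s + 1) t =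
      thetaPlain (P.α (s + 1)) (P.β (s + 1)) (1 / 2) (P.T (s + 1)) t) {K : ℕ}
    (hα' : ∀ k < K, P.α (s0 n + k + 1) = 2 / ((k : ℝ) + 5))
    (hθ' : ∀ k < K, ∀ t, P.θ (s0 n + k + 1) t = thetaPlain (P.α (s0 n + k + 1))
      (P.β (s0 n + k + 1)) (1 / 2) (P.T (s0 n + k + 1)) t) {k : ℕ} (hk : k ≤ K) :
    ((k : ℝ) + 5) ^ 2 * lateLength n / 8 * expGap A μ P Q I (s0 n + k) +
      3 / 2 * A.Lγ * expDist A μ P Q I (s0 n + k) ≤ A.D0 := by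
  refine sublinear_rate (Δ := fun k => expGap A μ P Q I (s0 n + k))
    (d := fun k => expDist A μ P Q I (s0 n + k)) (lateLength_ge_one n)
    (fun k => hA.expGap_nonneg hμ hP _) ?_ (fun k hk => ?_) k hk
  · have h := hA.warmup_phase hn hI hμ hP hsc hT hα hθ le_rfl
    rw [two_mul_lateLength]
    exact h
  · have h := hA.expGap_plain hn hI hμ hP hsc (hθ' k hk)
    rw [hα' k hk, hT, epochLength_late] at h
    push_cast at h
    exact h

/-- The consequence of `sublinear_phase` in terms of the number `n` of components. -/
lemma expGap_sublinear (hα : ∀ s < s0 n, P.α (s + 1) = 1 / 2)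
    (hθ : ∀ s < s0 n, ∀ t, P.θ (s + 1) t =
      thetaPlain (P.α (s + 1)) (P.β (s + 1)) (1 / 2) (P.T (s + 1)) t) {K : ℕ}
    (hα' : ∀ k < K, P.α (s0 n + k + 1) = 2 / ((k : ℝ) + 5))
    (hθ' : ∀ k < K, ∀ t, P.θ (s0 n + k + 1) t = thetaPlain (P.α (s0 n + k + 1))
      (P.β (s0 n + k + 1)) (1 / 2) (P.T (s0 n + k + 1)) t) {k : ℕ} (hk : k ≤ K) :
    ((k : ℝ) + 4) ^ 2 * n * expGap A μ P Q I (s0 n + k) ≤ 16 * A.D0 := by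
  have h := hA.sublinear_phase hn hI hμ hP hsc hT hα hθ hα' hθ' hk
  have h1 := le_two_mul_lateLength n
  have h2 := hA.expGap_nonneg (Q := Q) (I := I) hμ hP (s0 n + k)
  have h3 : 0 ≤ 3 / 2 * A.Lγ * expDist A μ P Q I (s0 n + k) :=
    mul_nonneg (by have := hA.Lγ_pos; positivity) (expDist_nonneg _)
  have hk0 : (0 : ℝ) ≤ k := Nat.cast_nonneg k
  have hn0 : (0 : ℝ) ≤ n := Nat.cast_nonneg n
  have h4 : ((k : ℝ) + 4) ^ 2 * n ≤ ((k : ℝ) + 5) ^ 2 * (2 * lateLength n) := by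
    gcongr
    norm_num
  have h5 := mul_le_mul_of_nonneg_right h4 h2
  linarith

/-- Linear convergence when `α = 1 / 2` throughout: the geometric weights gain a factor `4 / 5`
per epoch. -/
lemma expGap_linear_half (hα : ∀ s, P.α (s + 1) = 1 / 2)
    (hθ : ∀ s < s0 n, ∀ t, P.θ (s + 1) t =
      thetaPlain (P.α (s + 1)) (P.β (s + 1)) (1 / 2) (P.T (s + 1)) t)
    (hθ' : ∀ k t, P.θ (s0 n + k + 1) t = thetaGeom μ (P.α (s0 n + k + 1))
      (P.β (s0 n + k + 1)) (1 / 2) (P.T (s0 n + k + 1)) t)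
    (hκ : 3 * A.Lγ ≤ 4 * n * μ) (j : ℕ) :
    (5 / 4) ^ j * (n * expGap A μ P Q I (s0 n + j)) ≤ A.D0 := by
  have hL := hA.Lγ_pos
  have hnpos : (0 : ℝ) < n := by exact_mod_cast hn
  set b := μ * (2 / (3 * A.Lγ)) with hb
  have hb0 : 0 ≤ b := by positivity
  have hβ : ∀ k, μ * P.β (s0 n + k + 1) = b := by
    intro k
    rw [(hP (s0 n + k + 1) (by omega)).β_eq, hα, hb]
    field_simp
  set N := 2 ^ (s0 n - 1) with hN
  have hNT : ((N : ℕ) : ℝ) = lateLength n := by rw [hN, lateLength]; push_cast; rfl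
  set G := ∑ t ∈ Finset.range N, (1 + b) ^ t with hG
  have hGT : lateLength n ≤ G := by
    have : ∑ t ∈ Finset.range N, (1 : ℝ) ≤ G :=
      Finset.sum_le_sum fun t _ => one_le_pow₀ (by linarith)
    simpa [hNT] using this
  have hT1 := lateLength_ge_one n
  have hnT := le_two_mul_lateLength n
  have hpow : 5 / 4 ≤ (1 + b) ^ N := by
    have h1 := one_add_mul_le_pow (by linarith : (-2 : ℝ) ≤ b) N
    have h2 : 1 / (2 * n) ≤ b := by
      rw [hb, mul_div_assoc', div_le_div_iff₀ (by positivity) (by positivity)]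
      linarith
    have h3 : n / 2 * (1 / (2 * (n : ℝ))) ≤ N * b := by
      rw [hNT]
      have : (n : ℝ) / 2 ≤ lateLength n := by linarith
      gcongr
    have h4 : n / 2 * (1 / (2 * (n : ℝ))) = 1 / 4 := by field_simp; norm_num
    linarith
  let U : ℕ → ℝ := fun j => G / 2 * expGap A μ P Q I (s0 n + j) +
    3 / 8 * A.Lγ * expDist A μ P Q I (s0 n + j)
  have hrec : ∀ j, 5 / 4 * U (j + 1) ≤ U j := by
    intro j
    have h := hA.expGap_geom hn hI hμ hP hsc (hθ' j)
    rw [hβ j, hα, hT, epochLength_late, ← hN, ← hG] at h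
    have h1 := hA.expGap_nonneg (Q := Q) (I := I) hμ hP (s0 n + (j + 1))
    have h2 := expDist_nonneg (A := A) (μ := μ) (P := P) (Q := Q) (I := I) (s0 n + (j + 1))
    have h3 : 3 / 8 * A.Lγ * expDist A μ P Q I (s0 n + (j + 1)) * (5 / 4) ≤
        3 / 8 * A.Lγ * expDist A μ P Q I (s0 n + (j + 1)) * (1 + b) ^ N := by gcongr
    have h4 : 0 ≤ G * expGap A μ P Q I (s0 n + (j + 1)) := mul_nonneg (by linarith) h1
    simp only [U]
    rw [← add_assoc] at *
    linarith
  have hlin := linear_rate (by norm_num) hrec j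
  have hw := hA.warmup_phase hn hI hμ hP hsc hT (fun s _ => hα s) hθ le_rfl
  rw [← two_mul_lateLength] at hw
  -- `G` may be exponentially large in `n`; only `G ≥ T` is used to compare `U / G` with the
  -- potential of the warm-up phase
  have hU0 : lateLength n * U 0 ≤ G * (A.D0 / 4) := by
    have h2 := expDist_nonneg (A := A) (μ := μ) (P := P) (Q := Q) (I := I) (s0 n)
    have h3 : lateLength n * (3 / 8 * A.Lγ * expDist A μ P Q I (s0 n)) ≤
        G * (3 / 8 * A.Lγ * expDist A μ P Q I (s0 n)) := by gcongr
    have h4 := mul_le_mul_of_nonneg_left hw (by linarith : 0 ≤ G)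
    have h5 : 0 ≤ G * lateLength n * expGap A μ P Q I (s0 n) :=
      mul_nonneg (mul_nonneg (by linarith) (by linarith)) (hA.expGap_nonneg hμ hP _)
    simp only [U, add_zero]
    linarith
  have hUj : G / 2 * expGap A μ P Q I (s0 n + j) ≤ U j := by
    have : 0 ≤ 3 / 8 * A.Lγ * expDist A μ P Q I (s0 n + j) :=
      mul_nonneg (by positivity) (expDist_nonneg _)
    simp only [U]; linarith
  have h5 : (5 / 4) ^ j * (G / 2 * expGap A μ P Q I (s0 n + j)) ≤ U 0 :=
    (mul_le_mul_of_nonneg_left hUj (by positivity)).trans hlin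
  have h6 := mul_le_mul_of_nonneg_left h5 (by linarith : 0 ≤ lateLength n)
  have hGpos : 0 < G := by linarith
  have h7 : (5 / 4) ^ j * (2 * lateLength n * expGap A μ P Q I (s0 n + j)) ≤ A.D0 := by
    refine le_of_mul_le_mul_left ?_ hGpos
    linarith
  refine le_trans ?_ h7
  have := hA.expGap_nonneg (Q := Q) (I := I) hμ hP (s0 n + j)
  gcongr

/-- Linear convergence once `α` has reached the value `ρ = √(n / (3 κ)) < 1 / 2`, after `K` epochs
with `α = 2 / (k + 5)`; the geometric weights gain a factor `1 + ρ / 2` per epoch. -/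
lemma expGap_linear {ρ : ℝ} (hρ0 : 0 < ρ) (hρ : ρ < 1 / 2) (hρκ : 3 * A.Lγ * ρ ^ 2 = n * μ)
    (hα : ∀ s < s0 n, P.α (s + 1) = 1 / 2)
    (hθ : ∀ s < s0 n, ∀ t, P.θ (s + 1) t =
      thetaPlain (P.α (s + 1)) (P.β (s + 1)) (1 / 2) (P.T (s + 1)) t) {K : ℕ}
    (hK : 2 ≤ ρ * (K + 5))
    (hα' : ∀ k < K, P.α (s0 n + k + 1) = 2 / ((k : ℝ) + 5))
    (hθ' : ∀ k < K, ∀ t, P.θ (s0 n + k + 1) t = thetaPlain (P.α (s0 n + k + 1))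
      (P.β (s0 n + k + 1)) (1 / 2) (P.T (s0 n + k + 1)) t)
    (hα'' : ∀ k, K ≤ k → P.α (s0 n + k + 1) = ρ)
    (hθ'' : ∀ k, K ≤ k → ∀ t, P.θ (s0 n + k + 1) t = thetaGeom μ (P.α (s0 n + k + 1))
      (P.β (s0 n + k + 1)) (1 / 2) (P.T (s0 n + k + 1)) t) (j : ℕ) :
    (1 + ρ / 2) ^ j * (n * expGap A μ P Q I (s0 n + (K + j))) ≤ 12 * ρ ^ 2 * A.D0 := by
  have hL := hA.Lγ_pos
  have hnpos : (0 : ℝ) < n := by exact_mod_cast hn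
  set b := ρ / n with hb
  have hb0 : 0 ≤ b := by positivity
  have hβ : ∀ k, K ≤ k → μ * P.β (s0 n + k + 1) = b := by
    intro k hk
    rw [(hP (s0 n + k + 1) (by omega)).β_eq, hα'' k hk, hb, mul_one_div, div_eq_div_iff
      (by positivity) (by positivity)]
    linarith
  set N := 2 ^ (s0 n - 1) with hN
  have hNT : ((N : ℕ) : ℝ) = lateLength n := by rw [hN, lateLength]; push_cast; rfl
  set T := lateLength n with hTdef
  have hT1 : 1 ≤ T := lateLength_ge_one n
  have hnT : (n : ℝ) ≤ 2 * T := le_two_mul_lateLength n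
  have hTn : T ≤ n := lateLength_le hn
  set G := ∑ t ∈ Finset.range N, (1 + b) ^ t with hG
  have hGT : T ≤ G := by
    have : ∑ t ∈ Finset.range N, (1 : ℝ) ≤ G :=
      Finset.sum_le_sum fun t _ => one_le_pow₀ (by linarith)
    simpa [hNT] using this
  have hpow2 : (1 + b) ^ N ≤ 2 := by
    have h1 : 1 + b ≤ Real.exp b := by linarith [Real.add_one_le_exp b]
    have h2 : (1 + b) ^ N ≤ Real.exp b ^ N := pow_le_pow_left₀ (by linarith) h1 N
    rw [← Real.exp_nat_mul] at h2
    have h3 : N * b ≤ 1 / 2 := by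
      rw [hNT, hb, mul_div_assoc', div_le_iff₀ hnpos]
      nlinarith
    have h4 : Real.exp (N * b) ≤ Real.exp (1 / 2) := Real.exp_le_exp.2 h3
    have h5 : Real.exp (1 / 2) * (1 / 2) ≤ 1 := by
      have h6 := Real.add_one_le_exp (-(1 / 2) : ℝ)
      have h7 : Real.exp (1 / 2) * Real.exp (-(1 / 2)) = 1 := by rw [← Real.exp_add]; simp
      have h8 := Real.exp_pos (1 / 2)
      nlinarith
    linarith
  have hG2 : G ≤ 2 * T := by
    have : G ≤ ∑ t ∈ Finset.range N, (2 : ℝ) := Finset.sum_le_sum fun t ht =>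
      (pow_le_pow_right₀ (by linarith) (Finset.mem_range.1 ht).le).trans hpow2
    simp only [Finset.sum_const, Finset.card_range, nsmul_eq_mul, hNT] at this
    linarith
  have hpow : 1 + ρ / 2 ≤ (1 + b) ^ N := by
    have h1 := one_add_mul_le_pow (by linarith : (-2 : ℝ) ≤ b) N
    have h3 : ρ / 2 ≤ N * b := by
      rw [hNT, hb, mul_div_assoc', div_le_div_iff₀ (by norm_num) hnpos]
      nlinarith
    linarith
  let U : ℕ → ℝ := fun j => (1 / 2 - ρ + G / 2) * expGap A μ P Q I (s0 n + (K + j)) +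
    3 / 2 * ρ ^ 2 * A.Lγ * expDist A μ P Q I (s0 n + (K + j))
  have hrec : ∀ j, (1 + ρ / 2) * U (j + 1) ≤ U j := by
    intro j
    have h := hA.expGap_geom hn hI hμ hP hsc (hθ'' (K + j) (by omega))
    rw [hβ _ (by omega), hα'' _ (by omega), hT, epochLength_late, ← hN, ← hG] at h
    have h1 := hA.expGap_nonneg (Q := Q) (I := I) hμ hP (s0 n + (K + j) + 1)
    have h2 := expDist_nonneg (A := A) (μ := μ) (P := P) (Q := Q) (I := I) (s0 n + (K + j) + 1)
    have h3 : 3 / 2 * ρ ^ 2 * A.Lγ * (1 + ρ / 2) * expDist A μ P Q I (s0 n + (K + j) + 1) ≤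
        3 / 2 * ρ ^ 2 * A.Lγ * (1 + b) ^ N * expDist A μ P Q I (s0 n + (K + j) + 1) := by gcongr
    have h4 : (1 + ρ / 2) * (1 / 2 - ρ + G / 2) ≤ 1 / 2 - ρ + (1 / 2 + ρ) * G := by
      nlinarith
    have h5 := mul_le_mul_of_nonneg_right h4 h1
    have e : s0 n + (K + (j + 1)) = s0 n + (K + j) + 1 := by omega
    simp only [U, e]
    linarith
  have hlin := linear_rate (by positivity) hrec j
  have hw := hA.sublinear_phase hn hI hμ hP hsc hT hα hθ hα' hθ' le_rfl
  have hU0 : U 0 ≤ 3 * ρ ^ 2 * A.D0 := by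
    have h1 := hA.expGap_nonneg (Q := Q) (I := I) hμ hP (s0 n + K)
    have h2 := expDist_nonneg (A := A) (μ := μ) (P := P) (Q := Q) (I := I) (s0 n + K)
    have h3 : 2 ^ 2 ≤ (ρ * (K + 5)) ^ 2 := pow_le_pow_left₀ (by norm_num) hK 2
    have h4 := mul_le_mul_of_nonneg_left hw (by positivity : 0 ≤ 3 * ρ ^ 2)
    have h5 : (1 / 2 - ρ + G / 2) ≤ 3 * (ρ * (K + 5)) ^ 2 * T / 8 := by
      nlinarith
    have h6 := mul_le_mul_of_nonneg_right h5 h1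
    have h7 : 0 ≤ ρ ^ 2 * A.Lγ * expDist A μ P Q I (s0 n + K) := by positivity
    simp only [U, add_zero]
    linarith
  have hUj : G / 2 * expGap A μ P Q I (s0 n + (K + j)) ≤ U j := by
    have h1 := hA.expGap_nonneg (Q := Q) (I := I) hμ hP (s0 n + (K + j))
    have h2 : 0 ≤ 3 / 2 * ρ ^ 2 * A.Lγ * expDist A μ P Q I (s0 n + (K + j)) :=
      mul_nonneg (by positivity) (expDist_nonneg _)
    have h3 : 0 ≤ (1 / 2 - ρ) * expGap A μ P Q I (s0 n + (K + j)) :=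
      mul_nonneg (by linarith) h1
    simp only [U]; linarith
  have h1 := hA.expGap_nonneg (Q := Q) (I := I) hμ hP (s0 n + (K + j))
  have h5 : (1 + ρ / 2) ^ j * (G / 2 * expGap A μ P Q I (s0 n + (K + j))) ≤ U 0 :=
    (mul_le_mul_of_nonneg_left hUj (by positivity)).trans hlin
  have h6 : (1 + ρ / 2) ^ j * (n * expGap A μ P Q I (s0 n + (K + j))) ≤
      (1 + ρ / 2) ^ j * (2 * G * expGap A μ P Q I (s0 n + (K + j))) := by
    have : (n : ℝ) ≤ 2 * G := by linarith
    gcongr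
  linarith

end Instance.Assumptions

/-! ### From the penalized gap to optimality -/

namespace Instance.Assumptions

variable {n d m : ℕ} {A : Instance n d m} {μ : ℝ} {P : Schedule} {Ω : Type*} [MeasurableSpace Ω]
  {Q : Measure Ω} [IsProbabilityMeasure Q] {I : ℕ → ℕ → Ω → Fin n}
  (hA : A.Assumptions) (hI : UniformSampling Q I) (hμ : 0 ≤ μ)
  (hP : ∀ s, 1 ≤ s → P.IsValid A.Lγ s)

include hA hI hμ hP

/-- A small expected penalized gap gives all the accuracy guarantees. -/
lemma attains {ε : ℝ} {S : ℕ} (hgap : expGap A μ P Q I S ≤ ε) :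
    Attains A Q (fun ω => (outerState A μ P S fun p => I p.1 p.2 ω).xt) ε := by
  have hmem : ∀ ω, (outerState A μ P S fun p => I p.1 p.2 ω).xt ∈ A.K :=
    fun ω => hA.outerState_xt_mem hμ hP S _
  have hobj := integrable_outerState (A := A) (μ := μ) (P := P) hI (fun o => A.obj o.xt) S
  have hviol := integrable_outerState (A := A) (μ := μ) (P := P) hI (fun o => A.viol o.xt) S
  have hF := integrable_outerState (A := A) (μ := μ) (P := P) hI (fun o => A.F o.xt) S
  have hgapint := integrable_outerState (A := A) (μ := μ) (P := P) hI (fun o => A.gap o.xt) S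
  have hg := fun k => integrable_outerState (A := A) (μ := μ) (P := P) hI
    (fun o => max (A.g k o.xt) 0) S
  have h1 : (∫ ω, A.obj (outerState A μ P S fun p => I p.1 p.2 ω).xt ∂Q) - A.obj A.xs ≤ ε := by
    have e : (∫ ω, (A.obj (outerState A μ P S fun p => I p.1 p.2 ω).xt - A.obj A.xs) ∂Q) =
        (∫ ω, A.obj (outerState A μ P S fun p => I p.1 p.2 ω).xt ∂Q) - A.obj A.xs := by
      rw [integral_sub hobj (integrable_const _)]; simp
    rw [← e]
    exact (integral_mono (hobj.sub (integrable_const _)) hgapint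
      fun ω => hA.obj_sub_le_gap _).trans hgap
  have h2 : (A.γ - A.Bt / A.nu) *
      ∫ ω, A.viol (outerState A μ P S fun p => I p.1 p.2 ω).xt ∂Q ≤ ε := by
    rw [← integral_const_mul]
    exact (integral_mono (hviol.const_mul _) hgapint
      fun ω => hA.penalty_mul_viol_le_gap (hmem ω)).trans hgap
  refine ⟨hmem, hobj, hviol, ?_, h1, h2, fun hpen => ⟨hmem, hobj, hg, h1, ?_⟩⟩
  · have e : expGap A μ P Q I S =
        (∫ ω, A.F (outerState A μ P S fun p => I p.1 p.2 ω).xt ∂Q) - A.F A.xs := by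
      unfold expGap gap
      rw [integral_sub hF (integrable_const _)]; simp
    rwa [← e]
  · refine le_trans ?_ h2
    have hv0 : 0 ≤ ∫ ω, A.viol (outerState A μ P S fun p => I p.1 p.2 ω).xt ∂Q :=
      integral_nonneg fun _ => viol_nonneg _
    calc ∑ k, ∫ ω, max (A.g k (outerState A μ P S fun p => I p.1 p.2 ω).xt) 0 ∂Q
        ≤ ∑ _k : Fin m, ∫ ω, A.viol (outerState A μ P S fun p => I p.1 p.2 ω).xt ∂Q :=
          Finset.sum_le_sum fun k _ => integral_mono (hg k) hviol fun ω =>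
            max_le (le_maxPos (fun k => A.g k _) k) (viol_nonneg _)
      _ = m * ∫ ω, A.viol (outerState A μ P S fun p => I p.1 p.2 ω).xt ∂Q := by simp
      _ ≤ _ := by gcongr; linarith

lemma expected_sq_dist_le (hμ0 : 0 < μ) (hsc : StrongConvexOn Set.univ μ A.favg) {ε : ℝ} {S : ℕ}
    (hgap : expGap A μ P Q I S ≤ ε) :
    ∫ ω, ‖(outerState A μ P S fun p => I p.1 p.2 ω).xt - A.xs‖ ^ 2 ∂Q ≤ 2 * ε / μ := by
  have h1 := integrable_outerState (A := A) (μ := μ) (P := P) hI (fun o => ‖o.xt - A.xs‖ ^ 2) S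
  have h2 := integrable_outerState (A := A) (μ := μ) (P := P) hI (fun o => A.gap o.xt) S
  have h3 := (integral_mono (h1.const_mul (μ / 2)) h2
      fun ω => hA.quadratic_growth hsc (hA.outerState_xt_mem hμ hP S _)).trans hgap
  rw [integral_const_mul] at h3
  rw [le_div_iff₀ hμ0]
  linarith

end Instance.Assumptions

/-! ### The parameter schedules -/

section Schedules

variable {n : ℕ} {L μ : ℝ}

lemma alphaConvex_early {s : ℕ} (hs : s < s0 n) : alphaConvex n (s + 1) = 1 / 2 := by
  rw [alphaConvex, if_pos (by omega)]

lemma alphaConvex_late (k : ℕ) : alphaConvex n (s0 n + k + 1) = 2 / ((k : ℝ) + 5) := by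
  rw [alphaConvex, if_neg (by omega)]
  push_cast
  congr 1
  ring

lemma two_div_le_half (k : ℕ) : 2 / ((k : ℝ) + 5) ≤ 1 / 2 := by
  have hk : (0 : ℝ) ≤ k := Nat.cast_nonneg k
  rw [div_le_div_iff₀ (by positivity) (by norm_num)]
  linarith

lemma scheduleConvex_isValid (hL : 0 < L) {s : ℕ} (hs : 1 ≤ s) :
    (scheduleConvex n L).IsValid L s := by
  have h : 0 < alphaConvex n s ∧ alphaConvex n s ≤ 1 / 2 := by
    rcases le_or_gt s (s0 n) with h | h
    · rw [alphaConvex, if_pos h]; norm_num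
    · obtain ⟨k, rfl⟩ : ∃ k, s = s0 n + k + 1 := ⟨s - s0 n - 1, by omega⟩
      rw [alphaConvex_late]
      exact ⟨by positivity, two_div_le_half k⟩
  exact Schedule.isValid_plain hL h.1 h.2 rfl rfl (epochLength_pos n s) fun t => rfl

lemma alphaStrong_early {κ : ℝ} {s : ℕ} (hs : s < s0 n) : alphaStrong n κ (s + 1) = 1 / 2 := by
  rw [alphaStrong, if_pos (by omega)]

lemma alphaStrong_late (κ : ℝ) (k : ℕ) : alphaStrong n κ (s0 n + k + 1) =
    max (2 / ((k : ℝ) + 5)) (min (√(n / (3 * κ))) (1 / 2)) := by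
  rw [alphaStrong, if_neg (by omega)]
  push_cast
  congr 2
  ring

lemma alphaStrong_of_le {κ : ℝ} (hκ : 0 < κ) (hn : 3 * κ / 4 ≤ n) (s : ℕ) :
    alphaStrong n κ (s + 1) = 1 / 2 := by
  rcases lt_or_ge s (s0 n) with h | h
  · exact alphaStrong_early h
  · obtain ⟨k, rfl⟩ : ∃ k, s = s0 n + k := ⟨s - s0 n, by omega⟩
    rw [alphaStrong_late, min_eq_right, max_eq_right (two_div_le_half k)]
    apply Real.le_sqrt_of_sq_le
    rw [le_div_iff₀ (by positivity)]
    linarith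

/-- The constant value `√(n / (3 κ))` of `α` equals `2 / r` for `r = √(12 κ / n)`, which is where
`2 / (k + 5)` falls below it. -/
lemma sqrt_mul_sqrt_eq_two {κ : ℝ} (hκ : 0 < κ) (hn : 1 ≤ n) :
    √(n / (3 * κ)) * √(12 * κ / n) = 2 := by
  have hn' : (0 : ℝ) < n := by exact_mod_cast hn
  rw [← Real.sqrt_mul (by positivity)]
  have : n / (3 * κ) * (12 * κ / n) = 2 ^ 2 := by field_simp; norm_num
  rw [this, Real.sqrt_sq (by norm_num)]

lemma sqrt_lt_half {κ : ℝ} (hκ : 0 < κ) (hn : (n : ℝ) < 3 * κ / 4) : √(n / (3 * κ)) < 1 / 2 := by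
  rw [Real.sqrt_lt' (by norm_num), div_lt_iff₀ (by positivity)]
  linarith

lemma alphaStrong_plain {κ : ℝ} (hκ : 0 < κ) (hn : 1 ≤ n) {k : ℕ}
    (hk : (k : ℝ) + 5 ≤ √(12 * κ / n)) :
    alphaStrong n κ (s0 n + k + 1) = 2 / ((k : ℝ) + 5) := by
  rw [alphaStrong_late]
  apply max_eq_left
  refine (min_le_left _ _).trans ?_
  rw [le_div_iff₀ (by positivity), ← sqrt_mul_sqrt_eq_two hκ hn]
  gcongr

lemma alphaStrong_geom {κ : ℝ} (hκ : 0 < κ) (hn : 1 ≤ n) (hnκ : (n : ℝ) < 3 * κ / 4) {k : ℕ}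
    (hk : √(12 * κ / n) ≤ (k : ℝ) + 5) :
    alphaStrong n κ (s0 n + k + 1) = √(n / (3 * κ)) := by
  rw [alphaStrong_late, min_eq_left (sqrt_lt_half hκ hnκ).le]
  apply max_eq_right
  rw [div_le_iff₀ (by positivity), ← sqrt_mul_sqrt_eq_two hκ hn]
  gcongr

lemma thetaStrong_early {s : ℕ} (hs : s < s0 n) (t : ℕ) :
    (scheduleStrong n L μ).θ (s + 1) t = thetaPlain ((scheduleStrong n L μ).α (s + 1))
      ((scheduleStrong n L μ).β (s + 1)) (1 / 2) ((scheduleStrong n L μ).T (s + 1)) t := by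
  simp only [scheduleStrong]
  rw [if_pos (Or.inl (by omega))]

lemma thetaStrong_plain (hnκ : (n : ℝ) < 3 * (L / μ) / 4) {k : ℕ}
    (hk : (k : ℝ) + 5 ≤ √(12 * (L / μ) / n)) (t : ℕ) :
    (scheduleStrong n L μ).θ (s0 n + k + 1) t =
      thetaPlain ((scheduleStrong n L μ).α (s0 n + k + 1))
        ((scheduleStrong n L μ).β (s0 n + k + 1)) (1 / 2)
        ((scheduleStrong n L μ).T (s0 n + k + 1)) t := by
  simp only [scheduleStrong]
  rw [if_pos (Or.inr ⟨by push_cast; linarith, hnκ⟩)]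

lemma thetaStrong_geom {k : ℕ}
    (hk : 3 * (L / μ) / 4 ≤ n ∨ √(12 * (L / μ) / n) < (k : ℝ) + 5) (t : ℕ) :
    (scheduleStrong n L μ).θ (s0 n + k + 1) t =
      thetaGeom μ ((scheduleStrong n L μ).α (s0 n + k + 1))
        ((scheduleStrong n L μ).β (s0 n + k + 1)) (1 / 2)
        ((scheduleStrong n L μ).T (s0 n + k + 1)) t := by
  simp only [scheduleStrong]
  rw [if_neg]
  rintro (h | ⟨h1, h2⟩)
  · omega
  · rcases hk with hk | hk
    · linarith
    · push_cast at h1; linarith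

lemma scheduleStrong_isValid (hL : 0 < L) (hμ : 0 < μ) (hn : 1 ≤ n) {s : ℕ} (hs : 1 ≤ s) :
    (scheduleStrong n L μ).IsValid L s := by
  have hκ : 0 < L / μ := by positivity
  have hn' : (0 : ℝ) < n := by exact_mod_cast hn
  have hn1 : (1 : ℝ) ≤ n := by exact_mod_cast hn
  obtain ⟨s, rfl⟩ : ∃ r, s = r + 1 := ⟨s - 1, by omega⟩
  rcases lt_or_ge s (s0 n) with h | h
  · have hα : (scheduleStrong n L μ).α (s + 1) = 1 / 2 := alphaStrong_early h
    exact Schedule.isValid_plain hL (by rw [hα]; norm_num) (by rw [hα]) rfl rfl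
      (epochLength_pos n _) (thetaStrong_early h)
  obtain ⟨k, rfl⟩ : ∃ k, s = s0 n + k := ⟨s - s0 n, by omega⟩
  rcases le_or_gt (3 * (L / μ) / 4) n with hnκ | hnκ
  · have hα : (scheduleStrong n L μ).α (s0 n + k + 1) = 1 / 2 := alphaStrong_of_le hκ hnκ _
    exact Schedule.isValid_geom hL hμ.le (by rw [hα]; norm_num) (by rw [hα]) rfl rfl
      (epochLength_pos n _) (thetaStrong_geom (Or.inl hnκ)) (by rw [hα]; norm_num)
  rcases le_or_gt ((k : ℝ) + 5) (√(12 * (L / μ) / n)) with hk | hk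
  · have hα : (scheduleStrong n L μ).α (s0 n + k + 1) = 2 / ((k : ℝ) + 5) :=
      alphaStrong_plain hκ hn hk
    exact Schedule.isValid_plain hL (by rw [hα]; positivity) (by rw [hα]; exact two_div_le_half k)
      rfl rfl (epochLength_pos n _) (thetaStrong_plain hnκ hk)
  · have hα : (scheduleStrong n L μ).α (s0 n + k + 1) = √(n / (3 * (L / μ))) :=
      alphaStrong_geom hκ hn hnκ hk.le
    have hρ0 : 0 < √(n / (3 * (L / μ))) := by positivity
    have hρ := sqrt_lt_half hκ hnκ
    refine Schedule.isValid_geom hL hμ.le (by rw [hα]; exact hρ0) (by rw [hα]; exact hρ.le) rfl rfl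
      (epochLength_pos n _) (thetaStrong_geom (Or.inr hk)) ?_
    have hβ : (scheduleStrong n L μ).β (s0 n + k + 1) =
        1 / (3 * (scheduleStrong n L μ).α (s0 n + k + 1) * L) := rfl
    rw [hβ, hα]
    set ρ := √(n / (3 * (L / μ))) with hρdef
    -- `μ β = ρ / n` is at most `1 / 2`
    have hsq : ρ ^ 2 = n / (3 * (L / μ)) := Real.sq_sqrt (by positivity)
    have hb : μ * (1 / (3 * ρ * L)) = ρ / n := by
      have : 3 * L * ρ ^ 2 = n * μ := by rw [hsq]; field_simp
      rw [mul_one_div, div_eq_div_iff (by positivity) (by positivity)]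
      linarith
    have hb1 : ρ / n ≤ 1 / 2 := by
      rw [div_le_iff₀ hn']; nlinarith
    rw [hb]
    nlinarith

end Schedules

/-! ### Choosing the number of epochs -/

lemma one_le_log_two_mul {x : ℝ} (hx : 2 ≤ x) : 1 ≤ 2 * Real.log x := by
  have h1 := Real.log_two_gt_d9
  have h2 := Real.log_le_log (by norm_num) hx
  linarith

/-- The number of epochs of the warm-up phase needed for the relative accuracy `1 / x`. -/
lemma early_epochs {n : ℕ} {x : ℝ} (hx : 1 ≤ x) (hn : x ≤ n ∨ x < 2) :
    Nat.log 2 ⌊x⌋₊ ≤ s0 n ∧ x ≤ 2 * 2 ^ Nat.log 2 ⌊x⌋₊ ∧ (2 : ℝ) ^ Nat.log 2 ⌊x⌋₊ ≤ x ∧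
      (x < 2 → Nat.log 2 ⌊x⌋₊ = 0) ∧
      n * (Nat.log 2 ⌊x⌋₊ : ℝ) + (2 ^ Nat.log 2 ⌊x⌋₊ - 1) ≤ 4 * (n * Real.log x) := by
  have hfl : 1 ≤ ⌊x⌋₊ := Nat.le_floor (by simpa using hx)
  have hflx : (⌊x⌋₊ : ℝ) ≤ x := Nat.floor_le (by linarith)
  have h0 : x < 2 → Nat.log 2 ⌊x⌋₊ = 0 := by
    intro h
    rw [Nat.log_eq_zero_iff]
    left
    exact (Nat.floor_lt (by linarith)).2 (by exact_mod_cast h)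
  have h2 : (2 : ℝ) ^ Nat.log 2 ⌊x⌋₊ ≤ x := by
    refine le_trans ?_ hflx
    exact_mod_cast Nat.pow_log_le_self 2 (by omega)
  have h3 : x ≤ 2 * 2 ^ Nat.log 2 ⌊x⌋₊ := by
    have h4 : ⌊x⌋₊ < 2 ^ (Nat.log 2 ⌊x⌋₊ + 1) := Nat.lt_pow_succ_log_self (by norm_num) _
    have h5 : x < ⌊x⌋₊ + 1 := Nat.lt_floor_add_one x
    have h6 : ((⌊x⌋₊ + 1 : ℕ) : ℝ) ≤ (2 ^ (Nat.log 2 ⌊x⌋₊ + 1) : ℕ) := by exact_mod_cast h4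
    push_cast at h6
    rw [pow_succ] at h6
    linarith
  have hlog0 : 0 ≤ Real.log x := Real.log_nonneg hx
  rcases lt_or_ge x 2 with hx2 | hx2
  · refine ⟨by rw [h0 hx2]; omega, h3, h2, h0, ?_⟩
    rw [h0 hx2]
    norm_num
    positivity
  · have hxn : x ≤ n := hn.resolve_right (by linarith)
    refine ⟨?_, h3, h2, h0, ?_⟩
    · have h7 : ⌊x⌋₊ ≤ n := Nat.floor_le_of_le hxn
      have := Nat.log_mono_right (b := 2) h7
      unfold s0; omega
    · have h8 := Real.log_le_log (by positivity) h2
      rw [Real.log_pow] at h8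
      have h9 := Real.log_two_gt_d9
      have h10 : (0 : ℝ) ≤ Nat.log 2 ⌊x⌋₊ := Nat.cast_nonneg _
      have h11 : (Nat.log 2 ⌊x⌋₊ : ℝ) ≤ 2 * Real.log x := by nlinarith
      have h12 := one_le_log_two_mul hx2
      have hn0 : (0 : ℝ) ≤ n := Nat.cast_nonneg n
      have h13 := mul_le_mul_of_nonneg_left h11 hn0
      have h14 := mul_le_mul_of_nonneg_left h12 hn0
      linarith

lemma mul_sqrt_div {n x : ℝ} (hn : 0 < n) (hx : n < x) :
    n * √(x / n) = √(n * x) ∧ n ≤ √(n * x) ∧ 1 < √(x / n) := by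
  have h1 : 1 < √(x / n) := by
    rw [Real.lt_sqrt (by norm_num), lt_div_iff₀ hn]; linarith
  have h2 : n * √(x / n) = √(n * x) := by
    have : n * x = n ^ 2 * (x / n) := by field_simp
    rw [this, Real.sqrt_mul (by positivity), Real.sqrt_sq hn.le]
  refine ⟨h2, ?_, h1⟩
  rw [← h2]
  nlinarith

lemma le_pow_of_log_le {q x c : ℝ} (hx : 0 < x) (hq : 0 < q) (hc : c ≤ Real.log q) {j : ℕ}
    (hj : Real.log x ≤ c * j) : x ≤ q ^ j := by
  rw [← Real.log_le_log_iff hx (by positivity), Real.log_pow]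
  have : c * j ≤ Real.log q * j := by gcongr
  linarith

/-! ### Accuracy and cost of the first two phases -/

/-- Accuracy and cost when the method stops within the first `s₀` epochs. -/
lemma warmup_bound {n d m : ℕ} {A : Instance n d m} (hA : A.Assumptions) (hn : 1 ≤ n)
    {Ω : Type*} [MeasurableSpace Ω] {Q : Measure Ω} [IsProbabilityMeasure Q]
    {I : ℕ → ℕ → Ω → Fin n} (hI : UniformSampling Q I) {μ : ℝ} (hμ : 0 ≤ μ) {P : Schedule}
    (hP : ∀ s, 1 ≤ s → P.IsValid A.Lγ s) (hsc : StrongConvexOn Set.univ μ A.favg)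
    (hT : P.T = epochLength n) (hα : ∀ s < s0 n, P.α (s + 1) = 1 / 2)
    (hθ : ∀ s < s0 n, ∀ t, P.θ (s + 1) t =
      thetaPlain (P.α (s + 1)) (P.β (s + 1)) (1 / 2) (P.T (s + 1)) t)
    {ε : ℝ} (hε : 0 < ε) (hεD : ε ≤ A.D0) (hx : A.D0 / ε ≤ n ∨ A.D0 / ε < 2) :
    expGap A μ P Q I (Nat.log 2 ⌊A.D0 / ε⌋₊) ≤ ε ∧
      ∀ j, ((outerState A μ P (Nat.log 2 ⌊A.D0 / ε⌋₊) j).sfo : ℝ) ≤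
          4 * (n * Real.log (A.D0 / ε)) ∧
        ((outerState A μ P (Nat.log 2 ⌊A.D0 / ε⌋₊) j).qmo : ℝ) ≤ A.D0 / ε ∧
        (A.D0 / ε < 2 → ((outerState A μ P (Nat.log 2 ⌊A.D0 / ε⌋₊) j).sfo : ℝ) = 0 ∧
          ((outerState A μ P (Nat.log 2 ⌊A.D0 / ε⌋₊) j).qmo : ℝ) = 0) := by
  have hx1 : 1 ≤ A.D0 / ε := by rwa [le_div_iff₀ hε, one_mul]
  obtain ⟨h1, h2, h3, h4, h5⟩ := early_epochs hx1 hx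
  set S := Nat.log 2 ⌊A.D0 / ε⌋₊ with hS
  have hw := hA.warmup_phase (Q := Q) (I := I) hn hI hμ hP hsc hT hα hθ h1
  have hg := hA.expGap_nonneg (Q := Q) (I := I) hμ hP S
  have hd : 0 ≤ 3 / 4 * A.Lγ * expDist A μ P Q I S :=
    mul_nonneg (by have := hA.Lγ_pos; positivity) (expDist_nonneg _)
  refine ⟨?_, fun j => ?_⟩
  · have h6 := mul_le_mul_of_nonneg_right h2 hg
    have hD : 0 < A.D0 := by linarith
    have h7 : A.D0 / ε * expGap A μ P Q I S ≤ A.D0 := by linarith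
    rw [div_mul_eq_mul_div, div_le_iff₀ hε] at h7
    exact le_of_mul_le_mul_left h7 hD
  · obtain ⟨c1, c2⟩ := counts_early A μ hT j h1
    rw [c1, c2]
    refine ⟨h5, by linarith, fun hlt => ?_⟩
    rw [h4 hlt]; simp

/-- Accuracy and cost when the method stops in the phase with `α = 2 / (k + 5)`. -/
lemma sublinear_bound {n d m : ℕ} {A : Instance n d m} (hA : A.Assumptions) (hn : 1 ≤ n)
    {Ω : Type*} [MeasurableSpace Ω] {Q : Measure Ω} [IsProbabilityMeasure Q]
    {I : ℕ → ℕ → Ω → Fin n} (hI : UniformSampling Q I) {μ : ℝ} (hμ : 0 ≤ μ) {P : Schedule}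
    (hP : ∀ s, 1 ≤ s → P.IsValid A.Lγ s) (hsc : StrongConvexOn Set.univ μ A.favg)
    (hT : P.T = epochLength n) (hα : ∀ s < s0 n, P.α (s + 1) = 1 / 2)
    (hθ : ∀ s < s0 n, ∀ t, P.θ (s + 1) t =
      thetaPlain (P.α (s + 1)) (P.β (s + 1)) (1 / 2) (P.T (s + 1)) t)
    {ε : ℝ} (hε : 0 < ε) (hεD : ε ≤ A.D0) (hx : n < A.D0 / ε)
    (hα' : ∀ k < ⌈4 * √(A.D0 / ε / n)⌉₊ - 4, P.α (s0 n + k + 1) = 2 / ((k : ℝ) + 5))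
    (hθ' : ∀ k < ⌈4 * √(A.D0 / ε / n)⌉₊ - 4, ∀ t, P.θ (s0 n + k + 1) t =
      thetaPlain (P.α (s0 n + k + 1)) (P.β (s0 n + k + 1)) (1 / 2) (P.T (s0 n + k + 1)) t) :
    expGap A μ P Q I (s0 n + (⌈4 * √(A.D0 / ε / n)⌉₊ - 4)) ≤ ε ∧
      ∀ j, ((outerState A μ P (s0 n + (⌈4 * √(A.D0 / ε / n)⌉₊ - 4)) j).sfo : ℝ) ≤
          2 * (n * Real.log n) + 11 * √(n * (A.D0 / ε)) ∧
        ((outerState A μ P (s0 n + (⌈4 * √(A.D0 / ε / n)⌉₊ - 4)) j).qmo : ℝ) ≤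
          6 * √(n * (A.D0 / ε)) := by
  have hn' : (0 : ℝ) < n := by exact_mod_cast hn
  have hD : 0 < A.D0 := by linarith
  obtain ⟨e1, e2, e3⟩ := mul_sqrt_div hn' hx
  set x := A.D0 / ε with hxdef
  have hx0 : 0 < x := by linarith
  set c := ⌈4 * √(x / n)⌉₊ with hc
  have hc4 : 4 ≤ c := by
    have : ((4 : ℕ) : ℝ) < c := lt_of_lt_of_le (by push_cast; linarith) (Nat.le_ceil _)
    exact_mod_cast this.le
  have hcast : ((c - 4 : ℕ) : ℝ) = c - 4 := by rw [Nat.cast_sub hc4]; norm_num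
  have hge : 4 * √(x / n) ≤ c := Nat.le_ceil _
  have hlt : (c : ℝ) < 4 * √(x / n) + 1 := Nat.ceil_lt_add_one (by positivity)
  refine ⟨?_, fun j => ?_⟩
  · have h := hA.expGap_sublinear (Q := Q) (I := I) hn hI hμ hP hsc hT hα hθ hα' hθ' le_rfl
    rw [hcast, sub_add_cancel] at h
    have hg := hA.expGap_nonneg (Q := Q) (I := I) hμ hP (s0 n + (c - 4))
    have h1 : 16 * x ≤ (c : ℝ) ^ 2 * n := by
      have h2 : (4 * √(x / n)) ^ 2 ≤ (c : ℝ) ^ 2 := pow_le_pow_left₀ (by positivity) hge 2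
      rw [mul_pow, Real.sq_sqrt (by positivity)] at h2
      have h3 := mul_le_mul_of_nonneg_right h2 hn'.le
      have h4 : 4 ^ 2 * (x / n) * n = 16 * x := by field_simp; norm_num
      linarith
    have h2 := mul_le_mul_of_nonneg_right h1 hg
    have h3 : x * expGap A μ P Q I (s0 n + (c - 4)) ≤ A.D0 := by linarith
    rw [hxdef, div_mul_eq_mul_div, div_le_iff₀ hε] at h3
    exact le_of_mul_le_mul_left h3 hD
  · obtain ⟨c1, c2⟩ := counts_late A μ hT j hn (c - 4)
    rw [hcast] at c1 c2
    have h1 := mul_le_mul_of_nonneg_left hlt.le hn'.le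
    constructor
    · linarith
    · linarith

/-! ### Accuracy and cost of the linearly convergent phases -/

section Strong

variable {n d m : ℕ} {A : Instance n d m} (hA : A.Assumptions) (hn : 1 ≤ n)
  {Ω : Type*} [MeasurableSpace Ω] {Q : Measure Ω} [IsProbabilityMeasure Q]
  {I : ℕ → ℕ → Ω → Fin n} (hI : UniformSampling Q I) {μ : ℝ} (hμ : 0 < μ)
  (hsc : StrongConvexOn Set.univ μ A.favg) {ε : ℝ} (hε : 0 < ε) (hεD : ε ≤ A.D0)

include hA hn hI hμ hsc hε hεD

/-- Accuracy and cost for well-conditioned problems, `n ≥ 3 κ / 4`. -/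
lemma linear_half_bound (hx : n < A.D0 / ε) (hx2 : 2 ≤ A.D0 / ε) (hκ : 3 * (A.Lγ / μ) / 4 ≤ n) :
    expGap A μ (scheduleStrong n A.Lγ μ) Q I
        (s0 n + ⌈5 * Real.log (A.D0 / ε / n)⌉₊) ≤ ε ∧
      ∀ j, ((outerState A μ (scheduleStrong n A.Lγ μ)
            (s0 n + ⌈5 * Real.log (A.D0 / ε / n)⌉₊) j).sfo : ℝ) ≤
          20 * (n * Real.log (A.D0 / ε)) ∧
        ((outerState A μ (scheduleStrong n A.Lγ μ)
            (s0 n + ⌈5 * Real.log (A.D0 / ε / n)⌉₊) j).qmo : ℝ) ≤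
          20 * (n * Real.log (A.D0 / ε)) := by
  have hL := hA.Lγ_pos
  have hn' : (0 : ℝ) < n := by exact_mod_cast hn
  have hn1 : (1 : ℝ) ≤ n := by exact_mod_cast hn
  have hD : 0 < A.D0 := by linarith
  have hP := fun s (hs : 1 ≤ s) => scheduleStrong_isValid (L := A.Lγ) (μ := μ) (n := n) hL hμ hn hs
  set x := A.D0 / ε with hxdef
  have hx0 : 0 < x := by linarith
  have hlog : Real.log (x / n) = Real.log x - Real.log n := Real.log_div hx0.ne' hn'.ne'
  have hlogn : 0 ≤ Real.log n := Real.log_nonneg hn1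
  have hlogxn : 0 ≤ Real.log (x / n) := Real.log_nonneg (by rw [le_div_iff₀ hn']; linarith)
  set c := ⌈5 * Real.log (x / n)⌉₊ with hc
  have hge : 5 * Real.log (x / n) ≤ c := Nat.le_ceil _
  have hlt : (c : ℝ) < 5 * Real.log (x / n) + 1 := Nat.ceil_lt_add_one (by positivity)
  refine ⟨?_, fun j => ?_⟩
  · have h := hA.expGap_linear_half (Q := Q) (I := I) hn hI hμ.le hP hsc rfl
      (fun s => alphaStrong_of_le (by positivity) hκ s) (fun s hs => thetaStrong_early hs)
      (fun k => thetaStrong_geom (Or.inl hκ))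
      (by
        rw [mul_div_assoc', div_div, div_le_iff₀ (by positivity)] at hκ
        linarith) c
    have hg := hA.expGap_nonneg (Q := Q) (I := I) hμ.le hP (s0 n + c)
    have hlog54 : (1 / 5 : ℝ) ≤ Real.log (5 / 4) := by
      have := Real.one_sub_inv_le_log_of_pos (by norm_num : (0 : ℝ) < 5 / 4)
      norm_num at this ⊢
      exact this
    have hpow : x / n ≤ (5 / 4) ^ c :=
      le_pow_of_log_le (by positivity) (by norm_num) hlog54 (by linarith)
    have h1 : x / n * (n * expGap A μ (scheduleStrong n A.Lγ μ) Q I (s0 n + c)) ≤ A.D0 := by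
      refine le_trans ?_ h
      gcongr
    have h2 : x * expGap A μ (scheduleStrong n A.Lγ μ) Q I (s0 n + c) ≤ A.D0 := by
      refine le_trans (le_of_eq ?_) h1
      field_simp
    rw [hxdef, div_mul_eq_mul_div, div_le_iff₀ hε] at h2
    exact le_of_mul_le_mul_left h2 hD
  · obtain ⟨c1, c2⟩ := counts_late A μ (P := scheduleStrong n A.Lγ μ) rfl j hn c
    have h1 := one_le_log_two_mul hx2
    have h2 : 2 * Real.log n + 3 + 2 * (c : ℝ) ≤ 20 * Real.log x := by linarith
    have h3 : (c : ℝ) + 2 ≤ 20 * Real.log x := by linarith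
    have h4 := mul_le_mul_of_nonneg_left h2 hn'.le
    have h5 := mul_le_mul_of_nonneg_left h3 hn'.le
    constructor <;> linarith

/-- Accuracy and cost for ill-conditioned problems when the method runs into the phase with
constant `α`. -/
lemma linear_bound (hκ : n < 3 * (A.Lγ / μ) / 4) :
    expGap A μ (scheduleStrong n A.Lγ μ) Q I (s0 n + (⌊√(12 * (A.Lγ / μ) / n)⌋₊ - 4 +
        ⌈2 * √(12 * (A.Lγ / μ) / n) * Real.log (1 + 4 * (A.D0 / ε) / (A.Lγ / μ))⌉₊)) ≤ ε ∧
      ∀ j, ((outerState A μ (scheduleStrong n A.Lγ μ) (s0 n + (⌊√(12 * (A.Lγ / μ) / n)⌋₊ - 4 +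
          ⌈2 * √(12 * (A.Lγ / μ) / n) * Real.log (1 + 4 * (A.D0 / ε) / (A.Lγ / μ))⌉₊)) j).sfo : ℝ) ≤
          2 * (n * Real.log n) + n * √(12 * (A.Lγ / μ) / n) *
            (4 + 4 * Real.log (1 + 4 * (A.D0 / ε) / (A.Lγ / μ))) ∧
        ((outerState A μ (scheduleStrong n A.Lγ μ) (s0 n + (⌊√(12 * (A.Lγ / μ) / n)⌋₊ - 4 +
          ⌈2 * √(12 * (A.Lγ / μ) / n) * Real.log (1 + 4 * (A.D0 / ε) / (A.Lγ / μ))⌉₊)) j).qmo : ℝ) ≤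
          n * √(12 * (A.Lγ / μ) / n) *
            (4 + 4 * Real.log (1 + 4 * (A.D0 / ε) / (A.Lγ / μ))) := by
  have hL := hA.Lγ_pos
  have hn' : (0 : ℝ) < n := by exact_mod_cast hn
  have hD : 0 < A.D0 := by linarith
  have hx : 0 < A.D0 / ε := div_pos hD hε
  have hP := fun s (hs : 1 ≤ s) => scheduleStrong_isValid (L := A.Lγ) (μ := μ) (n := n) hL hμ hn hs
  set x := A.D0 / ε with hxdef
  set κ := A.Lγ / μ with hκdef
  have hκ0 : 0 < κ := by positivity
  set r := √(12 * κ / n) with hr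
  set ρ := √(n / (3 * κ)) with hρdef
  have hρ0 : 0 < ρ := by positivity
  have hρ : ρ < 1 / 2 := sqrt_lt_half hκ0 hκ
  have hρr : ρ * r = 2 := sqrt_mul_sqrt_eq_two hκ0 hn
  have hρsq : ρ ^ 2 = n / (3 * κ) := Real.sq_sqrt (by positivity)
  have hr4 : 4 < r := by
    by_contra hcon
    push Not at hcon
    have : ρ * r ≤ ρ * 4 := by gcongr
    linarith
  have hfl4 : 4 ≤ ⌊r⌋₊ := Nat.le_floor (by push_cast; exact hr4.le)
  set K := ⌊r⌋₊ - 4 with hK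
  have hKcast : (K : ℝ) = ⌊r⌋₊ - 4 := by rw [hK, Nat.cast_sub hfl4]; norm_num
  have hflle : (⌊r⌋₊ : ℝ) ≤ r := Nat.floor_le (by linarith)
  have hfllt : r < ⌊r⌋₊ + 1 := Nat.lt_floor_add_one r
  have hlow : ∀ k < K, (k : ℝ) + 5 ≤ r := by
    intro k hk
    have : ((k + 1 : ℕ) : ℝ) ≤ K := by exact_mod_cast hk
    push_cast at this
    linarith
  have hhigh : ∀ k, K ≤ k → r < (k : ℝ) + 5 := by
    intro k hk
    have : (K : ℝ) ≤ k := by exact_mod_cast hk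
    linarith
  set Λ := Real.log (1 + 4 * x / κ) with hΛ
  have hy : 0 < 4 * x / κ := by positivity
  have hΛ0 : 0 ≤ Λ := Real.log_nonneg (by linarith)
  set c := ⌈2 * r * Λ⌉₊ with hc
  have hge : 2 * r * Λ ≤ c := Nat.le_ceil _
  have hlt : (c : ℝ) < 2 * r * Λ + 1 := Nat.ceil_lt_add_one (by positivity)
  refine ⟨?_, fun j => ?_⟩
  · have h := hA.expGap_linear (Q := Q) (I := I) hn hI hμ.le hP hsc rfl hρ0 hρ
      (by rw [hρsq, hκdef]; field_simp)
      (fun s hs => alphaStrong_early hs) (fun s hs => thetaStrong_early hs) (K := K)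
      (by
        rw [← hρr]
        have := (hhigh K le_rfl).le
        gcongr)
      (fun k hk => alphaStrong_plain hκ0 hn (hlow k hk))
      (fun k hk => thetaStrong_plain hκ (hlow k hk))
      (fun k hk => alphaStrong_geom hκ0 hn hκ (hhigh k hk).le)
      (fun k hk => thetaStrong_geom (Or.inr (hhigh k hk))) c
    have hg := hA.expGap_nonneg (Q := Q) (I := I) hμ.le hP (s0 n + (K + c))
    have hlogq : ρ / 4 ≤ Real.log (1 + ρ / 2) := by
      have h1 := Real.one_sub_inv_le_log_of_pos (by positivity : 0 < 1 + ρ / 2)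
      have h2 : 1 - (1 + ρ / 2)⁻¹ = (ρ / 2) / (1 + ρ / 2) := by field_simp; ring
      have h3 : ρ / 4 ≤ (ρ / 2) / (1 + ρ / 2) := by
        rw [le_div_iff₀ (by positivity)]; nlinarith
      linarith
    have hpow : 4 * x / κ ≤ (1 + ρ / 2) ^ c := by
      refine le_pow_of_log_le hy (by positivity) hlogq ?_
      have h1 : Real.log (4 * x / κ) ≤ Λ := Real.log_le_log hy (by linarith)
      have h2 := mul_le_mul_of_nonneg_left hge (by positivity : 0 ≤ ρ / 4)
      have h3 : ρ / 4 * (2 * r * Λ) = Λ := by linear_combination (Λ / 2) * hρr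
      linarith
    have h1 : 4 * x / κ * (n * expGap A μ (scheduleStrong n A.Lγ μ) Q I (s0 n + (K + c))) ≤
        12 * ρ ^ 2 * A.D0 := by
      refine le_trans ?_ h
      gcongr
    rw [hρsq] at h1
    have h2 : x * expGap A μ (scheduleStrong n A.Lγ μ) Q I (s0 n + (K + c)) ≤ A.D0 := by
      have hp : 0 < 4 * n / κ := by positivity
      refine le_of_mul_le_mul_left ?_ hp
      refine le_trans (le_of_eq ?_) (h1.trans_eq ?_)
      · ring
      · field_simp; norm_num
    rw [hxdef, div_mul_eq_mul_div, div_le_iff₀ hε] at h2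
    exact le_of_mul_le_mul_left h2 hD
  · obtain ⟨c1, c2⟩ := counts_late A μ (P := scheduleStrong n A.Lγ μ) rfl j hn (K + c)
    push_cast at c1 c2
    rw [hKcast] at c1 c2
    have hnr : n * 4 ≤ n * r := by gcongr
    have h1 := mul_le_mul_of_nonneg_left hlt.le hn'.le
    have h2 := mul_le_mul_of_nonneg_left hflle hn'.le
    have h3 : 0 ≤ n * r * Λ := by positivity
    constructor <;> linarith

end Strong

/-- Bounds for the logarithmic factor in `linear_bound`, with `x = D₀ / ε`. -/
lemma log_one_add_le {x κ : ℝ} (hx : 0 < x) (hκ : 0 < κ) :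
    (x ≤ 3 * κ / 4 → Real.log (1 + 4 * x / κ) ≤ 2) ∧
      (3 * κ / 4 ≤ x → Real.log (1 + 4 * x / κ) ≤ 2 + Real.log (4 * x / (3 * κ)) ∧
        0 ≤ Real.log (4 * x / (3 * κ))) := by
  have h4 : Real.log 4 ≤ 2 := by
    have : (4 : ℝ) = 2 ^ 2 := by norm_num
    rw [this, Real.log_pow]
    have := Real.log_two_lt_d9
    push_cast
    linarith
  constructor
  · intro h
    refine le_trans (Real.log_le_log (by positivity) ?_) h4
    have : 4 * x / κ ≤ 3 := by rw [div_le_iff₀ hκ]; linarith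
    linarith
  · intro h
    have hy : 1 ≤ 4 * x / (3 * κ) := by rw [le_div_iff₀ (by positivity)]; linarith
    refine ⟨?_, Real.log_nonneg hy⟩
    have e : 4 * x / κ = 3 * (4 * x / (3 * κ)) := by field_simp
    have h1 : Real.log (1 + 4 * x / κ) ≤ Real.log (4 * (4 * x / (3 * κ))) :=
      Real.log_le_log (by positivity) (by rw [e]; linarith)
    rw [Real.log_mul (by norm_num) (by positivity)] at h1
    linarith

lemma mul_sqrt_twelve {n κ : ℝ} (hn : 0 < n) (hκ : 0 < κ) :
    n * √(12 * κ / n) ≤ 4 * √(n * κ) := by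
  have e : n * √(12 * κ / n) = √(12 * (n * κ)) := by
    have : 12 * (n * κ) = n ^ 2 * (12 * κ / n) := by field_simp
    rw [this, Real.sqrt_mul (by positivity), Real.sqrt_sq hn.le]
  rw [e]
  apply Real.sqrt_le_iff.2
  refine ⟨by positivity, ?_⟩
  rw [mul_pow, Real.sq_sqrt (by positivity)]
  nlinarith [mul_pos hn hκ]

end Varas

open Varas in
theorem theorem3 :
    ∃ C : ℝ, 0 < C ∧
      -- convex case
      (∀ (n : ℕ) (D ε : ℝ), 1 ≤ n → 0 < ε → ε ≤ D →
        ∃ S : ℕ, ∀ (d m : ℕ) (A : Varas.Instance n d m), A.Assumptions → A.D0 = D →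
          ∀ (Ω : Type*) [MeasurableSpace Ω] (Q : Measure Ω) [IsProbabilityMeasure Q]
            (I : ℕ → ℕ → Ω → Fin n), Varas.UniformSampling Q I →
          let out : Ω → Varas.Outer d := fun ω =>
            Varas.run A 0 (Varas.scheduleConvex n A.Lγ) (fun s t => I s t ω) S
          Varas.Attains A Q (fun ω => (out ω).xt) ε ∧
          ∀ ω,
            (D / ε ≤ n →
              ((out ω).sfo : ℝ) ≤ C * (n * Real.log (D / ε)) ∧
              ((out ω).qmo : ℝ) ≤ C * (D / ε)) ∧
            (n < D / ε →
              ((out ω).sfo : ℝ) ≤ C * (n * Real.log n + √(n * D / ε)) ∧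
              ((out ω).qmo : ℝ) ≤ C * √(n * D / ε))) ∧
      -- strongly convex case
      (∀ (n : ℕ) (κ D ε : ℝ), 1 ≤ n → 0 < ε → ε ≤ D →
        ∃ S : ℕ, ∀ (d m : ℕ) (A : Varas.Instance n d m) (μ : ℝ), A.Assumptions → 0 < μ →
          StrongConvexOn Set.univ μ A.favg → A.D0 = D → A.Lγ / μ = κ →
          ∀ (Ω : Type*) [MeasurableSpace Ω] (Q : Measure Ω) [IsProbabilityMeasure Q]
            (I : ℕ → ℕ → Ω → Fin n), Varas.UniformSampling Q I →
          let out : Ω → Varas.Outer d := fun ω =>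
            Varas.run A μ (Varas.scheduleStrong n A.Lγ μ) (fun s t => I s t ω) S
          Varas.Attains A Q (fun ω => (out ω).xt) ε ∧
          Integrable (fun ω => ‖(out ω).xt - A.xs‖ ^ 2) Q ∧
          ∫ ω, ‖(out ω).xt - A.xs‖ ^ 2 ∂Q ≤ 2 * ε / μ ∧
          ∀ ω,
            (D / ε ≤ n ∨ 3 * κ / 4 ≤ n →
              ((out ω).sfo : ℝ) ≤ C * (n * Real.log (D / ε))) ∧
            (n < D / ε → D / ε ≤ 3 * κ / 4 →
              ((out ω).sfo : ℝ) ≤ C * (n * Real.log n + √(n * D / ε))) ∧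
            (n < 3 * κ / 4 → 3 * κ / 4 ≤ D / ε →
              ((out ω).sfo : ℝ) ≤
                C * (n * Real.log n + √(n * κ) * (1 + Real.log (4 * D / (3 * κ * ε))))) ∧
            (D / ε ≤ n →
              ((out ω).qmo : ℝ) ≤ C * (D / ε)) ∧
            (3 * κ / 4 ≤ n → n ≤ D / ε →
              ((out ω).qmo : ℝ) ≤ C * (n * Real.log (D / ε))) ∧
            (n < D / ε → D / ε ≤ 3 * κ / 4 →
              ((out ω).qmo : ℝ) ≤ C * √(n * D / ε)) ∧
            (n < 3 * κ / 4 → 3 * κ / 4 ≤ D / ε →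
              ((out ω).qmo : ℝ) ≤
                C * (n * Real.log n + √(n * κ) * (1 + Real.log (4 * D / (3 * κ * ε)))))) := by
  refine ⟨100, by norm_num, ?_, ?_⟩
  · intro n D ε hn hε hεD
    have hn1 : (1 : ℝ) ≤ n := by exact_mod_cast hn
    have hx1 : 1 ≤ D / ε := by rwa [le_div_iff₀ hε, one_mul]
    have hlogx := Real.log_nonneg hx1
    have hlogn := Real.log_nonneg hn1
    have hnx : 0 ≤ n * Real.log (D / ε) := by positivity
    have hnn : 0 ≤ n * Real.log n := by positivity
    have hsq := Real.sqrt_nonneg (n * (D / ε))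
    rw [mul_div_assoc]
    rcases le_or_gt (D / ε) n with hx | hx
    · refine ⟨Nat.log 2 ⌊D / ε⌋₊, ?_⟩
      rintro d m A hA rfl Ω _ Q _ I hI
      have hP := fun s (hs : 1 ≤ s) => scheduleConvex_isValid (n := n) hA.Lγ_pos hs
      obtain ⟨h1, h2⟩ := warmup_bound hA hn hI le_rfl hP (strongConvexOn_zero.2 hA.favg_convex)
        rfl (fun s hs => alphaConvex_early hs) (fun s hs t => rfl) hε hεD (Or.inl hx)
      refine ⟨hA.attains hI le_rfl hP h1, fun ω => ?_⟩
      obtain ⟨c1, c2, -⟩ := h2 fun p => I p.1 p.2 ω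
      exact ⟨fun _ => ⟨c1.trans (by linarith), c2.trans (by linarith)⟩,
        fun h => absurd h (not_lt.2 hx)⟩
    · refine ⟨s0 n + (⌈4 * √(D / ε / n)⌉₊ - 4), ?_⟩
      rintro d m A hA rfl Ω _ Q _ I hI
      have hP := fun s (hs : 1 ≤ s) => scheduleConvex_isValid (n := n) hA.Lγ_pos hs
      obtain ⟨h1, h2⟩ := sublinear_bound hA hn hI le_rfl hP (strongConvexOn_zero.2 hA.favg_convex)
        rfl (fun s hs => alphaConvex_early hs) (fun s hs t => rfl) hε hεD hx
        (fun k _ => alphaConvex_late k) (fun k _ t => rfl)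
      refine ⟨hA.attains hI le_rfl hP h1, fun ω => ?_⟩
      obtain ⟨c1, c2⟩ := h2 fun p => I p.1 p.2 ω
      exact ⟨fun h => absurd hx (not_lt.2 h), fun _ =>
        ⟨c1.trans (by linarith), c2.trans (by linarith)⟩⟩
  · intro n κ D ε hn hε hεD
    have hn1 : (1 : ℝ) ≤ n := by exact_mod_cast hn
    have hn0 : (0 : ℝ) < n := by linarith
    have hx1 : 1 ≤ D / ε := by rwa [le_div_iff₀ hε, one_mul]
    have hx0 : 0 < D / ε := by linarith
    have hlogx := Real.log_nonneg hx1
    have hlogn := Real.log_nonneg hn1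
    have hnx : 0 ≤ n * Real.log (D / ε) := by positivity
    have hnn : 0 ≤ n * Real.log n := by positivity
    have hsq := Real.sqrt_nonneg (n * (D / ε))
    have hlast : 4 * D / (3 * κ * ε) = 4 * (D / ε) / (3 * κ) := by
      rw [mul_div_assoc', div_div, mul_comm ε]
    rw [mul_div_assoc (n : ℝ) D ε, hlast]
    have hsκ := Real.sqrt_nonneg (n * κ)
    -- it is enough to bound the expected penalized gap and the oracle counts
    suffices H : ∃ S : ℕ, ∀ (d m : ℕ) (A : Instance n d m) (μ : ℝ), A.Assumptions → 0 < μ →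
        StrongConvexOn Set.univ μ A.favg → A.D0 = D → A.Lγ / μ = κ →
        ∀ (Ω : Type _) [MeasurableSpace Ω] (Q : Measure Ω) [IsProbabilityMeasure Q]
          (I : ℕ → ℕ → Ω → Fin n), UniformSampling Q I →
        expGap A μ (scheduleStrong n A.Lγ μ) Q I S ≤ ε ∧
        ∀ j, let o := outerState A μ (scheduleStrong n A.Lγ μ) S j
          (D / ε ≤ n ∨ 3 * κ / 4 ≤ n → (o.sfo : ℝ) ≤ 100 * (n * Real.log (D / ε))) ∧
          (n < D / ε → D / ε ≤ 3 * κ / 4 →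
            (o.sfo : ℝ) ≤ 100 * (n * Real.log n + √(n * (D / ε)))) ∧
          (n < 3 * κ / 4 → 3 * κ / 4 ≤ D / ε →
            (o.sfo : ℝ) ≤
              100 * (n * Real.log n + √(n * κ) * (1 + Real.log (4 * (D / ε) / (3 * κ))))) ∧
          (D / ε ≤ n → (o.qmo : ℝ) ≤ 100 * (D / ε)) ∧
          (3 * κ / 4 ≤ n → n ≤ D / ε → (o.qmo : ℝ) ≤ 100 * (n * Real.log (D / ε))) ∧
          (n < D / ε → D / ε ≤ 3 * κ / 4 → (o.qmo : ℝ) ≤ 100 * √(n * (D / ε))) ∧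
          (n < 3 * κ / 4 → 3 * κ / 4 ≤ D / ε →
            (o.qmo : ℝ) ≤
              100 * (n * Real.log n + √(n * κ) * (1 + Real.log (4 * (D / ε) / (3 * κ))))) by
      obtain ⟨S, hS⟩ := H
      refine ⟨S, fun d m A μ hA hμ hsc hD hκ Ω _ Q _ I hI => ?_⟩
      obtain ⟨h1, h2⟩ := hS d m A μ hA hμ hsc hD hκ Ω Q I hI
      have hP := fun s (hs : 1 ≤ s) =>
        scheduleStrong_isValid (n := n) (μ := μ) hA.Lγ_pos hμ hn hs
      exact ⟨hA.attains hI hμ.le hP h1,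
        Instance.Assumptions.integrable_outerState (A := A) hI (fun o => ‖o.xt - A.xs‖ ^ 2) S,
        hA.expected_sq_dist_le hI hμ.le hP hμ hsc h1, fun ω => h2 fun p => I p.1 p.2 ω⟩
    by_cases hx : D / ε ≤ n ∨ D / ε < 2
    · refine ⟨Nat.log 2 ⌊D / ε⌋₊, ?_⟩
      rintro d m A μ hA hμ hsc rfl rfl Ω _ Q _ I hI
      have hP := fun s (hs : 1 ≤ s) =>
        scheduleStrong_isValid (n := n) (μ := μ) hA.Lγ_pos hμ hn hs
      obtain ⟨h1, h2⟩ := warmup_bound hA hn hI hμ.le hP hsc rfl (fun s hs => alphaStrong_early hs)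
        (fun s hs => thetaStrong_early hs) hε hεD hx
      refine ⟨h1, fun j => ?_⟩
      obtain ⟨c1, c2, c3⟩ := h2 j
      have hκ0 : 0 < A.Lγ / μ := div_pos hA.Lγ_pos hμ
      obtain ⟨-, hlog⟩ := log_one_add_le hx0 hκ0
      refine ⟨fun _ => c1.trans (by linarith), fun h _ => ?_, fun h h' => ?_,
        fun _ => c2.trans (by linarith), fun _ h => ?_, fun h _ => ?_, fun h h' => ?_⟩
      · rw [(c3 (hx.resolve_left (not_le.2 h))).1]; positivity
      · rw [(c3 (hx.resolve_left (not_le.2 (h.trans_le h')))).1]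
        have := (hlog h').2
        positivity
      · rcases lt_or_ge (A.D0 / ε) 2 with h2 | h2
        · rw [(c3 h2).2]; positivity
        · have h3 := hx.resolve_right (not_lt.2 h2)
          have h4 := one_le_log_two_mul h2
          have h5 := mul_le_mul_of_nonneg_left h4 hn0.le
          linarith
      · rw [(c3 (hx.resolve_left (not_le.2 h))).2]; positivity
      · rw [(c3 (hx.resolve_left (not_le.2 (h.trans_le h')))).2]
        have := (hlog h').2
        positivity
    push Not at hx
    obtain ⟨hxn, hx2⟩ := hx
    obtain ⟨e1, e2, e3⟩ := mul_sqrt_div hn0 hxn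
    rcases le_or_gt (3 * κ / 4) n with hκn | hκn
    · refine ⟨s0 n + ⌈5 * Real.log (D / ε / n)⌉₊, ?_⟩
      rintro d m A μ hA hμ hsc rfl rfl Ω _ Q _ I hI
      obtain ⟨h1, h2⟩ := linear_half_bound hA hn hI hμ hsc hε hεD hxn hx2 hκn
      refine ⟨h1, fun j => ?_⟩
      obtain ⟨c1, c2⟩ := h2 j
      exact ⟨fun _ => c1.trans (by linarith), fun h h' => absurd (h.trans_le h') (not_lt.2 hκn),
        fun h => absurd h (not_lt.2 hκn), fun h => absurd hxn (not_lt.2 h),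
        fun _ _ => c2.trans (by linarith), fun h h' => absurd (h.trans_le h') (not_lt.2 hκn),
        fun h => absurd h (not_lt.2 hκn)⟩
    have hκ0 : 0 < κ := by linarith
    obtain ⟨hlog1, hlog2⟩ := log_one_add_le hx0 hκ0
    rcases le_or_gt ((⌈4 * √(D / ε / n)⌉₊ : ℕ) : ℝ) (√(12 * κ / n)) with hr | hr
    · -- the accuracy is reached before `α` becomes constant
      have hxκ : D / ε ≤ 3 * κ / 4 := by
        have h1 : 4 * √(D / ε / n) ≤ √(12 * κ / n) := (Nat.le_ceil _).trans hr
        have h2 : (4 * √(D / ε / n)) ^ 2 ≤ √(12 * κ / n) ^ 2 :=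
          pow_le_pow_left₀ (by positivity) h1 2
        rw [mul_pow, Real.sq_sqrt (by positivity), Real.sq_sqrt (by positivity),
          mul_div_assoc', div_le_div_iff_of_pos_right hn0] at h2
        linarith
      have hsκx : √(n * (D / ε)) ≤ √(n * κ) := by
        apply Real.sqrt_le_sqrt
        gcongr
        linarith
      have hlow : ∀ k < ⌈4 * √(D / ε / n)⌉₊ - 4, (k : ℝ) + 5 ≤ √(12 * κ / n) := by
        intro k hk
        have : ((k + 5 : ℕ) : ℝ) ≤ (⌈4 * √(D / ε / n)⌉₊ : ℕ) := by
          exact_mod_cast (by omega : k + 5 ≤ ⌈4 * √(D / ε / n)⌉₊)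
        push_cast at this
        linarith
      refine ⟨s0 n + (⌈4 * √(D / ε / n)⌉₊ - 4), ?_⟩
      rintro d m A μ hA hμ hsc rfl rfl Ω _ Q _ I hI
      have hP := fun s (hs : 1 ≤ s) =>
        scheduleStrong_isValid (n := n) (μ := μ) hA.Lγ_pos hμ hn hs
      obtain ⟨h1, h2⟩ := sublinear_bound hA hn hI hμ.le hP hsc rfl (fun s hs => alphaStrong_early hs)
        (fun s hs => thetaStrong_early hs) hε hεD hxn
        (fun k hk => alphaStrong_plain hκ0 hn (hlow k hk))
        (fun k hk => thetaStrong_plain hκn (hlow k hk))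
      refine ⟨h1, fun j => ?_⟩
      obtain ⟨c1, c2⟩ := h2 j
      refine ⟨fun h => ?_, fun _ _ => c1.trans (by linarith), fun _ h => c1.trans ?_,
        fun h => absurd hxn (not_lt.2 h), fun h => absurd hκn (not_lt.2 h),
        fun _ _ => c2.trans (by linarith), fun _ h => c2.trans ?_⟩
      · rcases h with h | h <;> linarith
      · have := mul_nonneg hsκ (hlog2 h).2
        linarith
      · have := mul_nonneg hsκ (hlog2 h).2
        linarith
    · -- the last phase is needed, so `D / ε` is at least of the order of `κ`
      have hr0 := Real.sqrt_nonneg (12 * κ / n)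
      have hrx : n * √(12 * κ / n) ≤ 5 * √(n * (D / ε)) := by
        have h1 := Nat.ceil_lt_add_one (by positivity : 0 ≤ 4 * √(D / ε / n))
        have h2 : √(12 * κ / n) ≤ 5 * √(D / ε / n) := by linarith
        have h3 := mul_le_mul_of_nonneg_left h2 hn0.le
        linarith
      have hrκ := mul_sqrt_twelve hn0 hκ0
      have hΛ0 : 0 ≤ Real.log (1 + 4 * (D / ε) / κ) := Real.log_nonneg (by
        have : 0 < 4 * (D / ε) / κ := by positivity
        linarith)
      have b1 : D / ε ≤ 3 * κ / 4 → n * √(12 * κ / n) *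
          (4 + 4 * Real.log (1 + 4 * (D / ε) / κ)) ≤ 60 * √(n * (D / ε)) := by
        intro h
        have h1 := hlog1 h
        calc n * √(12 * κ / n) * (4 + 4 * Real.log (1 + 4 * (D / ε) / κ))
            ≤ 5 * √(n * (D / ε)) * (4 + 4 * 2) := by gcongr
          _ = 60 * √(n * (D / ε)) := by ring
      have b2 : 3 * κ / 4 ≤ D / ε → n * √(12 * κ / n) *
          (4 + 4 * Real.log (1 + 4 * (D / ε) / κ)) ≤
          48 * (√(n * κ) * (1 + Real.log (4 * (D / ε) / (3 * κ)))) := by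
        intro h
        obtain ⟨h1, h2⟩ := hlog2 h
        calc n * √(12 * κ / n) * (4 + 4 * Real.log (1 + 4 * (D / ε) / κ))
            ≤ 4 * √(n * κ) * (12 * (1 + Real.log (4 * (D / ε) / (3 * κ)))) := by
              gcongr; linarith
          _ = 48 * (√(n * κ) * (1 + Real.log (4 * (D / ε) / (3 * κ)))) := by ring
      have b3 : 3 * κ / 4 ≤ D / ε →
          0 ≤ √(n * κ) * (1 + Real.log (4 * (D / ε) / (3 * κ))) := by
        intro h
        have := (hlog2 h).2
        positivity
      refine ⟨s0 n + (⌊√(12 * κ / n)⌋₊ - 4 +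
        ⌈2 * √(12 * κ / n) * Real.log (1 + 4 * (D / ε) / κ)⌉₊), ?_⟩
      rintro d m A μ hA hμ hsc rfl rfl Ω _ Q _ I hI
      obtain ⟨h1, h2⟩ := linear_bound hA hn hI hμ hsc hε hεD hκn
      refine ⟨h1, fun j => ?_⟩
      obtain ⟨c1, c2⟩ := h2 j
      refine ⟨fun h => ?_, fun _ h => c1.trans ?_, fun _ h => c1.trans ?_,
        fun h => absurd hxn (not_lt.2 h), fun h => absurd hκn (not_lt.2 h),
        fun _ h => c2.trans ?_, fun _ h => c2.trans ?_⟩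
      · rcases h with h | h <;> linarith
      · linarith [b1 h]
      · linarith [b2 h, b3 h]
      · linarith [b1 h]
      · linarith [b2 h, b3 h]
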